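/- Let $\Omega\subset\mathbb{R}^n$ be a bounded open set and let $L=-\operatorname{div}(a(x)\nabla)+c(x)$ in $\Omega$ with homogeneous Dirichlet or Neumann (conormal) boundary condition, understood in the weak sense: test and solution space is $H^1_0(\Omega)$ for Dirichlet, $H^1(\Omega)$ for Neumann. Here $a=(a^{ij})$ is measurable and symmetric with $\Lambda^{-1}|\xi|^2\le a^{ij}(x)\xi_i\xi_j\le\Lambda|\xi|^2$ for a.e. $x\in\Omega$ and all $\xi\in\mathbb{R}^n$, for some $\Lambda>0$, and $0\le c\in L^\infty(\Omega)$. Suppose that $L$ has a sequence of eigenvalues and (real, weak) eigenfunctions $(\lambda_k,\phi_k)_{k\ge0}$ such that $\{\phi_k\}$ is an orthonormal basis of $L^2(\Omega)$, and that $W_\tau(x,z)$ is the heat kernel of $L$, measurable in $(\tau,x,z)$, with $W_\tau(x,z)=W_\tau(z,x)\ge0$, that is, for all $\tau>0$ and real $\varphi,\psi\in L^2(\Omega)$ the function $W_\tau(x,z)\varphi(z)\psi(x)$ is integrable on $\Omega\times\Omega$ and $$\sum_{k}e^{-\tau\lambda_k}\int_\Omega\varphi\phi_k\,dx\int_\Omega\psi\phi_k\,dx=\int_\Omega\int_\Omega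 W_\tau(x,z)\varphi(z)\psi(x)\,dz\,dx .$$ For $u\in L^2(\mathbb{R}\times\Omega)$ (complex valued) put $u_k(t)=\int_\Omega u(t,x)\phi_k(x)\,dx$ and let $\widehat{u_k}(\rho)=(2\pi)^{-1/2}\int_{\mathbb{R}}u_k(t)e^{-i\rho t}\,dt$ be its Fourier transform in $L^2(\mathbb{R})$. For $0<s<1$ let $$\operatorname{Dom}(H^s)=\Big\{u\in L^2(\mathbb{R}\times\Omega):\int_{\mathbb{R}}\sum_{k}|i\rho+\lambda_k|^s|\widehat{u_k}(\rho)|^2\,d\rho<\infty\Big\},$$ $$\langle H^su,v\rangle=\langle(\partial_t+L)^su,v\rangle=\int_{\mathbb{R}}\sum_{k}(i\rho+\lambda_k)^s\,\widehat{u_k}(\rho)\,\overline{\widehat{v_k}(\rho)}\,d\rho ,\qquad u,v\in\operatorname{Dom}(H^s),$$ with the principal branch of the power. Then for all $u,v\in\operatorname{Dom}(H^s)$ $$\begin{aligned}\langle H^su,v\rangle&=\int_0^\infty\int_{\mathbb{R}}\int_\Omega\int_\Omega K_s(\tau,x,z)\,\big(u(t-\tau,x)-u(t-\tau,z)\big)\,\overline{\big(v(t,x)-v(t,z)\big)}\,dz\,dx\,dt\,d\tau\\&\quad+\int_0^\infty\bigg[\int_{\mathbb{R}}\int_\Omega\frac{1-e^{-\tau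 L}1(x)}{|\Gamma(-s)|\tau^{1+s}}\,u(t,x)\overline{v(t,x)}\,dx\,dt\\&\qquad\qquad-\int_{\mathbb{R}}\int_\Omega e^{-\tau L}1(x)\,\frac{u(t-\tau,x)-u(t,x)}{|\Gamma(-s)|\tau^{1+s}}\,\overline{v(t,x)}\,dx\,dt\bigg]\,d\tau,\end{aligned}$$ where $$K_s(\tau,x,z)=\frac{W_\tau(x,z)}{2|\Gamma(-s)|\tau^{1+s}},\qquad e^{-\tau L}1(x)=\int_\Omega W_\tau(x,z)\,dz .$$ All these integrals converge absolutely: the integrand of the first one is integrable on $(0,\infty)\times\mathbb{R}\times\Omega\times\Omega$, for each $\tau>0$ the two integrands in the bracket are integrable on $\mathbb{R}\times\Omega$, and the bracket is integrable in $\tau\in(0,\infty)$. -/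

import Mathlib

open MeasureTheory Set
open scoped ENNReal ContDiff FourierTransform ComplexConjugate

noncomputable section

namespace MasterEquation

/-- The Euclidean space of dimension `n`. -/
abbrev Euc (n : ℕ) : Type := EuclideanSpace ℝ (Fin n)

/-- Lebesgue measure on `Ω`. -/
abbrev leb {n : ℕ} (Ω : Set (Euc n)) : Measure (Euc n) := volume.restrict Ω

/-! ### The elliptic operator `L = -div (a ∇) + c` -/

/-- The coefficients of `L`: `a` is measurable, symmetric and uniformly elliptic with constant `Λ`
(hence bounded), and `0 ≤ c ∈ L^∞(Ω)`. -/
structure IsEllipticCoeff {n : ℕ} (Ω : Set (Euc n)) (Λ : ℝ)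
    (a : Euc n → Matrix (Fin n) (Fin n) ℝ) (c : Euc n → ℝ) : Prop where
  pos : 0 < Λ
  meas_a : ∀ i j, AEMeasurable (fun x => a x i j) (leb Ω)
  symm : ∀ᵐ x ∂leb Ω, ∀ i j, a x i j = a x j i
  elliptic : ∀ᵐ x ∂leb Ω, ∀ ξ : Euc n,
    Λ⁻¹ * ‖ξ‖ ^ 2 ≤ ∑ i, ∑ j, a x i j * ξ i * ξ j ∧
      ∑ i, ∑ j, a x i j * ξ i * ξ j ≤ Λ * ‖ξ‖ ^ 2
  meas_c : AEMeasurable c (leb Ω)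
  nonneg_c : ∀ᵐ x ∂leb Ω, 0 ≤ c x
  bdd_c : ∃ M : ℝ, ∀ᵐ x ∂leb Ω, c x ≤ M

/-- `η ∈ C_c^∞(Ω)`. -/
def IsTest {n : ℕ} (Ω : Set (Euc n)) (η : Euc n → ℝ) : Prop :=
  ContDiff ℝ ∞ η ∧ HasCompactSupport η ∧ tsupport η ⊆ Ω

/-- `f ∈ H¹(Ω)`, with weak gradient `g`. -/
def MemH1 {n : ℕ} (Ω : Set (Euc n)) (f : Euc n → ℝ) (g : Euc n → Euc n) : Prop :=
  MemLp f 2 (leb Ω) ∧ MemLp g 2 (leb Ω) ∧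
    ∀ η, IsTest Ω η → ∀ i : Fin n,
      ∫ x in Ω, f x * fderiv ℝ η x (EuclideanSpace.single i 1) = - ∫ x in Ω, g x i * η x

/-- `f ∈ H¹₀(Ω)`, the closure of `C_c^∞(Ω)` in `H¹(Ω)`, with weak gradient `g`. -/
def MemH10 {n : ℕ} (Ω : Set (Euc n)) (f : Euc n → ℝ) (g : Euc n → Euc n) : Prop :=
  MemH1 Ω f g ∧ ∀ ε : ℝ≥0∞, 0 < ε → ∃ η, IsTest Ω η ∧
    eLpNorm (fun x => f x - η x) 2 (leb Ω) < ε ∧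
      eLpNorm (fun x => g x - gradient η x) 2 (leb Ω) < ε

/-- The homogeneous boundary condition attached to `L`. -/
inductive BoundaryCondition : Type
  | dirichlet
  | neumann

/-- `f`, with weak gradient `g`, lies in the form domain of `L`: this is `H¹₀(Ω)` for the Dirichlet
condition and `H¹(Ω)` for the Neumann (conormal) condition. -/
def FormDomain {n : ℕ} (Ω : Set (Euc n)) :
    BoundaryCondition → (Euc n → ℝ) → (Euc n → Euc n) → Prop
  | .dirichlet => MemH10 Ω
  | .neumann => MemH1 Ω

/-- `L φ = lam φ` in the weak sense, with the given boundary condition. -/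
def IsEigenfunction {n : ℕ} (Ω : Set (Euc n)) (a : Euc n → Matrix (Fin n) (Fin n) ℝ)
    (c : Euc n → ℝ) (bc : BoundaryCondition) (lam : ℝ) (φ : Euc n → ℝ) : Prop :=
  ∃ g, FormDomain Ω bc φ g ∧ ∀ w h, FormDomain Ω bc w h →
    (∫ x in Ω, ∑ i, ∑ j, a x i j * g x j * h x i) + ∫ x in Ω, c x * φ x * w x =
      lam * ∫ x in Ω, φ x * w x

/-- `W` is the (symmetric, nonnegative) heat kernel of `L`, where `phi` is an orthonormal basis of
`L²(Ω)` made of eigenfunctions of `L` with eigenvalues `lam`: for every `τ > 0`,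
`⟨e^{-τL} f, g⟩ = ∑ₖ e^{-τ lamₖ} fₖ gₖ = ∬ W_τ(x, z) f(z) g(x) dz dx` on `L²(Ω)`. Only the values of
`W` on `(0, ∞) × Ω × Ω` matter. -/
structure IsHeatKernel {n : ℕ} {Ω : Set (Euc n)} (lam : ℕ → ℝ)
    (phi : HilbertBasis ℕ ℝ (Lp ℝ 2 (leb Ω))) (W : ℝ → Euc n → Euc n → ℝ) : Prop where
  meas : Measurable fun p : ℝ × Euc n × Euc n => W p.1 p.2.1 p.2.2
  symm : ∀ τ, 0 < τ → ∀ x ∈ Ω, ∀ z ∈ Ω, W τ x z = W τ z x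
  nonneg : ∀ τ, 0 < τ → ∀ x ∈ Ω, ∀ z ∈ Ω, 0 ≤ W τ x z
  integrable : ∀ τ, 0 < τ → ∀ f g : Lp ℝ 2 (leb Ω),
    Integrable (fun p : Euc n × Euc n => W τ p.1 p.2 * f p.2 * g p.1) ((leb Ω).prod (leb Ω))
  repr : ∀ τ, 0 < τ → ∀ f g : Lp ℝ 2 (leb Ω),
    HasSum (fun k => Real.exp (-τ * lam k) * (∫ x in Ω, f x * phi k x) * ∫ x in Ω, g x * phi k x)
      (∫ x in Ω, ∫ z in Ω, W τ x z * f z * g x)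

/-- `e^{-τL} 1 (x) = ∫_Ω W_τ(x, z) dz`. -/
def heatOne {n : ℕ} (Ω : Set (Euc n)) (W : ℝ → Euc n → Euc n → ℝ) (τ : ℝ) (x : Euc n) : ℝ :=
  ∫ z in Ω, W τ x z

/-- `K_s(τ, x, z) = W_τ(x, z) / (2 |Γ(-s)| τ^{1+s})`. -/
def masterKernel {n : ℕ} (W : ℝ → Euc n → Euc n → ℝ) (s τ : ℝ) (x z : Euc n) : ℝ :=
  W τ x z / (2 * |Real.Gamma (-s)| * τ ^ (1 + s))

/-! ### The fractional parabolic operator `H^s = (∂_t + L)^s` -/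

/-- The complex Hilbert space `L²(ℝ × Ω)`. -/
abbrev L2RΩ {n : ℕ} (Ω : Set (Euc n)) : Type :=
  Lp ℂ 2 ((volume : Measure ℝ).prod (leb Ω))

/-- `t ↦ ∫_Ω u(t, x) φ(x) dx`. -/
def coeff {n : ℕ} {Ω : Set (Euc n)} (φ : Lp ℝ 2 (leb Ω)) (u : L2RΩ Ω) (t : ℝ) : ℂ :=
  ∫ x in Ω, u (t, x) * (φ x : ℂ)

theorem memLp_coeff {n : ℕ} {Ω : Set (Euc n)} (φ : Lp ℝ 2 (leb Ω)) (u : L2RΩ Ω) :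
    MemLp (coeff φ u) 2 volume := by
  have hu := Lp.memLp u
  have hφ := Lp.memLp φ
  have hum : AEStronglyMeasurable (fun p : ℝ × Euc n => u p)
    ((volume : Measure ℝ).prod (leb Ω)) := hu.1
  have hφm : AEStronglyMeasurable (fun p : ℝ × Euc n => ((φ p.2 : ℝ) : ℂ))
      ((volume : Measure ℝ).prod (leb Ω)) :=
    Complex.continuous_ofReal.comp_aestronglyMeasurable hφ.1.comp_snd
  refine ⟨(hum.mul hφm).integral_prod_right', ?_⟩
  rw [eLpNorm_lt_top_iff_lintegral_rpow_enorm_lt_top (by norm_num) (by norm_num)]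
  have hu2 := (eLpNorm_lt_top_iff_lintegral_rpow_enorm_lt_top (by norm_num) (by norm_num)).1 hu.2
  have hφ2 := (eLpNorm_lt_top_iff_lintegral_rpow_enorm_lt_top (by norm_num) (by norm_num)).1 hφ.2
  simp only [ENNReal.toReal_ofNat] at hu2 hφ2 ⊢
  rw [lintegral_prod _ (hum.enorm.pow_const 2)] at hu2
  have key : ∀ᵐ t : ℝ, ‖coeff φ u t‖ₑ ^ (2 : ℝ) ≤
      (∫⁻ x, ‖u (t, x)‖ₑ ^ (2 : ℝ) ∂leb Ω) * ∫⁻ x, ‖φ x‖ₑ ^ (2 : ℝ) ∂leb Ω := by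
    filter_upwards [hum.prodMk_left] with t ht
    have h1 : ‖coeff φ u t‖ₑ ≤ ∫⁻ x, ‖u (t, x)‖ₑ * ‖φ x‖ₑ ∂leb Ω := by
      refine (enorm_integral_le_lintegral_enorm _).trans (le_of_eq ?_)
      refine lintegral_congr fun x => ?_
      rw [enorm_mul, ← ofReal_norm (φ x : ℂ), Complex.norm_real, ofReal_norm]
    have h2 := ENNReal.lintegral_mul_le_Lp_mul_Lq (leb Ω) (p := 2) (q := 2)
      (by constructor <;> norm_num) ht.enorm hφ.1.enorm
    refine (ENNReal.rpow_le_rpow (h1.trans h2) (by norm_num)).trans (le_of_eq ?_)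
    rw [ENNReal.mul_rpow_of_nonneg _ _ (by norm_num), ← ENNReal.rpow_mul, ← ENNReal.rpow_mul]
    norm_num
  refine (lintegral_mono_ae key).trans_lt ?_
  rw [lintegral_mul_const' _ _ hφ2.ne]
  exact ENNReal.mul_lt_top hu2 hφ2

/-- The Fourier transform `(2π)^{-1/2} ∫ u_φ(t) e^{-iρt} dt` of `u_φ(t) = ∫_Ω u(t, x) φ(x) dx`, in the
sense of `L²(ℝ)`; Mathlib's `𝓕` uses the character `e^{-2πi ρt}`. -/
def coeffHat {n : ℕ} {Ω : Set (Euc n)} (φ : Lp ℝ 2 (leb Ω)) (u : L2RΩ Ω) (ρ : ℝ) : ℂ :=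
  ((Real.sqrt (2 * Real.pi))⁻¹ : ℝ) *
    (𝓕 ((memLp_coeff φ u).toLp (coeff φ u)) : Lp ℂ 2 (volume : Measure ℝ)) (ρ / (2 * Real.pi))

/-- `Dom(H^s)`, the set of `u ∈ L²(ℝ × Ω)` with `∫ ∑ₖ |iρ + lamₖ|^s |û_k(ρ)|² dρ < ∞`. -/
def Dom {n : ℕ} {Ω : Set (Euc n)} (lam : ℕ → ℝ) (phi : HilbertBasis ℕ ℝ (Lp ℝ 2 (leb Ω)))
    (s : ℝ) : Set (L2RΩ Ω) :=
  {u | ∫⁻ ρ : ℝ, ∑' k, ENNReal.ofReal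
    (‖Complex.I * (ρ : ℂ) + (lam k : ℂ)‖ ^ s * ‖coeffHat (phi k) u ρ‖ ^ 2) < ⊤}

/-- `⟨H^s u, v⟩ = ∫ ∑ₖ (iρ + lamₖ)^s û_k(ρ) conj (v̂_k(ρ)) dρ`, with the principal power. -/
def fracPairing {n : ℕ} {Ω : Set (Euc n)} (lam : ℕ → ℝ)
    (phi : HilbertBasis ℕ ℝ (Lp ℝ 2 (leb Ω))) (s : ℝ) (u v : L2RΩ Ω) : ℂ :=
  ∫ ρ : ℝ, ∑' k, (Complex.I * (ρ : ℂ) + (lam k : ℂ)) ^ (s : ℂ) *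
    coeffHat (phi k) u ρ * conj (coeffHat (phi k) v ρ)

end MasterEquation

end

noncomputable section

namespace MasterEquation

/-! ### The Balakrishnan formula for fractional powers -/

/-! The starting point is the Balakrishnan formula |Γ(-s)| z^s = ∫_0^∞ τ^(-1-s) (1 - e^(-τz)) dτ,
valid for Re z ≥ 0 (`integral_balakrishnan`). It is applied with z = iρ + λ_k, where λ_k ≥ 0, and
integrated against the product of û_k and the conjugate of v̂_k. The absolute τ-integral is at most
C_s |z|^s (`integrableOn_balakrishnan`), which is the weight defining `Dom`, so the sum over k and
the integrals in ρ and τ may be exchanged (`fracPairing_eq_integral`).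

At a fixed lag τ the factor e^(-iτρ) is the translation t ↦ t - τ, by Plancherel, and e^(-τλ_k) is
the heat semigroup. The integrand in τ thus becomes τ^(-1-s) (⟨u, v⟩ - ⟨e^(-τL) u(· - τ), v⟩)
(`tsum_spectralDensity`). On the other side, expanding the product and using the symmetry of W_τ,
the double integral of W_τ(x,z) (f(x) - f(z)) conj(g(x) - g(z)) equals 2 (∫ e^(-τL)1 f conj(g) -
⟨e^(-τL) f, g⟩) (`IsHeatKernel.integral_sub_mul_conj_sub`). With f = u(t - τ, ·) and g = v(t, ·),
adding the bracket cancels every term containing e^(-τL)1, and the same quantity is left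
(`kernel_add_bracket`).

The analytic input is the sub-Markov bound e^(-τL)1 ≤ 1 (`heatOne_le_one`), which is proved rather
than assumed. Under the Dirichlet condition the resolvents (1 + εL)^(-1) preserve the constraint f ≤
1, as one sees by testing their equation with a smooth function of the solution that lives where it
exceeds 1; then e^(-τL) = lim (1 + τL/m)^(-m). Under the Neumann condition 1 lies in the form domain
and L1 = c weakly, so that 1 - e^(-τL)1 = ∫_0^τ e^(-rL) c dr ≥ 0 because W ≥ 0.

This bound says that the measure W_τ dx dz has marginals below Lebesgue measure. Its energy at f is
therefore at most 2 ⟨(1 - e^(-τL)) f, f⟩, and integrating against τ^(-1-s) gives a multiple of ∑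
λ_k^s |f_k|², finite on `Dom` since λ_k ≤ |iρ + λ_k|. Hence the first integral converges absolutely
by Cauchy–Schwarz, and the bracket is integrable in τ as the difference of two integrable functions.
-/

theorem norm_one_sub_exp_neg_le {w : ℂ} (hw : 0 ≤ w.re) : ‖1 - Complex.exp (-w)‖ ≤ 2 := by
  have h : ‖Complex.exp (-w)‖ ≤ 1 := by
    rw [Complex.norm_exp]; exact Real.exp_le_one_iff.2 (by simpa using hw)
  exact (norm_sub_le _ _).trans (by rw [norm_one]; linarith)

theorem norm_one_sub_exp_neg_le_mul {w : ℂ} (hw : 0 ≤ w.re) :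
    ‖1 - Complex.exp (-w)‖ ≤ 2 * ‖w‖ := by
  rcases le_total ‖w‖ 1 with h | h
  · rw [norm_sub_rev]
    simpa using Complex.norm_exp_sub_one_le (x := -w) (by simpa using h)
  · exact (norm_one_sub_exp_neg_le hw).trans (by linarith)

/-- The integrand of the Balakrishnan formula for `z ^ s`. -/
def balakrishnan (s : ℝ) (z : ℂ) (τ : ℝ) : ℂ :=
  ((τ ^ (-1 - s) : ℝ) : ℂ) * (1 - Complex.exp (-(τ * z)))

theorem measurable_balakrishnan (s : ℝ) (z : ℂ) : Measurable (balakrishnan s z) := by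
  unfold balakrishnan; fun_prop

theorem norm_balakrishnan_le {s : ℝ} {z : ℂ} (hz : 0 ≤ z.re) {τ : ℝ} (hτ : 0 < τ) :
    ‖balakrishnan s z τ‖ ≤ 2 * τ ^ (-1 - s) := by
  have h0 := Real.rpow_nonneg hτ.le (-1 - s)
  rw [balakrishnan, norm_mul, Complex.norm_real, Real.norm_of_nonneg h0, mul_comm]
  exact mul_le_mul_of_nonneg_right
    (norm_one_sub_exp_neg_le (by simpa using mul_nonneg hτ.le hz)) h0

theorem norm_balakrishnan_le_mul {s : ℝ} {z : ℂ} (hz : 0 ≤ z.re) {τ : ℝ} (hτ : 0 < τ) :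
    ‖balakrishnan s z τ‖ ≤ 2 * ‖z‖ * τ ^ (-s) := by
  have h0 := Real.rpow_nonneg hτ.le (-1 - s)
  rw [balakrishnan, norm_mul, Complex.norm_real, Real.norm_of_nonneg h0]
  calc _ ≤ τ ^ (-1 - s) * (2 * ‖(τ : ℂ) * z‖) := mul_le_mul_of_nonneg_left
        (norm_one_sub_exp_neg_le_mul (by simpa using mul_nonneg hτ.le hz)) h0
    _ = 2 * ‖z‖ * (τ ^ (-1 - s) * τ ^ (1 : ℝ)) := by
        rw [norm_mul, Complex.norm_real, Real.norm_of_nonneg hτ.le, Real.rpow_one]; ring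
    _ = _ := by rw [← Real.rpow_add hτ]; congr 2; ring

/-- The explicit multiple of ‖z‖ ^ s matters more than integrability itself: with z = iρ + λ_k it is
the weight in `Dom`, and it justifies every later exchange of integrals. -/
theorem integrableOn_balakrishnan {s : ℝ} (hs0 : 0 < s) (hs1 : s < 1) {z : ℂ} (hz : 0 ≤ z.re) :
    IntegrableOn (balakrishnan s z) (Ioi 0) ∧
      ∫ τ in Ioi 0, ‖balakrishnan s z τ‖ ≤ 2 * (1 / (1 - s) + 1 / s) * ‖z‖ ^ s := by
  rcases eq_or_ne z 0 with rfl | hz0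
  · have : balakrishnan s 0 = 0 := by ext τ; simp [balakrishnan]
    exact ⟨this ▸ integrableOn_zero, by simp [this, Real.zero_rpow hs0.ne']⟩
  have hr : 0 < ‖z‖ := norm_pos_iff.2 hz0
  -- The bounds 2‖z‖τ^(-s), good near 0, and 2τ^(-1-s), good at infinity, agree at τ = ‖z‖⁻¹.
  -- Cutting there makes both pieces homogeneous of degree s in ‖z‖.
  set R := ‖z‖⁻¹ with hR
  have hR0 : 0 < R := inv_pos.2 hr
  have i1 : IntegrableOn (fun τ : ℝ => 2 * ‖z‖ * τ ^ (-s)) (Ioc 0 R) := by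
    refine Integrable.const_mul ?_ _
    have := intervalIntegral.intervalIntegrable_rpow' (a := 0) (b := R) (r := -s) (by linarith)
    rwa [intervalIntegrable_iff_integrableOn_Ioc_of_le hR0.le] at this
  have i2 : IntegrableOn (fun τ : ℝ => 2 * τ ^ (-1 - s)) (Ioi R) :=
    (integrableOn_Ioi_rpow_of_lt (by linarith) hR0).const_mul _
  have m := (measurable_balakrishnan s z).aestronglyMeasurable (μ := volume)
  have b1 : ∀ᵐ τ ∂volume.restrict (Ioc 0 R), ‖balakrishnan s z τ‖ ≤ 2 * ‖z‖ * τ ^ (-s) :=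
    (ae_restrict_mem measurableSet_Ioc).mono fun τ h => norm_balakrishnan_le_mul hz h.1
  have b2 : ∀ᵐ τ ∂volume.restrict (Ioi R), ‖balakrishnan s z τ‖ ≤ 2 * τ ^ (-1 - s) :=
    (ae_restrict_mem measurableSet_Ioi).mono fun τ h =>
      norm_balakrishnan_le hz (hR0.trans h)
  have j1 : IntegrableOn (balakrishnan s z) (Ioc 0 R) := i1.mono' m.restrict b1
  have j2 : IntegrableOn (balakrishnan s z) (Ioi R) := i2.mono' m.restrict b2
  have hU : Ioc 0 R ∪ Ioi R = Ioi 0 := Ioc_union_Ioi_eq_Ioi hR0.le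
  refine ⟨hU ▸ j1.union j2, ?_⟩
  rw [← hU, setIntegral_union Ioc_disjoint_Ioi_same measurableSet_Ioi j1.norm j2.norm]
  have k1 : ∫ τ in Ioc 0 R, ‖balakrishnan s z τ‖ ≤ 2 * (1 / (1 - s)) * ‖z‖ ^ s := by
    refine (integral_mono_ae j1.norm i1 b1).trans (le_of_eq ?_)
    rw [integral_const_mul, ← intervalIntegral.integral_of_le hR0.le,
      integral_rpow (Or.inl (by linarith)), Real.zero_rpow (by linarith), hR,
      Real.inv_rpow hr.le, ← Real.rpow_neg hr.le]
    have : ‖z‖ ^ s = ‖z‖ * ‖z‖ ^ (-(-s + 1)) := by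
      nth_rewrite 2 [← Real.rpow_one ‖z‖]
      rw [← Real.rpow_add hr]; congr 1; ring
    rw [this, sub_zero, show -s + 1 = 1 - s by ring]; ring
  have k2 : ∫ τ in Ioi R, ‖balakrishnan s z τ‖ ≤ 2 * (1 / s) * ‖z‖ ^ s := by
    refine (integral_mono_ae j2.norm i2 b2).trans (le_of_eq ?_)
    rw [integral_const_mul, integral_Ioi_rpow_of_lt (by linarith) hR0, hR,
      Real.inv_rpow hr.le, ← Real.rpow_neg hr.le, show -(-1 - s + 1) = s by ring,
      show -1 - s + 1 = -s by ring]
    field_simp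
  linarith

theorem norm_exp_neg_mul (τ : ℝ) (z : ℂ) :
    ‖Complex.exp (-(τ * z))‖ = Real.exp (-(τ * z.re)) := by
  rw [Complex.norm_exp]; simp

theorem integrableOn_rpow_mul_exp {s : ℝ} (hs1 : s < 1) {b : ℝ} (hb : 0 < b) :
    IntegrableOn (fun τ : ℝ => τ ^ (-s) * Real.exp (-(τ * b))) (Ioi 0) := by
  have h := integrableOn_rpow_mul_exp_neg_mul_rpow (s := -s) (p := 1) (by linarith) one_pos hb
  refine h.congr_fun (fun τ _ => ?_) measurableSet_Ioi
  simp only [Real.rpow_one]; congr 2; ring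

theorem integrableOn_rpow_mul_cexp {s : ℝ} (hs1 : s < 1) {z : ℂ} (hz : 0 < z.re) :
    IntegrableOn (fun τ : ℝ => ((τ ^ (-s) : ℝ) : ℂ) * Complex.exp (-(τ * z))) (Ioi 0) := by
  refine (integrableOn_rpow_mul_exp hs1 hz).mono' ?_ ?_
  · exact Measurable.aestronglyMeasurable (by fun_prop)
  · refine (ae_restrict_mem measurableSet_Ioi).mono fun τ hτ => ?_
    rw [norm_mul, Complex.norm_real, Real.norm_of_nonneg (Real.rpow_nonneg (le_of_lt hτ) _),
      norm_exp_neg_mul]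

theorem hasDerivAt_one_sub_cexp (z : ℂ) (τ : ℝ) :
    HasDerivAt (fun τ : ℝ => 1 - Complex.exp (-(τ * z))) (z * Complex.exp (-(τ * z))) τ := by
  have h : HasDerivAt (fun τ : ℝ => -((τ : ℂ) * z)) (-z) τ := by
    simpa using ((hasDerivAt_id τ).ofReal_comp.mul_const z).fun_neg
  refine ((h.cexp).const_sub 1).congr_deriv ?_
  ring

/-- Integration by parts in the Balakrishnan formula. -/
theorem integral_balakrishnan_by_parts {s : ℝ} (hs0 : 0 < s) (hs1 : s < 1) {z : ℂ}
    (hz : 0 < z.re) :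
    s * ∫ τ in Ioi 0, balakrishnan s z τ =
      z * ∫ τ in Ioi (0 : ℝ), ((τ ^ (-s) : ℝ) : ℂ) * Complex.exp (-(τ * z)) := by
  have hu : ∀ τ ∈ Ioi (0 : ℝ), HasDerivAt (fun τ : ℝ => ((τ ^ (-s) : ℝ) : ℂ))
      (((-s) * τ ^ (-1 - s) : ℝ) : ℂ) τ := fun τ hτ => by
    have := (Real.hasDerivAt_rpow_const (x := τ) (p := -s) (Or.inl (ne_of_gt hτ))).ofReal_comp
    rwa [show -s - 1 = -1 - s by ring] at this
  -- The boundary term has modulus τ‖balakrishnan s z τ‖, so the two bounds on the integrand make it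
  -- vanish at both ends: O(τ^(1-s)) at 0 and O(τ^(-s)) at infinity.
  have hb : ∀ τ : ℝ, 0 < τ → ‖((τ ^ (-s) : ℝ) : ℂ) * (1 - Complex.exp (-(τ * z)))‖ =
      τ * ‖balakrishnan s z τ‖ := fun τ hτ => by
    rw [balakrishnan, norm_mul, norm_mul, ← mul_assoc, Complex.norm_real, Complex.norm_real,
      Real.norm_of_nonneg (Real.rpow_nonneg hτ.le _),
      Real.norm_of_nonneg (Real.rpow_nonneg hτ.le _)]
    have : τ ^ (-s) = τ * τ ^ (-1 - s) := by
      nth_rewrite 2 [← Real.rpow_one τ]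
      rw [← Real.rpow_add hτ]; congr 1; ring
    rw [this]
  have h := integral_Ioi_mul_deriv_eq_deriv_mul (a := (0 : ℝ)) (a' := (0 : ℂ)) (b' := (0 : ℂ)) hu
    (fun τ _ => hasDerivAt_one_sub_cexp z τ) ?_ ?_ ?_ ?_
  · have e1 : ∫ τ in Ioi (0 : ℝ), ((τ ^ (-s) : ℝ) : ℂ) * (z * Complex.exp (-(τ * z))) =
        z * ∫ τ in Ioi (0 : ℝ), ((τ ^ (-s) : ℝ) : ℂ) * Complex.exp (-(τ * z)) := by
      rw [← integral_const_mul]; congr 1; ext τ; ring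
    have e2 : ∫ τ in Ioi (0 : ℝ), (((-s) * τ ^ (-1 - s) : ℝ) : ℂ) * (1 - Complex.exp (-(τ * z))) =
        -(s * ∫ τ in Ioi 0, balakrishnan s z τ) := by
      rw [← integral_const_mul, ← integral_neg]; congr 1; ext τ; simp only [balakrishnan]
      push_cast; ring
    rw [e1, e2] at h
    rw [h]; ring
  · refine ((integrableOn_rpow_mul_cexp hs1 hz).const_mul z).congr (.of_forall fun τ => ?_)
    simp only [Pi.mul_apply]; ring
  · refine ((integrableOn_balakrishnan hs0 hs1 hz.le).1.const_mul (-s : ℂ)).congr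
      (.of_forall fun τ => ?_)
    simp only [Pi.mul_apply, balakrishnan]; push_cast; ring
  · rw [tendsto_zero_iff_norm_tendsto_zero]
    have : Filter.Tendsto (fun τ : ℝ => 2 * ‖z‖ * τ ^ (1 - s)) (nhdsWithin 0 (Ioi 0)) (nhds 0) := by
      have h1 : ContinuousAt (fun τ : ℝ => 2 * ‖z‖ * τ ^ (1 - s)) 0 :=
        (Real.continuousAt_rpow_const 0 (1 - s) (Or.inr (by linarith))).const_mul _
      have h2 := h1.tendsto
      simp only [Real.zero_rpow (show (1 - s) ≠ 0 by linarith), mul_zero] at h2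
      exact h2.mono_left nhdsWithin_le_nhds
    refine tendsto_of_tendsto_of_tendsto_of_le_of_le' tendsto_const_nhds this
      (.of_forall fun _ => norm_nonneg _) ?_
    filter_upwards [self_mem_nhdsWithin] with τ hτ
    simp only [Pi.mul_apply]
    rw [hb τ hτ]
    refine (mul_le_mul_of_nonneg_left (norm_balakrishnan_le_mul hz.le hτ) (le_of_lt hτ)).trans
      (le_of_eq ?_)
    rw [sub_eq_add_neg, Real.rpow_add hτ, Real.rpow_one]; ring
  · rw [tendsto_zero_iff_norm_tendsto_zero]
    have := (tendsto_rpow_neg_atTop hs0).const_mul 2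
    rw [mul_zero] at this
    refine tendsto_of_tendsto_of_tendsto_of_le_of_le' tendsto_const_nhds this
      (.of_forall fun _ => norm_nonneg _) ?_
    filter_upwards [Filter.eventually_gt_atTop 0] with τ hτ
    simp only [Pi.mul_apply]
    rw [hb τ hτ]
    refine (mul_le_mul_of_nonneg_left (norm_balakrishnan_le hz.le hτ) (le_of_lt hτ)).trans
      (le_of_eq ?_)
    nth_rewrite 1 [← Real.rpow_one τ]
    rw [mul_left_comm, ← Real.rpow_add hτ]; congr 2; ring

/-- Together with the integration by parts, this yields the equation z F'(z) = s F(z) for the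
Balakrishnan integral F on the right half-plane. -/
theorem hasDerivAt_integral_balakrishnan {s : ℝ} (hs0 : 0 < s) (hs1 : s < 1) {z : ℂ}
    (hz : 0 < z.re) :
    HasDerivAt (fun z : ℂ => ∫ τ in Ioi 0, balakrishnan s z τ)
      (∫ τ in Ioi (0 : ℝ), ((τ ^ (-s) : ℝ) : ℂ) * Complex.exp (-(τ * z))) z := by
  -- On this smaller half-plane the derivatives share the integrable majorant τ^(-s) e^(-τ Re z /
  -- 2).
  have hS : {w : ℂ | z.re / 2 < w.re} ∈ nhds z :=
    (isOpen_lt continuous_const Complex.continuous_re).mem_nhds (by simp; linarith)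
  refine (hasDerivAt_integral_of_dominated_loc_of_deriv_le (μ := volume.restrict (Ioi 0))
    (F := fun z τ => balakrishnan s z τ)
    (F' := fun z τ => ((τ ^ (-s) : ℝ) : ℂ) * Complex.exp (-(τ * z)))
    (bound := fun τ => τ ^ (-s) * Real.exp (-(τ * (z.re / 2)))) hS ?_ ?_ ?_ ?_ ?_ ?_).2
  · exact .of_forall fun w => (measurable_balakrishnan s w).aestronglyMeasurable
  · exact (integrableOn_balakrishnan hs0 hs1 hz.le).1
  · exact Measurable.aestronglyMeasurable (by fun_prop)
  · refine (ae_restrict_mem measurableSet_Ioi).mono fun τ hτ w hw => ?_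
    have hτ' : 0 < τ := hτ
    have h0 := Real.rpow_nonneg hτ'.le (-s)
    rw [norm_mul, Complex.norm_real, Real.norm_of_nonneg h0, norm_exp_neg_mul]
    refine mul_le_mul_of_nonneg_left (Real.exp_le_exp.2 ?_) h0
    have : z.re / 2 < w.re := hw
    nlinarith
  · exact integrableOn_rpow_mul_exp hs1 (by linarith)
  · refine (ae_restrict_mem measurableSet_Ioi).mono fun τ hτ w hw => ?_
    have hτ' : 0 < τ := hτ
    have h : HasDerivAt (fun w : ℂ => -((τ : ℂ) * w)) (-τ) w := by
      simpa using ((hasDerivAt_id w).const_mul (τ : ℂ)).fun_neg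
    have h2 := ((h.cexp).const_sub 1).const_mul ((τ ^ (-1 - s) : ℝ) : ℂ)
    refine h2.congr_deriv ?_
    have : τ ^ (-s) = τ ^ (-1 - s) * τ := by
      nth_rewrite 3 [← Real.rpow_one τ]
      rw [← Real.rpow_add hτ']; congr 1; ring
    rw [this]; push_cast; ring

/-- The functional equation gives Γ(1-s) = -s Γ(-s), and Γ(1-s) > 0 forces Γ(-s) < 0. -/
theorem abs_Gamma_neg {s : ℝ} (hs0 : 0 < s) (hs1 : s < 1) :
    s * |Real.Gamma (-s)| = Real.Gamma (1 - s) := by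
  have h := Real.Gamma_add_one (s := -s) (by linarith)
  have hp : 0 < Real.Gamma (1 - s) := Real.Gamma_pos_of_pos (by linarith)
  rw [show -s + 1 = 1 - s by ring] at h
  rw [h] at hp ⊢
  rw [abs_of_neg (by nlinarith)]; ring

theorem abs_Gamma_neg_pos {s : ℝ} (hs0 : 0 < s) (hs1 : s < 1) : 0 < |Real.Gamma (-s)| := by
  have h := abs_Gamma_neg hs0 hs1
  have hp : 0 < Real.Gamma (1 - s) := Real.Gamma_pos_of_pos (by linarith)
  rw [← h] at hp
  exact pos_of_mul_pos_right hp hs0.le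

theorem integral_balakrishnan_one {s : ℝ} (hs0 : 0 < s) (hs1 : s < 1) :
    ∫ τ in Ioi 0, balakrishnan s 1 τ = (|Real.Gamma (-s)| : ℝ) := by
  have h := integral_balakrishnan_by_parts hs0 hs1 (z := 1) (by simp)
  have h2 : ∫ τ in Ioi (0 : ℝ), ((τ ^ (-s) : ℝ) : ℂ) * Complex.exp (-(τ * 1)) =
      (Real.Gamma (1 - s) : ℝ) := by
    rw [Real.Gamma_eq_integral (by linarith), ← integral_complex_ofReal]
    refine setIntegral_congr_fun measurableSet_Ioi fun τ _ => ?_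
    simp only [show 1 - s - 1 = -s by ring]
    push_cast; ring_nf
  rw [h2, ← abs_Gamma_neg hs0 hs1, one_mul, Complex.ofReal_mul] at h
  exact mul_left_cancel₀ (by exact_mod_cast hs0.ne') h

/-- The equation z F' = s F says that F(z) z^(-s) has zero derivative on the connected right
half-plane, so it equals its value at z = 1, which is a Gamma integral. -/
theorem integral_balakrishnan_of_re_pos {s : ℝ} (hs0 : 0 < s) (hs1 : s < 1) {z : ℂ}
    (hz : 0 < z.re) :
    ∫ τ in Ioi 0, balakrishnan s z τ = (|Real.Gamma (-s)| : ℝ) * z ^ (s : ℂ) := by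
  have hslit : ∀ w : ℂ, 0 < w.re → w ∈ Complex.slitPlane := fun w hw => Or.inl hw
  have hd : ∀ w ∈ {w : ℂ | 0 < w.re}, HasDerivAt
      (fun w : ℂ => (∫ τ in Ioi 0, balakrishnan s w τ) * w ^ (-s : ℂ)) 0 w := fun w hw => by
    have hw0 : w ≠ 0 := fun h => by simp [h] at hw
    have h := (hasDerivAt_integral_balakrishnan hs0 hs1 hw).mul
      ((hasDerivAt_id w).cpow_const (c := (-s : ℂ)) (hslit w hw))
    refine h.congr_deriv ?_
    have h2 := integral_balakrishnan_by_parts hs0 hs1 hw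
    simp only [id]
    rw [Complex.cpow_sub _ _ hw0, Complex.cpow_one]
    field_simp
    linear_combination (-w ^ (-s : ℂ)) * h2
  have hconst := (isOpen_lt continuous_const Complex.continuous_re).is_const_of_deriv_eq_zero
    (convex_halfSpace_re_gt 0).isPreconnected
    (fun w hw => (hd w hw).differentiableAt.differentiableWithinAt)
    (fun w hw => (hd w hw).deriv) (x := z) (y := 1) hz (by simp)
  simp only [Complex.one_cpow, mul_one, integral_balakrishnan_one hs0 hs1] at hconst
  have hz0 : z ≠ 0 := fun h => by simp [h] at hz
  rw [← hconst, mul_assoc, ← Complex.cpow_add _ _ hz0]; simp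

/-- The Balakrishnan formula. -/
theorem integral_balakrishnan {s : ℝ} (hs0 : 0 < s) (hs1 : s < 1) {z : ℂ} (hz : 0 ≤ z.re) :
    ∫ τ in Ioi 0, balakrishnan s z τ = (|Real.Gamma (-s)| : ℝ) * z ^ (s : ℂ) := by
  rcases hz.lt_or_eq with h | h
  · exact integral_balakrishnan_of_re_pos hs0 hs1 h
  rcases eq_or_ne z 0 with rfl | hz0
  · have : balakrishnan s 0 = 0 := by ext τ; simp [balakrishnan]
    have hs : (s : ℂ) ≠ 0 := by exact_mod_cast hs0.ne'
    simp [this, hs]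
  have hslit : z ∈ Complex.slitPlane := Or.inr fun him => hz0 (Complex.ext h.symm him)
  -- On the imaginary axis away from 0 the principal power is continuous, so the formula is the
  -- limit of the one at z + ε_n. Since ε_n ≤ 1, a single majorant, split at τ = 1, serves all n.
  let ε : ℕ → ℝ := fun n => 1 / ((n : ℝ) + 1)
  have hε : Filter.Tendsto ε Filter.atTop (nhds 0) := tendsto_one_div_add_atTop_nhds_zero_nat
  have hε0 : ∀ n, 0 < ε n := fun n => Nat.one_div_pos_of_nat
  have hzε : Filter.Tendsto (fun n => z + ε n) Filter.atTop (nhds z) := by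
    have := (Complex.continuous_ofReal.tendsto 0).comp hε
    simpa using this.const_add z
  have hre : ∀ n, 0 < (z + ε n).re := fun n => by simpa [← h] using hε0 n
  have t1 : Filter.Tendsto (fun n => ∫ τ in Ioi 0, balakrishnan s (z + ε n) τ) Filter.atTop
      (nhds (∫ τ in Ioi 0, balakrishnan s z τ)) := by
    refine tendsto_integral_of_dominated_convergence
      (fun τ => if τ ≤ 1 then 2 * (‖z‖ + 1) * τ ^ (-s) else 2 * τ ^ (-1 - s)) ?_ ?_ ?_ ?_
    · exact fun n => (measurable_balakrishnan _ _).aestronglyMeasurable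
    · rw [← Ioc_union_Ioi_eq_Ioi (zero_le_one' ℝ)]
      refine IntegrableOn.union ?_ ?_
      · have := intervalIntegral.intervalIntegrable_rpow' (a := 0) (b := 1) (r := -s) (by linarith)
        rw [intervalIntegrable_iff_integrableOn_Ioc_of_le zero_le_one] at this
        exact (Integrable.const_mul this (2 * (‖z‖ + 1))).congr
          ((ae_restrict_mem measurableSet_Ioc).mono fun τ hτ => by simp [hτ.2])
      · exact ((integrableOn_Ioi_rpow_of_lt (show -1 - s < -1 by linarith) one_pos).const_mul 2).congr
          ((ae_restrict_mem measurableSet_Ioi).mono fun τ hτ => by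
            simp [not_le.2 (show 1 < τ from hτ)])
    · refine fun n => (ae_restrict_mem measurableSet_Ioi).mono fun τ hτ => ?_
      have hτ' : 0 < τ := hτ
      split_ifs
      · refine (norm_balakrishnan_le_mul (hre n).le hτ).trans ?_
        refine mul_le_mul_of_nonneg_right ?_ (Real.rpow_nonneg hτ'.le _)
        have : ‖z + ε n‖ ≤ ‖z‖ + 1 := by
          refine (norm_add_le _ _).trans ?_
          rw [Complex.norm_real, Real.norm_of_nonneg (hε0 n).le]
          have : ε n ≤ 1 := by
            simp only [ε]; rw [div_le_one (by positivity)]; linarith [n.cast_nonneg (α := ℝ)]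
          linarith
        linarith
      · exact norm_balakrishnan_le (hre n).le hτ
    · refine .of_forall fun τ => ?_
      have hc : Continuous fun w : ℂ => balakrishnan s w τ := by unfold balakrishnan; fun_prop
      exact (hc.tendsto z).comp hzε
  have t2 : Filter.Tendsto (fun n => ∫ τ in Ioi 0, balakrishnan s (z + ε n) τ) Filter.atTop
      (nhds ((|Real.Gamma (-s)| : ℝ) * z ^ (s : ℂ))) := by
    simp only [fun n => integral_balakrishnan_of_re_pos hs0 hs1 (hre n)]
    refine Filter.Tendsto.const_mul _ ?_
    exact ((continuousAt_cpow_const hslit).tendsto).comp hzε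
  exact tendsto_nhds_unique t1 t2

/-! ### Plancherel's identity for translates -/

/-- Translation by `τ` on `L²(ℝ)`. -/
def translateLp (τ : ℝ) : Lp ℂ 2 (volume : Measure ℝ) →+ Lp ℂ 2 (volume : Measure ℝ) :=
  Lp.compMeasurePreserving (fun t => t - τ) (measurePreserving_sub_right volume τ)

theorem coeFn_translateLp (τ : ℝ) (f : Lp ℂ 2 (volume : Measure ℝ)) :
    translateLp τ f =ᵐ[volume] fun t => f (t - τ) :=
  Lp.coeFn_compMeasurePreserving f (measurePreserving_sub_right volume τ)

theorem norm_translateLp (τ : ℝ) (f : Lp ℂ 2 (volume : Measure ℝ)) :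
    ‖translateLp τ f‖ = ‖f‖ :=
  Lp.norm_compMeasurePreserving f (measurePreserving_sub_right volume τ)

theorem fourier_comp_sub (τ : ℝ) (f : ℝ → ℂ) (ξ : ℝ) :
    𝓕 (fun t => f (t - τ)) ξ = Complex.exp (-(2 * Real.pi * τ * ξ) * Complex.I) * 𝓕 f ξ := by
  rw [Real.fourier_eq, Real.fourier_eq, ← integral_const_mul,
    ← integral_add_right_eq_self _ τ]
  congr 1; ext t
  simp only [add_sub_cancel_right, Circle.smul_def, Real.fourierChar_apply, smul_eq_mul]
  rw [← mul_assoc, ← Complex.exp_add]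
  congr 2
  simp; ring

theorem norm_cexp_phase (τ ξ : ℝ) :
    ‖Complex.exp (-(2 * Real.pi * τ * ξ) * Complex.I)‖ = 1 := by
  rw [Complex.norm_exp]; simp

theorem fourier_translateLp_schwartz (τ : ℝ) (f : SchwartzMap ℝ ℂ) :
    (𝓕 (translateLp τ (f.toLp 2)) : Lp ℂ 2 volume) =ᵐ[volume] fun ξ : ℝ =>
      Complex.exp (-(2 * Real.pi * τ * ξ) * Complex.I) * (𝓕 (f.toLp 2 volume) : Lp ℂ 2 volume) ξ := by
  have h1 : translateLp τ (f.toLp 2) = (f.compSubConstCLM ℂ τ).toLp 2 := by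
    refine Lp.ext ?_
    have h2 := (measurePreserving_sub_right volume τ).quasiMeasurePreserving.ae_eq_comp
      (f.coeFn_toLp 2 volume)
    filter_upwards [coeFn_translateLp τ (f.toLp 2), h2,
      (f.compSubConstCLM ℂ τ).coeFn_toLp 2 volume] with t a b c
    rw [a, c]; exact b
  rw [h1, SchwartzMap.toLp_fourier_eq, SchwartzMap.toLp_fourier_eq]
  filter_upwards [(𝓕 (f.compSubConstCLM ℂ τ)).coeFn_toLp 2 volume, (𝓕 f).coeFn_toLp 2 volume]
    with ξ a b
  rw [a, b, SchwartzMap.fourier_coe, SchwartzMap.fourier_coe, ← fourier_comp_sub]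
  rfl

/-- The identity is a pointwise computation for Schwartz functions. Translation, multiplication by
the phase and the Fourier transform are isometries of L², so it extends by density. -/
theorem fourier_translateLp (τ : ℝ) (f : Lp ℂ 2 (volume : Measure ℝ)) :
    (𝓕 (translateLp τ f) : Lp ℂ 2 volume) =ᵐ[volume] fun ξ : ℝ =>
      Complex.exp (-(2 * Real.pi * τ * ξ) * Complex.I) * (𝓕 f : Lp ℂ 2 volume) ξ := by
  set e : ℝ → ℂ := fun ξ => Complex.exp (-(2 * Real.pi * τ * ξ) * Complex.I) with he
  have hem : AEStronglyMeasurable e volume := by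
    have : Measurable e := by fun_prop
    exact this.aestronglyMeasurable
  have key : eLpNorm (fun ξ => 𝓕 (translateLp τ f) ξ - e ξ * (𝓕 f : Lp ℂ 2 volume) ξ) 2 volume
      = 0 := by
    refine le_antisymm (le_of_forall_pos_le_add fun ε hε => ?_) zero_le
    rcases eq_or_ne ε ⊤ with rfl | hεt
    · simp
    have hε' : 0 < ε.toReal / 2 := half_pos (ENNReal.toReal_pos hε.ne' hεt)
    obtain ⟨g, hg⟩ := Metric.denseRange_iff.1
      (SchwartzMap.denseRange_toLpCLM (E := ℝ) (F := ℂ) (p := 2) (μ := volume)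
        ENNReal.ofNat_ne_top) f _ hε'
    rw [SchwartzMap.toLpCLM_apply, dist_eq_norm] at hg
    have hs := fourier_translateLp_schwartz τ g
    set G := g.toLp 2 volume
    -- The defect of the identity is additive in f and vanishes for the Schwartz function G, so the
    -- defect of f is that of f - G. Its two terms each have norm ‖f - G‖.
    have e1 : (fun ξ => 𝓕 (translateLp τ f) ξ - e ξ * (𝓕 f : Lp ℂ 2 volume) ξ) =ᵐ[volume]
        (⇑(𝓕 (translateLp τ (f - G))) - fun ξ => e ξ * (𝓕 (f - G) : Lp ℂ 2 volume) ξ) := by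
      have r1 : 𝓕 (translateLp τ (f - G)) = 𝓕 (translateLp τ f) - 𝓕 (translateLp τ G) := by
        rw [map_sub]; exact (Lp.fourierTransformₗᵢ ℝ ℂ).map_sub _ _
      have r2 : (𝓕 (f - G) : Lp ℂ 2 volume) = 𝓕 f - 𝓕 G :=
        (Lp.fourierTransformₗᵢ ℝ ℂ).map_sub _ _
      rw [r1, r2]
      filter_upwards [Lp.coeFn_sub (𝓕 (translateLp τ f)) (𝓕 (translateLp τ G)),
        Lp.coeFn_sub (𝓕 f : Lp ℂ 2 volume) (𝓕 G), hs] with ξ a b c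
      simp only [Pi.sub_apply] at a b ⊢
      rw [a, b, c]; ring
    rw [eLpNorm_congr_ae e1, zero_add]
    refine (eLpNorm_sub_le (Lp.aestronglyMeasurable _)
      (hem.mul (Lp.aestronglyMeasurable _)) (by norm_num)).trans ?_
    have n1 : eLpNorm (e * ⇑(𝓕 (f - G) : Lp ℂ 2 volume)) 2 volume =
        eLpNorm (𝓕 (f - G) : Lp ℂ 2 volume) 2 volume :=
      eLpNorm_congr_norm_ae (.of_forall fun ξ => by
        rw [Pi.mul_apply, norm_mul, he, norm_cexp_phase, one_mul])
    have n2 : ∀ h : Lp ℂ 2 (volume : Measure ℝ), ‖h‖ < ε.toReal / 2 →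
        eLpNorm h 2 volume ≤ ε / 2 := fun h hh => by
      rw [← ENNReal.ofReal_toReal (Lp.eLpNorm_ne_top h), ← Lp.norm_def]
      refine (ENNReal.ofReal_le_ofReal hh.le).trans (le_of_eq ?_)
      rw [ENNReal.ofReal_div_of_pos two_pos, ENNReal.ofReal_toReal hεt]; simp
    rw [n1, ← ENNReal.add_halves ε]
    refine add_le_add (n2 _ ?_) (n2 _ ?_)
    · rw [Lp.norm_fourier_eq, norm_translateLp]; exact hg
    · rw [Lp.norm_fourier_eq]; exact hg
  have key' := (eLpNorm_eq_zero_iff ((Lp.aestronglyMeasurable _).sub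
    (hem.mul (Lp.aestronglyMeasurable _))) (by norm_num)).1 key
  filter_upwards [key'] with ξ h
  exact sub_eq_zero.1 h

/-- The unitary Fourier transform `(2π)^{-1/2} ∫ f(t) e^{-iρt} dt` on `L²(ℝ)`. -/
def unitaryFourier (f : Lp ℂ 2 (volume : Measure ℝ)) (ρ : ℝ) : ℂ :=
  ((Real.sqrt (2 * Real.pi))⁻¹ : ℝ) * (𝓕 f : Lp ℂ 2 (volume : Measure ℝ)) (ρ / (2 * Real.pi))

/-- The square of the normalising factor (2π)^(-1/2) cancels the Jacobian of ρ = 2πξ. -/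
theorem integral_rescale (F : ℝ → ℂ) :
    ∫ ρ : ℝ, (((Real.sqrt (2 * Real.pi))⁻¹ : ℝ) : ℂ) ^ 2 * F (ρ / (2 * Real.pi)) = ∫ ξ, F ξ := by
  have h2 : (0 : ℝ) < 2 * Real.pi := by positivity
  rw [integral_const_mul, Measure.integral_comp_div F, abs_of_pos h2, ← Complex.ofReal_pow, inv_pow,
    Real.sq_sqrt h2.le, Complex.real_smul, ← mul_assoc, ← Complex.ofReal_mul,
    inv_mul_cancel₀ h2.ne', Complex.ofReal_one, one_mul]

theorem integral_translate_mul_conj (f g : Lp ℂ 2 (volume : Measure ℝ)) (τ : ℝ) :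
    ∫ t : ℝ, f (t - τ) * conj (g t) =
      ∫ ρ : ℝ, Complex.exp (-(τ * (Complex.I * ρ))) * unitaryFourier f ρ *
        conj (unitaryFourier g ρ) := by
  have h1 : ∫ t : ℝ, f (t - τ) * conj (g t) = inner ℂ g (translateLp τ f) := by
    rw [L2.inner_def]
    refine integral_congr_ae ?_
    filter_upwards [coeFn_translateLp τ f] with t ht
    simp [ht]
  rw [h1, ← Lp.inner_fourier_eq, L2.inner_def, ← integral_rescale]
  -- The phase identity holds for almost every ξ. Scaling preserves null sets, which carries it to
  -- almost every ρ = 2πξ.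
  have q : Filter.Tendsto (fun ρ : ℝ => ρ / (2 * Real.pi)) (ae volume) (ae volume) := by
    have h2 : (2 * Real.pi)⁻¹ ≠ (0 : ℝ) := by positivity
    have : Measure.QuasiMeasurePreserving (fun ρ : ℝ => ρ * (2 * Real.pi)⁻¹) volume volume :=
      ⟨measurable_id.mul_const _, by
        rw [Real.map_volume_mul_right h2]; exact Measure.smul_absolutelyContinuous⟩
    exact this.tendsto_ae
  refine integral_congr_ae ?_
  filter_upwards [q.eventually (fourier_translateLp τ f)] with ρ hρ
  rw [hρ]
  simp only [unitaryFourier, RCLike.inner_apply, map_mul, Complex.conj_ofReal]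
  have : -(2 * Real.pi * τ * ((ρ / (2 * Real.pi) : ℝ) : ℂ)) * Complex.I =
      -(τ * (Complex.I * ρ)) := by
    push_cast
    have : (Real.pi : ℂ) ≠ 0 := by exact_mod_cast Real.pi_ne_zero
    field_simp
  rw [this]; ring

theorem measurable_unitaryFourier (f : Lp ℂ 2 (volume : Measure ℝ)) :
    Measurable (unitaryFourier f) :=
  ((Lp.stronglyMeasurable _).measurable.comp (measurable_id.div_const _)).const_mul _

theorem lintegral_unitaryFourier (f : Lp ℂ 2 (volume : Measure ℝ)) :
    ∫⁻ ρ : ℝ, ‖unitaryFourier f ρ‖ₑ ^ 2 = ∫⁻ t, ‖f t‖ₑ ^ 2 := by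
  have hp : (0 : ℝ) < 2 * Real.pi := by positivity
  have h1 : ∀ g : Lp ℂ 2 (volume : Measure ℝ), ∫⁻ t, ‖g t‖ₑ ^ 2 = ENNReal.ofReal (‖g‖ ^ 2) :=
    fun g => by
      rw [ENNReal.ofReal_pow (norm_nonneg _), Lp.norm_def, ENNReal.ofReal_toReal
        (Lp.eLpNorm_ne_top g), eLpNorm_eq_lintegral_rpow_enorm_toReal (by norm_num) (by norm_num),
        ← ENNReal.rpow_natCast, ← ENNReal.rpow_mul]
      simp
  have h2 : ∫⁻ ρ : ℝ, ‖unitaryFourier f ρ‖ₑ ^ 2 = ∫⁻ ξ, ‖(𝓕 f : Lp ℂ 2 volume) ξ‖ₑ ^ 2 := by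
    have hm : Measurable fun ξ => ‖(𝓕 f : Lp ℂ 2 (volume : Measure ℝ)) ξ‖ₑ ^ 2 :=
      (Lp.stronglyMeasurable _).measurable.enorm.pow_const 2
    have hc : ∀ ρ : ℝ, ‖unitaryFourier f ρ‖ₑ ^ 2 = ENNReal.ofReal (2 * Real.pi)⁻¹ *
        ‖(𝓕 f : Lp ℂ 2 (volume : Measure ℝ)) (ρ * (2 * Real.pi)⁻¹)‖ₑ ^ 2 := fun ρ => by
      rw [unitaryFourier, enorm_mul, mul_pow, div_eq_mul_inv]
      congr 1
      rw [← ofReal_norm, Complex.norm_real, Real.norm_of_nonneg (by positivity),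
        ← ENNReal.ofReal_pow (by positivity), inv_pow, Real.sq_sqrt hp.le]
    simp only [hc]
    have hmul : Measurable fun ρ : ℝ => ρ * (2 * Real.pi)⁻¹ := measurable_id.mul_const _
    have hm' : Measurable fun ρ : ℝ =>
        ‖(𝓕 f : Lp ℂ 2 (volume : Measure ℝ)) (ρ * (2 * Real.pi)⁻¹)‖ₑ ^ 2 := hm.comp hmul
    rw [lintegral_const_mul _ hm', ← lintegral_map hm hmul, Real.map_volume_mul_right (by positivity), lintegral_smul_measure, inv_inv,
      abs_of_pos hp, smul_eq_mul, ← mul_assoc, ← ENNReal.ofReal_mul (by positivity),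
      inv_mul_cancel₀ hp.ne', ENNReal.ofReal_one, one_mul]
  rw [h2, h1, h1, Lp.norm_fourier_eq]

/-! ### Resolvents of a form with a basis of eigenvectors -/

/-- The resolvent (1 + εL)^(-1) f is written down as the eigenfunction series with coefficients
⟨b_k, f⟩ / (1 + ελ_k). Here D is the closed graph of the gradient, and the real content is that the
gradients of the partial sums converge as well, so that the limit stays in D and the form may be
applied to it. -/
theorem exists_resolvent {H V : Type*} [NormedAddCommGroup H] [InnerProductSpace ℝ H]
    [CompleteSpace H] [NormedAddCommGroup V] [InnerProductSpace ℝ V] [CompleteSpace V]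
    {D : Submodule ℝ (H × V)} (hD : IsClosed (D : Set (H × V))) (b : HilbertBasis ℕ ℝ H)
    {g : ℕ → V} {lam : ℕ → ℝ} (hlam : ∀ k, 0 ≤ lam k) {A : V →L[ℝ] V →L[ℝ] ℝ}
    {P : H →L[ℝ] H →L[ℝ] ℝ} {κ : ℝ} (hκ : 0 < κ) (hA : ∀ v, κ * ‖v‖ ^ 2 ≤ A v v)
    (hP : ∀ h, 0 ≤ P h h) (hmem : ∀ k, (b k, g k) ∈ D)
    (heig : ∀ k, ∀ q ∈ D, A (g k) q.2 + P (b k) q.1 = lam k * inner ℝ (b k) q.1)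
    {ε : ℝ} (hε : 0 < ε) (f : H) :
    ∃ p ∈ D, (∀ k, inner ℝ (b k) p.1 = inner ℝ (b k) f / (1 + ε * lam k)) ∧
      ∀ q ∈ D, inner ℝ p.1 q.1 + ε * (A p.2 q.2 + P p.1 q.1) = inner ℝ f q.1 := by
  have hpos : ∀ k, 0 < 1 + ε * lam k := fun k => by have := hlam k; positivity
  set c : ℕ → ℝ := fun k => inner ℝ (b k) f / (1 + ε * lam k) with hc
  have hf2 : Summable fun k => (inner ℝ (b k) f : ℝ) ^ 2 := by
    simpa using b.orthonormal.inner_products_summable f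
  -- Finite energy comes from λ ε ≤ (1 + ελ)², which bounds each term by ε⁻¹ ⟨b_k, f⟩².
  have hlc : Summable fun k => lam k * c k ^ 2 := by
    refine Summable.of_nonneg_of_le (fun k => mul_nonneg (hlam k) (sq_nonneg _)) (fun k => ?_)
      (hf2.mul_left ε⁻¹)
    have h1 := hpos k
    have h2 := hlam k
    rw [hc, div_pow, mul_div_assoc', div_le_iff₀ (by positivity), inv_mul_eq_div, div_mul_eq_mul_div,
      le_div_iff₀ hε]
    have : lam k * ε ≤ (1 + ε * lam k) ^ 2 := by nlinarith [mul_nonneg hε.le h2]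
    nlinarith [mul_le_mul_of_nonneg_left this (sq_nonneg (inner ℝ (b k) f : ℝ))]
  have hc2 : Summable fun k => c k ^ 2 := by
    refine Summable.of_nonneg_of_le (fun k => sq_nonneg _) (fun k => ?_) hf2
    rw [hc, div_pow]
    exact div_le_self (sq_nonneg _)
      (one_le_pow₀ (by have := mul_nonneg hε.le (hlam k); linarith))
  have hs1 : Summable fun k => c k • b k := by
    have := (b.orthonormal.orthogonalFamily.summable_iff_norm_sq_summable c).2 (by simpa using hc2)
    simpa using this
  have hs2 : Summable fun k => c k • g k := by
    rw [summable_iff_vanishing_norm]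
    intro δ hδ
    -- Testing each eigenvalue equation with the partial sum itself shows that its energy is ∑ λ_k
    -- c_k². As P ≥ 0, coercivity turns an energy below κδ² into a gradient norm below δ.
    obtain ⟨s, hs⟩ := summable_iff_vanishing_norm.1 hlc (κ * δ ^ 2) (by positivity)
    refine ⟨s, fun t ht => ?_⟩
    set v := ∑ k ∈ t, c k • g k
    set h := ∑ k ∈ t, c k • b k
    have hm : (h, v) ∈ D := by
      have : (h, v) = ∑ k ∈ t, c k • (b k, g k) := by
        simp [h, v, Prod.ext_iff, Prod.fst_sum, Prod.snd_sum]
      rw [this]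
      exact D.sum_mem fun k _ => D.smul_mem _ (hmem k)
    have e : A v v + P h h = ∑ k ∈ t, lam k * c k ^ 2 := by
      have e1 : A v v + P h h = ∑ k ∈ t, c k * (A (g k) v + P (b k) h) := by
        simp only [mul_add, Finset.sum_add_distrib]
        congr 1
        · rw [show A v = ∑ k ∈ t, c k • A (g k) by simp [v, map_sum]]
          simp
        · rw [show P h = ∑ k ∈ t, c k • P (b k) by simp [h, map_sum]]
          simp
      rw [e1]
      refine Finset.sum_congr rfl fun k hk => ?_
      rw [heig k (h, v) hm]
      have : inner ℝ (b k) h = c k := b.orthonormal.inner_right_sum c hk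
      simp only [this]; ring
    have h1 := hs t ht
    rw [← e] at h1
    have h2 := (Real.norm_eq_abs _ ▸ le_abs_self (A v v + P h h)).trans_lt h1
    have h3 := hA v
    have h4 := hP h
    have h5 : ‖v‖ ^ 2 < δ ^ 2 := lt_of_mul_lt_mul_left (by linarith) hκ.le
    exact lt_of_pow_lt_pow_left₀ 2 hδ.le h5
  obtain ⟨h, hh⟩ := hs1
  obtain ⟨v, hv⟩ := hs2
  refine ⟨(h, v), ?_, fun k => ?_, fun q hq => ?_⟩
  · have := hh.prodMk hv
    refine hD.mem_of_tendsto this (.of_forall fun t => D.sum_mem fun k _ => ?_)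
    exact D.smul_mem _ (hmem k)
  · have h1 := hh.mapL (innerSL ℝ (b k))
    refine h1.unique ?_
    have := hasSum_ite_eq k (c k)
    refine this.congr_fun fun j => ?_
    rw [map_smul, innerSL_apply_apply]
    have := orthonormal_iff_ite.1 b.orthonormal k j
    rw [this]
    by_cases hjk : j = k <;> simp [hjk, Ne.symm]
  · have h1 : HasSum (fun k => c k * inner ℝ (b k) q.1) (inner ℝ h q.1) := by
      have := hh.mapL (innerSL ℝ q.1)
      simpa [real_inner_comm] using this
    have h2 : HasSum (fun k => c k * A (g k) q.2) (A v q.2) := by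
      simpa using hv.mapL (A.flip q.2)
    have h3 : HasSum (fun k => c k * P (b k) q.1) (P h q.1) := by
      simpa using hh.mapL (P.flip q.1)
    have h4 := b.hasSum_inner_mul_inner f q.1
    -- By the eigenvalue equation the k-th term is c_k (1 + ελ_k) ⟨b_k, q⟩ = ⟨b_k, f⟩ ⟨b_k, q⟩, the
    -- Parseval term of ⟨f, q⟩.
    have h5 := h1.add ((h2.add h3).mul_left ε)
    refine h5.unique (h4.congr_fun fun k => ?_)
    rw [← mul_add, heig k q hq, real_inner_comm (b k) f, hc]
    have := (hpos k).ne'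
    field_simp

/-- The exponential formula e^(-τL) = lim (1 + τL/m)^(-m), tested against ψ: every iterate stays in
S, where the pairing is at most B. Only the scalar inequality passes to the limit, so S need not be
closed. -/
theorem hasSum_exp_le_of_resolvent {H : Type*} [NormedAddCommGroup H] [InnerProductSpace ℝ H]
    (b : HilbertBasis ℕ ℝ H) {lam : ℕ → ℝ} (hlam : ∀ k, 0 ≤ lam k) {S : Set H}
    (hS : ∀ ε : ℝ, 0 < ε → ∀ f ∈ S, ∃ h ∈ S, ∀ k, inner ℝ (b k) h = inner ℝ (b k) f / (1 + ε * lam k))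
    {f ψ : H} (hf : f ∈ S) {B : ℝ} (hB : ∀ h ∈ S, inner ℝ h ψ ≤ B) {τ : ℝ} (hτ : 0 < τ) :
    ∑' k, Real.exp (-τ * lam k) * inner ℝ f (b k) * inner ℝ (b k) ψ ≤ B := by
  have hit : ∀ ε : ℝ, 0 < ε → ∀ m : ℕ, ∃ h ∈ S, ∀ k,
      inner ℝ (b k) h = inner ℝ (b k) f / (1 + ε * lam k) ^ m := fun ε hε m => by
    induction m with
    | zero => exact ⟨f, hf, fun k => by simp⟩
    | succ m ih =>
      obtain ⟨h, h1, h2⟩ := ih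
      obtain ⟨h', h3, h4⟩ := hS ε hε h h1
      exact ⟨h', h3, fun k => by rw [h4, h2, div_div, pow_succ]⟩
  have hpt : ∀ m : ℕ, 0 < m →
      ∑' k, ((1 + τ * lam k / m) ^ m)⁻¹ * inner ℝ f (b k) * inner ℝ (b k) ψ ≤ B := fun m hm => by
    have hm' : (0 : ℝ) < m := by exact_mod_cast hm
    obtain ⟨h, h1, h2⟩ := hit (τ / m) (by positivity) m
    refine le_of_eq_of_le ?_ (hB h h1)
    rw [← b.tsum_inner_mul_inner h ψ]
    refine tsum_congr fun k => ?_
    rw [real_inner_comm (b k) h, h2, real_inner_comm (b k) f]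
    simp only [div_eq_inv_mul]; ring_nf
  have hlim : Filter.Tendsto (fun m : ℕ =>
      ∑' k, ((1 + τ * lam k / m) ^ m)⁻¹ * inner ℝ f (b k) * inner ℝ (b k) ψ) Filter.atTop
      (nhds (∑' k, Real.exp (-τ * lam k) * inner ℝ f (b k) * inner ℝ (b k) ψ)) := by
    -- All the factors (1 + τλ_k/m)^(-m) lie in (0, 1], so the absolutely convergent Parseval series
    -- of ⟨f, ψ⟩ dominates.
    refine tendsto_tsum_of_dominated_convergence
      (bound := fun k => ‖(inner ℝ f (b k) * inner ℝ (b k) ψ : ℝ)‖)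
      (b.summable_inner_mul_inner f ψ).norm (fun k => ?_) (.of_forall fun m k => ?_)
    · have h := (Real.tendsto_one_add_div_pow_exp (τ * lam k)).inv₀ (Real.exp_pos _).ne'
      rw [← Real.exp_neg, ← neg_mul] at h
      exact (h.mul_const _).mul_const _
    · rw [mul_assoc, norm_mul]
      refine mul_le_of_le_one_left (norm_nonneg _) ?_
      have h0 : 0 ≤ τ * lam k / m := by have := hlam k; positivity
      have h1 : 1 ≤ (1 + τ * lam k / m) ^ m := one_le_pow₀ (by linarith)
      rw [Real.norm_of_nonneg (by positivity)]
      exact inv_le_one_of_one_le₀ h1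
  exact le_of_tendsto hlim ((Filter.eventually_gt_atTop 0).mono hpt)

/-! ### The bilinear form of the elliptic operator -/

section Form

variable {n : ℕ} {Ω : Set (Euc n)} {Λ : ℝ} {a : Euc n → Matrix (Fin n) (Fin n) ℝ} {c : Euc n → ℝ}

theorem isFiniteMeasure_leb (hΩb : Bornology.IsBounded Ω) : IsFiniteMeasure (leb Ω) :=
  ⟨by rw [Measure.restrict_apply_univ]; exact hΩb.measure_lt_top⟩

/-- The bilinear form `∑ M i j ξ j ζ i` of a matrix. -/
def matrixForm (M : Matrix (Fin n) (Fin n) ℝ) (ξ ζ : Euc n) : ℝ :=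
  ∑ i, ∑ j, M i j * ξ j * ζ i

theorem matrixForm_add_left (M : Matrix (Fin n) (Fin n) ℝ) (ξ ξ' ζ : Euc n) :
    matrixForm M (ξ + ξ') ζ = matrixForm M ξ ζ + matrixForm M ξ' ζ := by
  simp [matrixForm, mul_add, add_mul, Finset.sum_add_distrib]

theorem matrixForm_add_right (M : Matrix (Fin n) (Fin n) ℝ) (ξ ζ ζ' : Euc n) :
    matrixForm M ξ (ζ + ζ') = matrixForm M ξ ζ + matrixForm M ξ ζ' := by
  simp [matrixForm, mul_add, Finset.sum_add_distrib]

theorem matrixForm_smul_left (M : Matrix (Fin n) (Fin n) ℝ) (r : ℝ) (ξ ζ : Euc n) :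
    matrixForm M (r • ξ) ζ = r * matrixForm M ξ ζ := by
  simp only [matrixForm, Finset.mul_sum, PiLp.smul_apply, smul_eq_mul]
  exact Finset.sum_congr rfl fun i _ => Finset.sum_congr rfl fun j _ => by ring

theorem matrixForm_smul_right (M : Matrix (Fin n) (Fin n) ℝ) (r : ℝ) (ξ ζ : Euc n) :
    matrixForm M ξ (r • ζ) = r * matrixForm M ξ ζ := by
  simp only [matrixForm, Finset.mul_sum, PiLp.smul_apply, smul_eq_mul]
  exact Finset.sum_congr rfl fun i _ => Finset.sum_congr rfl fun j _ => by ring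

theorem matrixForm_comm {M : Matrix (Fin n) (Fin n) ℝ} (hM : ∀ i j, M i j = M j i)
    (ξ ζ : Euc n) : matrixForm M ξ ζ = matrixForm M ζ ξ := by
  rw [matrixForm, Finset.sum_comm]
  refine Finset.sum_congr rfl fun i _ => Finset.sum_congr rfl fun j _ => ?_
  rw [hM j i]; ring

/-- Ellipticity controls only the diagonal. Nonnegativity at ξ ± ζ gives 2|M(ξ, ζ)| ≤ M(ξ, ξ) + M(ζ,
ζ), which settles unit vectors, and homogeneity does the rest. -/
theorem abs_matrixForm_le {M : Matrix (Fin n) (Fin n) ℝ} (hM : ∀ i j, M i j = M j i)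
    (h0 : ∀ ξ, 0 ≤ matrixForm M ξ ξ) (h1 : ∀ ξ, matrixForm M ξ ξ ≤ Λ * ‖ξ‖ ^ 2) (ξ ζ : Euc n) :
    |matrixForm M ξ ζ| ≤ Λ * ‖ξ‖ * ‖ζ‖ := by
  have unit : ∀ ξ ζ : Euc n, ‖ξ‖ = 1 → ‖ζ‖ = 1 → |matrixForm M ξ ζ| ≤ Λ := fun ξ ζ e1 e2 => by
    have p1 := h0 (ξ + ζ)
    have p2 := h0 (ξ + (-1 : ℝ) • ζ)
    have q1 := h1 ξ
    have q2 := h1 ζ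
    simp only [matrixForm_add_left, matrixForm_add_right, matrixForm_smul_left,
      matrixForm_smul_right] at p1 p2
    rw [e1] at q1
    rw [e2] at q2
    have := matrixForm_comm hM ξ ζ
    rw [abs_le]; constructor <;> linarith
  rcases eq_or_ne ξ 0 with rfl | hξ
  · simp [matrixForm]
  rcases eq_or_ne ζ 0 with rfl | hζ
  · simp [matrixForm]
  have n1 := norm_pos_iff.2 hξ
  have n2 := norm_pos_iff.2 hζ
  have h := unit (‖ξ‖⁻¹ • ξ) (‖ζ‖⁻¹ • ζ)
    (by rw [norm_smul, norm_inv, norm_norm, inv_mul_cancel₀ n1.ne'])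
    (by rw [norm_smul, norm_inv, norm_norm, inv_mul_cancel₀ n2.ne'])
  rw [matrixForm_smul_left, matrixForm_smul_right, abs_mul, abs_mul, abs_inv, abs_inv, abs_norm,
    abs_norm] at h
  rw [inv_mul_le_iff₀ n1, inv_mul_le_iff₀ n2] at h
  linarith

theorem IsEllipticCoeff.matrixForm_bounds (hL : IsEllipticCoeff Ω Λ a c) :
    ∀ᵐ x ∂leb Ω, (∀ ξ, Λ⁻¹ * ‖ξ‖ ^ 2 ≤ matrixForm (a x) ξ ξ) ∧
      ∀ ξ ζ, |matrixForm (a x) ξ ζ| ≤ Λ * ‖ξ‖ * ‖ζ‖ := by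
  filter_upwards [hL.symm, hL.elliptic] with x h1 h2
  have e : ∀ ξ : Euc n, matrixForm (a x) ξ ξ = ∑ i, ∑ j, a x i j * ξ i * ξ j := fun ξ =>
    Finset.sum_congr rfl fun i _ => Finset.sum_congr rfl fun j _ => by ring
  have hΛ := hL.pos
  refine ⟨fun ξ => (e ξ).symm ▸ (h2 ξ).1, abs_matrixForm_le h1 (fun ξ => ?_)
    fun ξ => (e ξ).symm ▸ (h2 ξ).2⟩
  exact le_trans (by positivity) ((e ξ).symm ▸ (h2 ξ).1)

theorem aestronglyMeasurable_matrixForm (hL : IsEllipticCoeff Ω Λ a c) {g h : Euc n → Euc n}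
    (hg : AEStronglyMeasurable g (leb Ω)) (hh : AEStronglyMeasurable h (leb Ω)) :
    AEStronglyMeasurable (fun x => matrixForm (a x) (g x) (h x)) (leb Ω) := by
  have hc : ∀ {g : Euc n → Euc n} (i : Fin n), AEStronglyMeasurable g (leb Ω) →
      AEStronglyMeasurable (fun x => g x i) (leb Ω) := fun i hg =>
    (EuclideanSpace.proj (𝕜 := ℝ) i).continuous.comp_aestronglyMeasurable hg
  refine Finset.aestronglyMeasurable_fun_sum _ fun i _ =>
    Finset.aestronglyMeasurable_fun_sum _ fun j _ => ?_
  exact ((hL.meas_a i j).aestronglyMeasurable.mul (hc j hg)).mul (hc i hh)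

theorem integrable_matrixForm (hL : IsEllipticCoeff Ω Λ a c) {g h : Euc n → Euc n}
    (hg : MemLp g 2 (leb Ω)) (hh : MemLp h 2 (leb Ω)) :
    Integrable (fun x => matrixForm (a x) (g x) (h x)) (leb Ω) := by
  refine ((hg.norm.integrable_mul hh.norm).const_mul Λ).mono'
    (aestronglyMeasurable_matrixForm hL hg.1 hh.1) ?_
  filter_upwards [hL.matrixForm_bounds] with x hx
  rw [Real.norm_eq_abs]
  simpa [mul_assoc] using hx.2 (g x) (h x)

theorem integral_norm_mul_norm_le {E F : Type*} [NormedAddCommGroup E] [InnerProductSpace ℝ E]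
    [NormedAddCommGroup F] [InnerProductSpace ℝ F] {X : Type*} [MeasurableSpace X] {μ : Measure X}
    (g : Lp E 2 μ) (h : Lp F 2 μ) : ∫ x, ‖g x‖ * ‖h x‖ ∂μ ≤ ‖g‖ * ‖h‖ := by
  have hg := (Lp.memLp g).norm
  have hh := (Lp.memLp h).norm
  have e : ∫ x, ‖g x‖ * ‖h x‖ ∂μ = inner ℝ (hh.toLp _) (hg.toLp _) := by
    rw [L2.inner_def]
    refine integral_congr_ae ?_
    filter_upwards [hg.coeFn_toLp, hh.coeFn_toLp] with x h1 h2
    rw [h1, h2]; simp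
  have e1 : ‖hg.toLp _‖ = ‖g‖ := by
    rw [Lp.norm_toLp, eLpNorm_norm, Lp.norm_def]
  have e2 : ‖hh.toLp _‖ = ‖h‖ := by
    rw [Lp.norm_toLp, eLpNorm_norm, Lp.norm_def]
  rw [e, ← e1, ← e2, mul_comm ‖hg.toLp _‖]
  exact real_inner_le_norm _ _

/-- The form `∫ a ∇f · ∇w` as a bounded bilinear form on gradients. -/
def energyForm (hL : IsEllipticCoeff Ω Λ a c) :
    Lp (Euc n) 2 (leb Ω) →L[ℝ] Lp (Euc n) 2 (leb Ω) →L[ℝ] ℝ :=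
  LinearMap.mkContinuous₂
    (LinearMap.mk₂ ℝ (fun g h : Lp (Euc n) 2 (leb Ω) => ∫ x in Ω, matrixForm (a x) (g x) (h x))
      (fun g g' h => by
        rw [← integral_add (integrable_matrixForm hL (Lp.memLp g) (Lp.memLp h))
          (integrable_matrixForm hL (Lp.memLp g') (Lp.memLp h))]
        refine integral_congr_ae ?_
        filter_upwards [Lp.coeFn_add g g'] with x hx
        rw [hx, Pi.add_apply, matrixForm_add_left])
      (fun r g h => by
        rw [smul_eq_mul, ← integral_const_mul]
        refine integral_congr_ae ?_
        filter_upwards [Lp.coeFn_smul r g] with x hx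
        rw [hx, Pi.smul_apply, matrixForm_smul_left])
      (fun g h h' => by
        rw [← integral_add (integrable_matrixForm hL (Lp.memLp g) (Lp.memLp h))
          (integrable_matrixForm hL (Lp.memLp g) (Lp.memLp h'))]
        refine integral_congr_ae ?_
        filter_upwards [Lp.coeFn_add h h'] with x hx
        rw [hx, Pi.add_apply, matrixForm_add_right])
      (fun r g h => by
        rw [smul_eq_mul, ← integral_const_mul]
        refine integral_congr_ae ?_
        filter_upwards [Lp.coeFn_smul r h] with x hx
        rw [hx, Pi.smul_apply, matrixForm_smul_right]))
    Λ (fun g h => by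
      rw [LinearMap.mk₂_apply, mul_assoc]
      refine (norm_integral_le_integral_norm _).trans ?_
      refine (integral_mono_ae (integrable_matrixForm hL (Lp.memLp g) (Lp.memLp h)).norm
        (((Lp.memLp g).norm.integrable_mul (Lp.memLp h).norm).const_mul Λ) ?_).trans ?_
      · filter_upwards [hL.matrixForm_bounds] with x hx
        simpa [mul_assoc] using hx.2 (g x) (h x)
      · rw [integral_const_mul]
        exact mul_le_mul_of_nonneg_left (integral_norm_mul_norm_le g h) hL.pos.le)

theorem energyForm_apply (hL : IsEllipticCoeff Ω Λ a c) (g h : Lp (Euc n) 2 (leb Ω)) :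
    energyForm hL g h = ∫ x in Ω, matrixForm (a x) (g x) (h x) := rfl

theorem energyForm_coercive (hL : IsEllipticCoeff Ω Λ a c) (g : Lp (Euc n) 2 (leb Ω)) :
    Λ⁻¹ * ‖g‖ ^ 2 ≤ energyForm hL g g := by
  rw [energyForm_apply, ← real_inner_self_eq_norm_sq, L2.inner_def, ← integral_const_mul]
  refine integral_mono_ae ((L2.integrable_inner g g).const_mul _)
    (integrable_matrixForm hL (Lp.memLp g) (Lp.memLp g)) ?_
  filter_upwards [hL.matrixForm_bounds] with x hx
  rw [real_inner_self_eq_norm_sq]; exact hx.1 _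

theorem IsEllipticCoeff.exists_bound (hL : IsEllipticCoeff Ω Λ a c) :
    ∃ M : ℝ, 0 ≤ M ∧ ∀ᵐ x ∂leb Ω, ‖c x‖ ≤ M := by
  obtain ⟨M, hM⟩ := hL.bdd_c
  refine ⟨max M 0, le_max_right _ _, ?_⟩
  filter_upwards [hM, hL.nonneg_c] with x h1 h2
  rw [Real.norm_of_nonneg h2]; exact h1.trans (le_max_left _ _)

theorem integrable_potential (hL : IsEllipticCoeff Ω Λ a c) {f w : Euc n → ℝ}
    (hf : MemLp f 2 (leb Ω)) (hw : MemLp w 2 (leb Ω)) :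
    Integrable (fun x => c x * f x * w x) (leb Ω) := by
  obtain ⟨M, -, hM⟩ := hL.exists_bound
  have := (hf.integrable_mul hw).bdd_mul hL.meas_c.aestronglyMeasurable hM
  exact this.congr (.of_forall fun x => (mul_assoc _ _ _).symm)

/-- The form `∫ c f w`. -/
def potentialForm (hL : IsEllipticCoeff Ω Λ a c) :
    Lp ℝ 2 (leb Ω) →L[ℝ] Lp ℝ 2 (leb Ω) →L[ℝ] ℝ :=
  LinearMap.mkContinuous₂
    (LinearMap.mk₂ ℝ (fun f w : Lp ℝ 2 (leb Ω) => ∫ x in Ω, c x * f x * w x)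
      (fun f f' w => by
        rw [← integral_add (integrable_potential hL (Lp.memLp f) (Lp.memLp w))
          (integrable_potential hL (Lp.memLp f') (Lp.memLp w))]
        refine integral_congr_ae ?_
        filter_upwards [Lp.coeFn_add f f'] with x hx
        rw [hx, Pi.add_apply]; ring)
      (fun r f w => by
        rw [smul_eq_mul, ← integral_const_mul]
        refine integral_congr_ae ?_
        filter_upwards [Lp.coeFn_smul r f] with x hx
        rw [hx, Pi.smul_apply, smul_eq_mul]; ring)
      (fun f w w' => by
        rw [← integral_add (integrable_potential hL (Lp.memLp f) (Lp.memLp w))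
          (integrable_potential hL (Lp.memLp f) (Lp.memLp w'))]
        refine integral_congr_ae ?_
        filter_upwards [Lp.coeFn_add w w'] with x hx
        rw [hx, Pi.add_apply]; ring)
      (fun r f w => by
        rw [smul_eq_mul, ← integral_const_mul]
        refine integral_congr_ae ?_
        filter_upwards [Lp.coeFn_smul r w] with x hx
        rw [hx, Pi.smul_apply, smul_eq_mul]; ring))
    hL.exists_bound.choose (fun f w => by
      have hM := hL.exists_bound.choose_spec
      rw [LinearMap.mk₂_apply, mul_assoc]
      refine (norm_integral_le_integral_norm _).trans ?_
      refine (integral_mono_ae (integrable_potential hL (Lp.memLp f) (Lp.memLp w)).norm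
        (((Lp.memLp f).norm.integrable_mul (Lp.memLp w).norm).const_mul
          hL.exists_bound.choose) ?_).trans ?_
      · filter_upwards [hM.2] with x hx
        rw [norm_mul, norm_mul, mul_assoc]
        exact mul_le_mul_of_nonneg_right hx (by positivity)
      · rw [integral_const_mul]
        exact mul_le_mul_of_nonneg_left (integral_norm_mul_norm_le f w) hM.1)

theorem potentialForm_apply (hL : IsEllipticCoeff Ω Λ a c) (f w : Lp ℝ 2 (leb Ω)) :
    potentialForm hL f w = ∫ x in Ω, c x * f x * w x := rfl

theorem potentialForm_self_nonneg (hL : IsEllipticCoeff Ω Λ a c) (f : Lp ℝ 2 (leb Ω)) :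
    0 ≤ potentialForm hL f f := by
  rw [potentialForm_apply]
  refine integral_nonneg_of_ae ?_
  filter_upwards [hL.nonneg_c] with x hx
  rw [mul_assoc]; exact mul_nonneg hx (mul_self_nonneg _)

theorem inner_eq_integral (f g : Lp ℝ 2 (leb Ω)) : inner ℝ f g = ∫ x in Ω, f x * g x := by
  rw [L2.inner_def]
  exact integral_congr_ae (.of_forall fun x => by simp [mul_comm])

/-- The eigenvalues of `L` are nonnegative. -/
theorem eigenvalue_nonneg (hL : IsEllipticCoeff Ω Λ a c) {bc : BoundaryCondition} {lam : ℝ}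
    {φ : Lp ℝ 2 (leb Ω)} (hφ : IsEigenfunction Ω a c bc lam φ) (h1 : ‖φ‖ = 1) : 0 ≤ lam := by
  obtain ⟨g, hg, heq⟩ := hφ
  have h := heq φ g hg
  have e : ∫ x in Ω, φ x * φ x = 1 := by
    rw [← inner_eq_integral, real_inner_self_eq_norm_sq, h1]; norm_num
  rw [e, mul_one] at h
  rw [← h]
  refine add_nonneg (integral_nonneg_of_ae ?_) (integral_nonneg_of_ae ?_)
  · filter_upwards [hL.matrixForm_bounds] with x hx
    have hΛ := hL.pos
    exact le_trans (by positivity) (hx.1 (g x))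
  · filter_upwards [hL.nonneg_c] with x hx
    rw [mul_assoc]; exact mul_nonneg hx (mul_self_nonneg _)

end Form

/-! ### The Dirichlet form domain -/

section Dirichlet

variable {n : ℕ} {Ω : Set (Euc n)}

theorem gradient_apply (η : Euc n → ℝ) (x : Euc n) (i : Fin n) :
    gradient η x i = fderiv ℝ η x (EuclideanSpace.single i 1) := by
  rw [gradient, ← InnerProductSpace.toDual_symm_apply, EuclideanSpace.inner_single_right]
  simp

namespace IsTest

variable {η : Euc n → ℝ}

theorem continuous_gradient (hη : IsTest Ω η) : Continuous (gradient η) :=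
  (InnerProductSpace.toDual ℝ (Euc n)).symm.continuous.comp (hη.1.continuous_fderiv (by simp))

theorem hasCompactSupport_gradient (hη : IsTest Ω η) : HasCompactSupport (gradient η) :=
  (hη.2.1.fderiv (𝕜 := ℝ)).comp_left (map_zero (InnerProductSpace.toDual ℝ (Euc n)).symm)

theorem memLp (hη : IsTest Ω η) : MemLp η 2 (leb Ω) :=
  (hη.1.continuous.memLp_of_hasCompactSupport hη.2.1).restrict Ω

theorem memLp_gradient (hη : IsTest Ω η) : MemLp (gradient η) 2 (leb Ω) :=
  (hη.continuous_gradient.memLp_of_hasCompactSupport hη.hasCompactSupport_gradient).restrict Ω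

theorem zero : IsTest Ω (0 : Euc n → ℝ) :=
  ⟨contDiff_const, HasCompactSupport.zero, by simp [tsupport]⟩

theorem add {η' : Euc n → ℝ} (hη : IsTest Ω η) (hη' : IsTest Ω η') : IsTest Ω (η + η') :=
  ⟨hη.1.add hη'.1, hη.2.1.add hη'.2.1, (tsupport_add η η').trans (union_subset hη.2.2 hη'.2.2)⟩

theorem smul (r : ℝ) (hη : IsTest Ω η) : IsTest Ω (r • η) :=
  ⟨contDiff_const.smul hη.1, hη.2.1.smul_left (f := fun _ => r),
    (tsupport_smul_subset_right (fun _ => r) η).trans hη.2.2⟩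

theorem comp {G : ℝ → ℝ} (hG : ContDiff ℝ ∞ G) (hG0 : G 0 = 0) (hη : IsTest Ω η) :
    IsTest Ω (G ∘ η) :=
  ⟨hG.comp hη.1, hη.2.1.comp_left hG0, (tsupport_comp_subset hG0 η).trans hη.2.2⟩

theorem differentiable (hη : IsTest Ω η) : Differentiable ℝ η := hη.1.differentiable (by simp)

theorem gradient_add {η' : Euc n → ℝ} (hη : IsTest Ω η) (hη' : IsTest Ω η') :
    gradient (η + η') = gradient η + gradient η' := by
  ext1 x
  simp only [gradient, Pi.add_apply]
  rw [fderiv_add (hη.differentiable x) (hη'.differentiable x), map_add]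

theorem gradient_smul (r : ℝ) (hη : IsTest Ω η) : gradient (r • η) = r • gradient η := by
  ext1 x
  simp only [gradient, Pi.smul_apply]
  rw [fderiv_const_smul (hη.differentiable x), map_smul]

theorem gradient_comp {G : ℝ → ℝ} (hG : ContDiff ℝ ∞ G) (hη : IsTest Ω η) (x : Euc n) :
    gradient (G ∘ η) x = deriv G (η x) • gradient η x := by
  simp only [gradient]
  have h : HasFDerivAt (G ∘ η) (deriv G (η x) • fderiv ℝ η x) x :=
    ((hG.differentiable (by simp) (η x)).hasDerivAt).comp_hasFDerivAt x
      (hη.differentiable x).hasFDerivAt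
  rw [h.fderiv, map_smul]

/-- Integration by parts for test functions. -/
theorem integral_mul_fderiv {η' : Euc n → ℝ} (hη : IsTest Ω η) (hη' : IsTest Ω η')
    (i : Fin n) :
    ∫ x in Ω, η x * fderiv ℝ η' x (EuclideanSpace.single i 1) =
      - ∫ x in Ω, gradient η x i * η' x := by
  have c1 : ∀ {f : Euc n → ℝ}, IsTest Ω f →
      Continuous fun x => fderiv ℝ f x (EuclideanSpace.single i 1) := fun hf =>
    (hf.1.continuous_fderiv (by simp)).clm_apply continuous_const
  have c2 := hη.1.continuous
  have c3 := hη'.1.continuous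
  have h := integral_mul_fderiv_eq_neg_fderiv_mul_of_integrable (μ := (volume : Measure (Euc n)))
    (f := η) (g := η') (v := EuclideanSpace.single i 1)
    (((c1 hη).mul c3).integrable_of_hasCompactSupport (hη'.2.1.mul_left))
    ((c2.mul (c1 hη')).integrable_of_hasCompactSupport (hη.2.1.mul_right))
    ((c2.mul c3).integrable_of_hasCompactSupport hη.2.1.mul_right)
    (fun x _ => hη.differentiable x) (fun x _ => hη'.differentiable x)
  -- Both integrands vanish off Ω because the supports lie inside it, so the boundaryless formula on
  -- the whole space applies.
  rw [setIntegral_eq_integral_of_forall_compl_eq_zero,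
    setIntegral_eq_integral_of_forall_compl_eq_zero, h]
  · simp only [gradient_apply]
  · intro x hx
    rw [image_eq_zero_of_notMem_tsupport fun h => hx (hη'.2.2 h), mul_zero]
  · intro x hx
    rw [image_eq_zero_of_notMem_tsupport fun h => hx (hη.2.2 h), zero_mul]

end IsTest

/-- The graph of the gradient on `C_c^∞(Ω)`. -/
def testGraph (Ω : Set (Euc n)) : Submodule ℝ (Lp ℝ 2 (leb Ω) × Lp (Euc n) 2 (leb Ω)) where
  carrier := {p | ∃ η, IsTest Ω η ∧ p.1 =ᵐ[leb Ω] η ∧ p.2 =ᵐ[leb Ω] gradient η}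
  add_mem' := by
    rintro p q ⟨η, h1, h2, h3⟩ ⟨η', h1', h2', h3'⟩
    exact ⟨η + η', h1.add h1', (Lp.coeFn_add _ _).trans (h2.add h2'),
      (Lp.coeFn_add _ _).trans (h1.gradient_add h1' ▸ h3.add h3')⟩
  zero_mem' := by
    refine ⟨0, IsTest.zero, Lp.coeFn_zero _ _ _, (Lp.coeFn_zero _ _ _).trans (.of_eq ?_)⟩
    ext1 x
    simp [gradient, show fderiv ℝ (0 : Euc n → ℝ) x = 0 from by simp]
  smul_mem' := by
    rintro r p ⟨η, h1, h2, h3⟩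
    exact ⟨r • η, h1.smul r, (Lp.coeFn_smul _ _).trans (h2.const_smul r),
      (Lp.coeFn_smul _ _).trans (h1.gradient_smul r ▸ h3.const_smul r)⟩

/-- `H¹₀(Ω)` as a closed subspace of `L² × L²`. -/
def dirichletSpace (Ω : Set (Euc n)) : Submodule ℝ (Lp ℝ 2 (leb Ω) × Lp (Euc n) 2 (leb Ω)) :=
  (testGraph Ω).topologicalClosure

theorem isClosed_dirichletSpace : 
    IsClosed (dirichletSpace Ω : Set (Lp ℝ 2 (leb Ω) × Lp (Euc n) 2 (leb Ω))) :=
  (testGraph Ω).isClosed_topologicalClosure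

theorem mem_dirichletSpace_iff {p : Lp ℝ 2 (leb Ω) × Lp (Euc n) 2 (leb Ω)} :
    p ∈ dirichletSpace Ω ↔ ∀ ε : ℝ≥0∞, 0 < ε → ∃ η, IsTest Ω η ∧
      eLpNorm (fun x => p.1 x - η x) 2 (leb Ω) < ε ∧
        eLpNorm (fun x => p.2 x - gradient η x) 2 (leb Ω) < ε := by
  have e1 : ∀ (q : Lp ℝ 2 (leb Ω) × Lp (Euc n) 2 (leb Ω)) (η : Euc n → ℝ),
      q.1 =ᵐ[leb Ω] η → q.2 =ᵐ[leb Ω] gradient η →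
      edist p q = max (eLpNorm (fun x => p.1 x - η x) 2 (leb Ω))
        (eLpNorm (fun x => p.2 x - gradient η x) 2 (leb Ω)) := fun q η h1 h2 => by
    rw [Prod.edist_eq, Lp.edist_def, Lp.edist_def]
    congr 1
    · exact eLpNorm_congr_ae (h1.mono fun x hx => by simp [hx])
    · exact eLpNorm_congr_ae (h2.mono fun x hx => by simp [hx])
  rw [dirichletSpace, ← SetLike.mem_coe, Submodule.topologicalClosure_coe, EMetric.mem_closure_iff]
  refine forall₂_congr fun ε hε => ⟨?_, ?_⟩
  · rintro ⟨q, ⟨η, h1, h2, h3⟩, hq⟩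
    rw [e1 q η h2 h3] at hq
    exact ⟨η, h1, (le_max_left _ _).trans_lt hq, (le_max_right _ _).trans_lt hq⟩
  · rintro ⟨η, h1, h2, h3⟩
    refine ⟨(h1.memLp.toLp η, h1.memLp_gradient.toLp _), ⟨η, h1, h1.memLp.coeFn_toLp,
      h1.memLp_gradient.coeFn_toLp⟩, ?_⟩
    rw [e1 _ η h1.memLp.coeFn_toLp h1.memLp_gradient.coeFn_toLp]
    exact max_lt h2 h3

/-- Approximability is the definition of the closure. The weak gradient identity equates two inner
products with fixed L² vectors, a closed condition on the pair that holds on the graph of test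
functions by integration by parts. -/
theorem memH10_of_mem_dirichletSpace {p : Lp ℝ 2 (leb Ω) × Lp (Euc n) 2 (leb Ω)}
    (hp : p ∈ dirichletSpace Ω) : MemH10 Ω p.1 p.2 := by
  refine ⟨⟨Lp.memLp _, Lp.memLp _, fun η hη i => ?_⟩, mem_dirichletSpace_iff.1 hp⟩
  have m1 : MemLp (fun x => fderiv ℝ η x (EuclideanSpace.single i 1)) 2 (leb Ω) := by
    have := hη.memLp_gradient.continuousLinearMap_comp (EuclideanSpace.proj (𝕜 := ℝ) i)
    refine this.congr_norm ?_ (.of_forall fun x => ?_)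
    · exact ((hη.1.continuous_fderiv (by simp)).clm_apply
        continuous_const).aestronglyMeasurable
    · simp [gradient_apply]
  have m2 : MemLp (fun x => EuclideanSpace.single i (η x)) 2 (leb Ω) := by
    have := hη.memLp.continuousLinearMap_comp
      ((ContinuousLinearMap.id ℝ ℝ).smulRight (EuclideanSpace.single i (1 : ℝ)))
    refine this.ae_eq (.of_forall fun x => ?_)
    ext j
    by_cases hj : j = i <;> simp [hj]
  have e1 : ∀ q : Lp ℝ 2 (leb Ω) × Lp (Euc n) 2 (leb Ω),
      ∫ x in Ω, q.1 x * fderiv ℝ η x (EuclideanSpace.single i 1) = inner ℝ q.1 (m1.toLp _) :=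
    fun q => by
      rw [inner_eq_integral]
      exact integral_congr_ae (m1.coeFn_toLp.mono fun x hx => by simp only [hx])
  have e2 : ∀ q : Lp ℝ 2 (leb Ω) × Lp (Euc n) 2 (leb Ω),
      ∫ x in Ω, q.2 x i * η x = inner ℝ q.2 (m2.toLp _) := fun q => by
    rw [L2.inner_def]
    refine integral_congr_ae (m2.coeFn_toLp.mono fun x hx => ?_)
    simp only [hx, EuclideanSpace.inner_single_right]
    simp [mul_comm]
  have hcl : IsClosed {q : Lp ℝ 2 (leb Ω) × Lp (Euc n) 2 (leb Ω) |
      (inner ℝ q.1 (m1.toLp _) : ℝ) = - inner ℝ q.2 (m2.toLp _)} :=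
    isClosed_eq (by fun_prop) (by fun_prop)
  rw [e1, e2]
  rw [dirichletSpace, ← SetLike.mem_coe, Submodule.topologicalClosure_coe] at hp
  refine closure_minimal ?_ hcl hp
  rintro q ⟨η', h1, h2, h3⟩
  change inner ℝ q.1 (m1.toLp _) = - inner ℝ q.2 (m2.toLp _)
  rw [← e1, ← e2]
  have i1 : ∫ x in Ω, q.1 x * fderiv ℝ η x (EuclideanSpace.single i 1) =
      ∫ x in Ω, η' x * fderiv ℝ η x (EuclideanSpace.single i 1) :=
    integral_congr_ae (h2.mono fun x hx => by simp only [hx])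
  have i2 : ∫ x in Ω, q.2 x i * η x = ∫ x in Ω, gradient η' x i * η x :=
    integral_congr_ae (h3.mono fun x hx => by simp only [hx])
  rw [i1, i2]
  exact h1.integral_mul_fderiv hη i

theorem mem_dirichletSpace_of_memH10 {f : Lp ℝ 2 (leb Ω)} {g : Euc n → Euc n}
    (h : MemH10 Ω f g) : (f, h.1.2.1.toLp g) ∈ dirichletSpace Ω := by
  rw [mem_dirichletSpace_iff]
  intro ε hε
  obtain ⟨η, h1, h2, h3⟩ := h.2 ε hε
  refine ⟨η, h1, h2, ?_⟩
  refine lt_of_eq_of_lt (eLpNorm_congr_ae ?_) h3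
  exact h.1.2.1.coeFn_toLp.mono fun x hx => by simp only [hx]

/-- Truncation of an `L²` function against a dominated sequence of multipliers. -/
theorem tendsto_eLpNorm_smul_of_tendsto_ae {E F : Type*} [MeasurableSpace E] {μ : Measure E}
    [NormedAddCommGroup F] [NormedSpace ℝ F] {g : E → F} (hg : MemLp g 2 μ) {m : ℕ → E → ℝ}
    (hm : ∀ k, AEStronglyMeasurable (m k) μ) {C : ℝ} (hC : ∀ k x, |m k x| ≤ C)
    (hlim : ∀ᵐ x ∂μ, Filter.Tendsto (fun k => m k x) Filter.atTop (nhds 0)) :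
    Filter.Tendsto (fun k => eLpNorm (fun x => m k x • g x) 2 μ) Filter.atTop (nhds 0) := by
  have e : ∀ k, eLpNorm (fun x => m k x • g x) 2 μ =
      (∫⁻ x, ‖m k x • g x‖ₑ ^ (2 : ℝ) ∂μ) ^ (1 / 2 : ℝ) := fun k => by
    rw [eLpNorm_eq_lintegral_rpow_enorm_toReal (by norm_num) (by norm_num)]
    simp
  simp only [e]
  have h0 : Filter.Tendsto (fun k => ∫⁻ x, ‖m k x • g x‖ₑ ^ (2 : ℝ) ∂μ) Filter.atTop
      (nhds (∫⁻ _, 0 ∂μ)) := by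
    refine tendsto_lintegral_of_dominated_convergence'
      (fun x => ENNReal.ofReal C ^ (2 : ℝ) * ‖g x‖ₑ ^ (2 : ℝ)) (fun k => ?_) (fun k => ?_) ?_ ?_
    · exact (((hm k).smul hg.1).enorm).pow_const _
    · refine .of_forall fun x => ?_
      simp only [enorm_smul]
      rw [ENNReal.mul_rpow_of_nonneg _ _ (by norm_num)]
      refine mul_le_mul_left (ENNReal.rpow_le_rpow ?_ (by norm_num)) _
      rw [← ofReal_norm, Real.norm_eq_abs]
      exact ENNReal.ofReal_le_ofReal (hC k x)
    · have h2 := (eLpNorm_lt_top_iff_lintegral_rpow_enorm_lt_top (by norm_num) (by norm_num)).1 hg.2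
      rw [lintegral_const_mul' _ _ (by simp)]
      exact ENNReal.mul_ne_top (by simp) (by simpa using h2.ne)
    · filter_upwards [hlim] with x hx
      have h1 := (hx.smul_const (g x)).enorm
      rw [zero_smul, enorm_zero] at h1
      have h2 := (ENNReal.continuous_rpow_const (y := 2)).tendsto 0 |>.comp h1
      simpa [Function.comp_def] using h2
  have h1 := (ENNReal.continuous_rpow_const (y := 1 / 2)).tendsto _ |>.comp h0
  simpa [Function.comp_def] using h1

/-- The chain rule in `H¹₀(Ω)`. -/
theorem exists_comp_mem_dirichletSpace {p : Lp ℝ 2 (leb Ω) × Lp (Euc n) 2 (leb Ω)}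
    (hp : p ∈ dirichletSpace Ω) {G : ℝ → ℝ} (hG : ContDiff ℝ ∞ G) (hG0 : G 0 = 0) {C : ℝ}
    (hC : ∀ y, |deriv G y| ≤ C) :
    ∃ q ∈ dirichletSpace Ω, q.1 =ᵐ[leb Ω] G ∘ p.1 ∧
      q.2 =ᵐ[leb Ω] fun x => deriv G (p.1 x) • p.2 x := by
  have hGd : Continuous (deriv G) := hG.continuous_deriv (by simp)
  have hlip : ∀ y z, |G y - G z| ≤ C * |y - z| := fun y z =>
    convex_univ.norm_image_sub_le_of_norm_deriv_le
      (fun x _ => hG.differentiable (by simp) x) (fun x _ => hC x) (mem_univ z) (mem_univ y)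
  have m1 : MemLp (G ∘ p.1) 2 (leb Ω) := by
    refine (Lp.memLp p.1).of_le_mul (c := C) (hG.continuous.comp_aestronglyMeasurable
      (Lp.aestronglyMeasurable _)) (.of_forall fun x => ?_)
    simpa [hG0] using hlip (p.1 x) 0
  have hdm : AEStronglyMeasurable (fun x => deriv G (p.1 x)) (leb Ω) :=
    hGd.comp_aestronglyMeasurable (Lp.aestronglyMeasurable _)
  have m2 : MemLp (fun x => deriv G (p.1 x) • p.2 x) 2 (leb Ω) := by
    refine (Lp.memLp p.2).of_le_mul (c := C) (hdm.smul (Lp.aestronglyMeasurable _))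
      (.of_forall fun x => ?_)
    rw [norm_smul]; exact mul_le_mul_of_nonneg_right (hC _) (norm_nonneg _)
  refine ⟨(m1.toLp _, m2.toLp _), ?_, m1.coeFn_toLp, m2.coeFn_toLp⟩
  have hp' := hp
  rw [dirichletSpace, ← SetLike.mem_coe, Submodule.topologicalClosure_coe,
    mem_closure_iff_seq_limit] at hp'
  obtain ⟨w, hw, hwlim⟩ := hp'
  -- G' is merely continuous and bounded here, so G'(η_k) → G'(p) is obtained pointwise almost
  -- everywhere, along a subsequence of the approximating test functions.
  obtain ⟨ns, hns, hae⟩ := (tendstoInMeasure_of_tendsto_Lp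
    ((continuous_fst.tendsto p).comp hwlim)).exists_seq_tendsto_ae
  choose η hη hη1 hη2 using hw
  have hwlim' := hwlim.comp hns.tendsto_atTop
  have l1 : Filter.Tendsto (fun k => eLpNorm (fun x => p.1 x - η (ns k) x) 2 (leb Ω))
      Filter.atTop (nhds 0) := by
    have := (Lp.tendsto_Lp_iff_tendsto_eLpNorm' _ _).1 ((continuous_fst.tendsto p).comp hwlim')
    refine this.congr fun k => ?_
    rw [eLpNorm_sub_comm]
    exact eLpNorm_congr_ae ((hη1 (ns k)).mono fun x hx => by simp [hx])
  have l2 : Filter.Tendsto (fun k => eLpNorm (fun x => p.2 x - gradient (η (ns k)) x) 2 (leb Ω))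
      Filter.atTop (nhds 0) := by
    have := (Lp.tendsto_Lp_iff_tendsto_eLpNorm' _ _).1 ((continuous_snd.tendsto p).comp hwlim')
    refine this.congr fun k => ?_
    rw [eLpNorm_sub_comm]
    exact eLpNorm_congr_ae ((hη2 (ns k)).mono fun x hx => by simp [hx])
  have hae' : ∀ᵐ x ∂leb Ω, Filter.Tendsto (fun k => η (ns k) x) Filter.atTop (nhds (p.1 x)) := by
    filter_upwards [hae, ae_all_iff.2 fun k => hη1 (ns k)] with x h1 h2
    exact h1.congr fun k => h2 k
  have hdm' : ∀ k, AEStronglyMeasurable (fun x => deriv G (η (ns k) x)) (leb Ω) := fun k =>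
    (hGd.comp (hη (ns k)).1.continuous).aestronglyMeasurable
  have l3 := tendsto_eLpNorm_smul_of_tendsto_ae (Lp.memLp p.2) (C := C + C)
    (m := fun k x => deriv G (p.1 x) - deriv G (η (ns k) x)) (fun k => hdm.sub (hdm' k))
    (fun k x => (abs_sub _ _).trans (add_le_add (hC _) (hC _))) (by
      filter_upwards [hae'] with x hx
      have := ((hGd.tendsto _).comp hx).const_sub (deriv G (p.1 x))
      rwa [sub_self] at this)
  have b1 : ∀ k, eLpNorm (fun x => G (p.1 x) - G (η (ns k) x)) 2 (leb Ω) ≤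
      ENNReal.ofReal C * eLpNorm (fun x => p.1 x - η (ns k) x) 2 (leb Ω) := fun k =>
    eLpNorm_le_mul_eLpNorm_of_ae_le_mul (.of_forall fun x => hlip _ _) _
  -- The gradient error splits as (G'(p) - G'(η_k)) ∇p + G'(η_k) (∇p - ∇η_k). Dominated convergence
  -- handles the first term, and the bound on G' handles the second.
  have b2 : ∀ k, eLpNorm (fun x => deriv G (p.1 x) • p.2 x - gradient (G ∘ η (ns k)) x) 2 (leb Ω) ≤
      eLpNorm (fun x => (deriv G (p.1 x) - deriv G (η (ns k) x)) • p.2 x) 2 (leb Ω) +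
        ENNReal.ofReal C * eLpNorm (fun x => p.2 x - gradient (η (ns k)) x) 2 (leb Ω) := fun k => by
    have e : (fun x => deriv G (p.1 x) • p.2 x - gradient (G ∘ η (ns k)) x) =
        (fun x => (deriv G (p.1 x) - deriv G (η (ns k) x)) • p.2 x) +
          fun x => deriv G (η (ns k) x) • (p.2 x - gradient (η (ns k)) x) := by
      ext1 x
      rw [(hη (ns k)).gradient_comp hG, Pi.add_apply, sub_smul, smul_sub]
      abel
    rw [e]
    refine (eLpNorm_add_le ((hdm.sub (hdm' k)).smul (Lp.aestronglyMeasurable p.2))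
      ((hdm' k).smul ((Lp.aestronglyMeasurable p.2).sub
        (hη (ns k)).continuous_gradient.aestronglyMeasurable)) (by norm_num)).trans ?_
    refine add_le_add le_rfl
      (eLpNorm_le_mul_eLpNorm_of_ae_le_mul (.of_forall fun x => ?_) _)
    simp only [Pi.smul_apply', norm_smul]
    exact mul_le_mul_of_nonneg_right (hC _) (norm_nonneg _)
  have t1 := tendsto_of_tendsto_of_tendsto_of_le_of_le tendsto_const_nhds
    (by simpa using ENNReal.Tendsto.const_mul l1 (Or.inr (ENNReal.ofReal_ne_top (r := C))))
    (fun k => zero_le) b1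
  have t2 := tendsto_of_tendsto_of_tendsto_of_le_of_le tendsto_const_nhds
    (by simpa using l3.add (ENNReal.Tendsto.const_mul l2
      (Or.inr (ENNReal.ofReal_ne_top (r := C))))) (fun k => zero_le) b2
  rw [mem_dirichletSpace_iff]
  intro ε hε
  obtain ⟨k, h1, h2⟩ := ((t1.eventually_lt_const hε).and (t2.eventually_lt_const hε)).exists
  refine ⟨G ∘ η (ns k), (hη _).comp hG hG0, ?_, ?_⟩
  · refine lt_of_eq_of_lt (eLpNorm_congr_ae ?_) h1
    exact m1.coeFn_toLp.mono fun x hx => by simp only [hx, Function.comp]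
  · refine lt_of_eq_of_lt (eLpNorm_congr_ae ?_) h2
    exact m2.coeFn_toLp.mono fun x hx => by simp only [hx]

end Dirichlet

/-! ### The sub-Markov property of the heat semigroup -/

section SubMarkov

variable {n : ℕ} {Ω : Set (Euc n)} {Λ : ℝ} {a : Euc n → Matrix (Fin n) (Fin n) ℝ} {c : Euc n → ℝ}
  {lam : ℕ → ℝ} {phi : HilbertBasis ℕ ℝ (Lp ℝ 2 (leb Ω))} {W : ℝ → Euc n → Euc n → ℝ}

/-- The function is constant on each side of [1, 2], so its derivative lives on a compact interval.
-/
theorem exists_bound_deriv_smoothTransition :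
    ∃ C, ∀ y, |deriv (fun y => Real.smoothTransition (y - 1)) y| ≤ C := by
  have hG : ContDiff ℝ ∞ fun y => Real.smoothTransition (y - 1) :=
    Real.smoothTransition.contDiff.comp (contDiff_id.sub contDiff_const)
  have hc : Continuous (deriv fun y => Real.smoothTransition (y - 1)) :=
    hG.continuous_deriv (by simp)
  obtain ⟨C, hC⟩ := isCompact_Icc.exists_bound_of_continuousOn (s := Icc (1 : ℝ) 2) hc.continuousOn
  refine ⟨max C 0, fun y => ?_⟩
  by_cases hy : y ∈ Icc (1 : ℝ) 2
  · exact (hC y hy).trans (le_max_left _ _)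
  · have h0 : deriv (fun y => Real.smoothTransition (y - 1)) y = 0 := by
      rcases lt_or_ge y 1 with h | h
      · have : (fun y => Real.smoothTransition (y - 1)) =ᶠ[nhds y] fun _ => 0 := by
          filter_upwards [Iio_mem_nhds h] with z hz
          exact Real.smoothTransition.zero_of_nonpos (by linarith [show z < 1 from hz])
        rw [this.deriv_eq, deriv_const]
      · have h2 : 2 < y := not_le.1 fun h2 => hy ⟨h, h2⟩
        have : (fun y => Real.smoothTransition (y - 1)) =ᶠ[nhds y] fun _ => 1 := by
          filter_upwards [Ioi_mem_nhds h2] with z hz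
          exact Real.smoothTransition.one_of_one_le (by linarith [show 2 < z from hz])
        rw [this.deriv_eq, deriv_const]
    rw [h0, abs_zero]; exact le_max_right _ _

/-- The resolvent of the Dirichlet form preserves the bound `f ≤ 1`. -/
theorem resolvent_le_one (hL : IsEllipticCoeff Ω Λ a c) {ε : ℝ} (hε : 0 < ε)
    {p : Lp ℝ 2 (leb Ω) × Lp (Euc n) 2 (leb Ω)} (hp : p ∈ dirichletSpace Ω) {f : Lp ℝ 2 (leb Ω)}
    (heq : ∀ q ∈ dirichletSpace Ω, inner ℝ p.1 q.1 +
      ε * (energyForm hL p.2 q.2 + potentialForm hL p.1 q.1) = inner ℝ f q.1)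
    (hf : ∀ᵐ x ∂leb Ω, f x ≤ 1) : ∀ᵐ x ∂leb Ω, p.1 x ≤ 1 := by
  -- A smooth substitute for the positive part of y - 1: monotone, zero for y ≤ 1 and positive
  -- beyond, so that G(p) is an admissible test function.
  set G : ℝ → ℝ := fun y => Real.smoothTransition (y - 1) with hGdef
  have hG : ContDiff ℝ ∞ G :=
    Real.smoothTransition.contDiff.comp (contDiff_id.sub contDiff_const)
  have hmono : Monotone G := fun y z h => Real.smoothTransition.monotone (by linarith)
  obtain ⟨C, hC⟩ := exists_bound_deriv_smoothTransition
  obtain ⟨q, hq, hq1, hq2⟩ := exists_comp_mem_dirichletSpace hp hG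
    (Real.smoothTransition.zero_of_nonpos (by norm_num)) hC
  have h := heq q hq
  -- By the chain rule the integrand is G'(p) times the quadratic form at ∇p, and both factors are
  -- nonnegative.
  have e1 : 0 ≤ energyForm hL p.2 q.2 := by
    rw [energyForm_apply]
    refine integral_nonneg_of_ae ?_
    filter_upwards [hq2, hL.matrixForm_bounds] with x h1 h2
    have hΛ := hL.pos
    rw [h1, matrixForm_smul_right]
    exact mul_nonneg hmono.deriv_nonneg (le_trans (by positivity) (h2.1 (p.2 x)))
  have e2 : 0 ≤ potentialForm hL p.1 q.1 := by
    rw [potentialForm_apply]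
    refine integral_nonneg_of_ae ?_
    filter_upwards [hq1, hL.nonneg_c] with x h1 h2
    rw [h1, Function.comp, mul_assoc]
    refine mul_nonneg h2 ?_
    rcases le_total (p.1 x) 1 with h3 | h3
    · rw [show G (p.1 x) = 0 from Real.smoothTransition.zero_of_nonpos (by linarith), mul_zero]
    · exact mul_nonneg (by linarith) (Real.smoothTransition.nonneg _)
  have hpt : ∀ᵐ x ∂leb Ω, 0 ≤ (p.1 x - f x) * q.1 x ∧ (1 < p.1 x → 0 < (p.1 x - f x) * q.1 x) := by
    filter_upwards [hq1, hf] with x h1 h2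
    rw [h1, Function.comp]
    rcases le_or_gt (p.1 x) 1 with h3 | h3
    · rw [show G (p.1 x) = 0 from Real.smoothTransition.zero_of_nonpos (by linarith), mul_zero]
      exact ⟨le_rfl, fun h => absurd h (not_lt.2 h3)⟩
    · have : 0 < (p.1 x - f x) * G (p.1 x) :=
        mul_pos (by linarith) (Real.smoothTransition.pos_of_pos (by linarith))
      exact ⟨this.le, fun _ => this⟩
  have i1 : Integrable (fun x => p.1 x * q.1 x) (leb Ω) :=
    (Lp.memLp p.1).integrable_mul (Lp.memLp q.1)
  have i2 : Integrable (fun x => f x * q.1 x) (leb Ω) :=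
    (Lp.memLp f).integrable_mul (Lp.memLp q.1)
  have e3 : ∫ x in Ω, (p.1 x - f x) * q.1 x = inner ℝ p.1 q.1 - inner ℝ f q.1 := by
    rw [inner_eq_integral, inner_eq_integral, ← integral_sub i1 i2]
    exact integral_congr_ae (.of_forall fun x => by simp only; ring)
  -- The resolvent equation makes this integral -ε times a nonnegative energy, while its integrand
  -- is nonnegative because f ≤ 1 < p wherever G(p) ≠ 0. The vanishing of the integral then excludes
  -- p > 1 on a set of positive measure.
  have e4 : ∫ x in Ω, (p.1 x - f x) * q.1 x = 0 := by
    refine le_antisymm ?_ (integral_nonneg_of_ae (hpt.mono fun x hx => hx.1))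
    rw [e3]
    have := mul_nonneg hε.le (add_nonneg e1 e2)
    linarith
  rw [integral_eq_zero_iff_of_nonneg_ae (hpt.mono fun x hx => hx.1)] at e4
  · filter_upwards [e4, hpt] with x h1 h2
    by_contra h3
    have := h2.2 (not_le.1 h3)
    rw [h1] at this
    exact lt_irrefl _ this
  · exact (i1.sub i2).congr (.of_forall fun x => by simp only [Pi.sub_apply]; ring)

/-- The constant function `1` as an element of `L²(Ω)`. -/
def oneLp (Ω : Set (Euc n)) [IsFiniteMeasure (leb Ω)] : Lp ℝ 2 (leb Ω) :=
  (memLp_const (1 : ℝ)).toLp fun _ => 1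

theorem coeFn_oneLp [IsFiniteMeasure (leb Ω)] : oneLp Ω =ᵐ[leb Ω] fun _ => 1 :=
  (memLp_const (1 : ℝ)).coeFn_toLp

theorem inner_oneLp [IsFiniteMeasure (leb Ω)] (ψ : Lp ℝ 2 (leb Ω)) :
    inner ℝ (oneLp Ω) ψ = ∫ x in Ω, ψ x := by
  rw [inner_eq_integral]
  exact integral_congr_ae (coeFn_oneLp.mono fun x hx => by simp [hx])

/-- The set {f ≤ 1} contains 1 and is stable under the resolvents, and there ⟨f, ψ⟩ ≤ ∫ ψ for ψ ≥ 0,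
so the exponential formula applies. -/
theorem tsum_exp_le_dirichlet [IsFiniteMeasure (leb Ω)] (hL : IsEllipticCoeff Ω Λ a c)
    (hphi : ∀ k, IsEigenfunction Ω a c .dirichlet (lam k) (phi k)) {τ : ℝ} (hτ : 0 < τ)
    {ψ : Lp ℝ 2 (leb Ω)} (hψ : ∀ᵐ x ∂leb Ω, 0 ≤ ψ x) :
    ∑' k, Real.exp (-τ * lam k) * inner ℝ (oneLp Ω) (phi k) * inner ℝ (phi k) ψ ≤
      ∫ x in Ω, ψ x := by
  have hlam : ∀ k, 0 ≤ lam k := fun k => eigenvalue_nonneg hL (hphi k) (phi.orthonormal.1 k)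
  choose g hg heig using hphi
  have hg' : ∀ k, MemH10 Ω (phi k) (g k) := hg
  have heig' : ∀ k, ∀ q ∈ dirichletSpace Ω, energyForm hL ((hg' k).1.2.1.toLp (g k)) q.2 +
      potentialForm hL (phi k) q.1 = lam k * inner ℝ (phi k) q.1 := fun k q hq => by
    have h := heig k q.1 q.2 (memH10_of_mem_dirichletSpace hq)
    rw [energyForm_apply, potentialForm_apply, inner_eq_integral, ← h]
    congr 1
    exact integral_congr_ae ((hg' k).1.2.1.coeFn_toLp.mono fun x hx => by
      simp only [hx, matrixForm])
  refine hasSum_exp_le_of_resolvent phi hlam (S := {f | ∀ᵐ x ∂leb Ω, f x ≤ 1})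
    (fun ε hε f hf => ?_) (coeFn_oneLp.mono fun x hx => hx.le) (fun h hh => ?_) hτ
  · obtain ⟨p, hp, hp1, hp2⟩ := exists_resolvent (isClosed_dirichletSpace (Ω := Ω)) phi hlam
      (inv_pos.2 hL.pos) (energyForm_coercive hL) (potentialForm_self_nonneg hL)
      (fun k => mem_dirichletSpace_of_memH10 (hg' k)) heig' hε f
    exact ⟨p.1, resolvent_le_one hL hε hp hp2 hf, hp1⟩
  · have hh' : ∀ᵐ x ∂leb Ω, h x ≤ 1 := hh
    rw [inner_eq_integral]
    refine integral_mono_ae ((Lp.memLp h).integrable_mul (Lp.memLp ψ))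
      ((Lp.memLp ψ).integrable (by norm_num)) ?_
    filter_upwards [hh', hψ] with x h1 h2
    exact mul_le_of_le_one_left h2 h1

/-- The integral of a partial derivative of a compactly supported function is zero. Under the
Neumann condition this makes 1 an admissible test function. -/
theorem memH1_one [IsFiniteMeasure (leb Ω)] : MemH1 Ω (fun _ => 1) (0 : Euc n → Euc n) := by
  refine ⟨memLp_const 1, MemLp.zero, fun η hη i => ?_⟩
  have c1 : Continuous fun x => fderiv ℝ η x (EuclideanSpace.single i 1) :=
    (hη.1.continuous_fderiv (by simp)).clm_apply continuous_const
  have s1 : HasCompactSupport fun x => fderiv ℝ η x (EuclideanSpace.single i 1) :=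
    (hη.2.1.fderiv (𝕜 := ℝ)).comp_left (g := fun L : Euc n →L[ℝ] ℝ => L (EuclideanSpace.single i 1))
      rfl
  have h := integral_mul_fderiv_eq_neg_fderiv_mul_of_integrable (μ := (volume : Measure (Euc n)))
    (f := fun _ => (1 : ℝ)) (g := η) (v := EuclideanSpace.single i 1) (by simp)
    (by simpa using c1.integrable_of_hasCompactSupport s1)
    (by simpa using hη.1.continuous.integrable_of_hasCompactSupport hη.2.1)
    (fun x _ => by fun_prop) (fun x _ => hη.differentiable x)
  rw [setIntegral_eq_integral_of_forall_compl_eq_zero, h]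
  · simp
  · intro x hx
    rw [image_eq_zero_of_notMem_tsupport (f := fderiv ℝ η) fun h =>
      hx (hη.2.2 (tsupport_fderiv_subset ℝ h))]
    simp

/-- Testing the eigenvalue equation with 1 gives ⟨c, φ_k⟩ = λ_k ⟨1, φ_k⟩, that is, L1 = c.
Integrating the semigroup yields ⟨1, ψ⟩ - ⟨e^(-τL)1, ψ⟩ = ∫_0^τ ⟨e^(-rL)c, ψ⟩ dr, which is
nonnegative because the kernel, c and ψ are. -/
theorem tsum_exp_le_neumann (hΩ : IsOpen Ω) [IsFiniteMeasure (leb Ω)]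
    (hL : IsEllipticCoeff Ω Λ a c)
    (hphi : ∀ k, IsEigenfunction Ω a c .neumann (lam k) (phi k)) (hW : IsHeatKernel lam phi W)
    {τ : ℝ} (hτ : 0 < τ) {ψ : Lp ℝ 2 (leb Ω)} (hψ : ∀ᵐ x ∂leb Ω, 0 ≤ ψ x) :
    ∑' k, Real.exp (-τ * lam k) * inner ℝ (oneLp Ω) (phi k) * inner ℝ (phi k) ψ ≤
      ∫ x in Ω, ψ x := by
  have hlam : ∀ k, 0 ≤ lam k := fun k => eigenvalue_nonneg hL (hphi k) (phi.orthonormal.1 k)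
  obtain ⟨M, -, hM⟩ := hL.exists_bound
  have hc : MemLp c 2 (leb Ω) := MemLp.of_bound hL.meas_c.aestronglyMeasurable M hM
  set C := hc.toLp c
  have hd : ∀ k, inner ℝ C (phi k) = lam k * inner ℝ (oneLp Ω) (phi k) := fun k => by
    obtain ⟨g, -, h⟩ := hphi k
    have := h (fun _ => 1) 0 memH1_one
    rw [inner_oneLp, inner_eq_integral]
    simp only [Pi.zero_apply, PiLp.zero_apply, mul_zero, Finset.sum_const_zero, integral_zero,
      zero_add, mul_one] at this
    rw [← this]
    exact integral_congr_ae (hc.coeFn_toLp.mono fun x hx => by simp only [C, hx])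
  have hsum := phi.summable_inner_mul_inner C ψ
  have hnn : ∀ r : ℝ, 0 < r →
      0 ≤ ∑' k, Real.exp (-r * lam k) * (inner ℝ C (phi k) * inner ℝ (phi k) ψ) := fun r hr => by
    have h := (hW.repr r hr ψ C).tsum_eq
    have e : ∀ k, Real.exp (-r * lam k) * (inner ℝ C (phi k) * inner ℝ (phi k) ψ) =
        Real.exp (-r * lam k) * (∫ x in Ω, ψ x * phi k x) * ∫ x in Ω, C x * phi k x := fun k => by
      rw [← inner_eq_integral, ← inner_eq_integral, real_inner_comm ψ]; ring
    rw [tsum_congr e, h]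
    refine integral_nonneg_of_ae ?_
    filter_upwards [ae_restrict_mem hΩ.measurableSet, hL.nonneg_c, hc.coeFn_toLp] with x h1 h2 h3
    refine integral_nonneg_of_ae ?_
    filter_upwards [ae_restrict_mem hΩ.measurableSet, hψ] with z h4 h5
    exact mul_nonneg (mul_nonneg (hW.nonneg r hr x h1 z h4) h5) (by rw [h3]; exact h2)
  have hint : ∀ k, ∫ r in Ioc 0 τ, Real.exp (-r * lam k) *
      (inner ℝ C (phi k) * inner ℝ (phi k) ψ) =
      (1 - Real.exp (-τ * lam k)) * (inner ℝ (oneLp Ω) (phi k) * inner ℝ (phi k) ψ) := fun k => by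
    have hder : ∀ r ∈ uIcc 0 τ, HasDerivAt (fun r => -Real.exp (-r * lam k))
        (Real.exp (-r * lam k) * lam k) r := fun r _ => by
      have h := (((hasDerivAt_id r).fun_neg.mul_const (lam k)).exp).fun_neg
      exact h.congr_deriv (by simp)
    have h := intervalIntegral.integral_eq_sub_of_hasDerivAt hder
      (by apply Continuous.intervalIntegrable; fun_prop)
    rw [intervalIntegral.integral_of_le hτ.le] at h
    have e : ∀ r, Real.exp (-r * lam k) * (inner ℝ C (phi k) * inner ℝ (phi k) ψ) =
        Real.exp (-r * lam k) * lam k * (inner ℝ (oneLp Ω) (phi k) * inner ℝ (phi k) ψ) :=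
      fun r => by rw [hd]; ring
    simp only [e]
    rw [integral_mul_const, h, neg_zero, zero_mul, Real.exp_zero]
    ring
  have hI : ∀ k, IntegrableOn (fun r => Real.exp (-r * lam k) *
      (inner ℝ C (phi k) * inner ℝ (phi k) ψ)) (Ioc 0 τ) := fun k =>
    (Continuous.integrableOn_Icc (by fun_prop)).mono_set Ioc_subset_Icc_self
  -- The k-th term has integral at most τ |⟨c, φ_k⟩ ⟨φ_k, ψ⟩|, a summable bound, so series and
  -- r-integral commute.
  have key := hasSum_integral_of_summable_integral_norm hI (by
    refine Summable.of_nonneg_of_le (fun k => integral_nonneg fun _ => norm_nonneg _) (fun k => ?_)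
      (hsum.norm.mul_left τ)
    have h := setIntegral_mono_on (hI k).norm (integrableOn_const (by simp)) measurableSet_Ioc
      (g := fun _ => ‖(inner ℝ C (phi k) * inner ℝ (phi k) ψ : ℝ)‖) (fun r hr => by
        rw [norm_mul]
        refine mul_le_of_le_one_left (norm_nonneg _) ?_
        rw [Real.norm_of_nonneg (Real.exp_pos _).le]
        refine Real.exp_le_one_iff.2 ?_
        have := mul_nonneg hr.1.le (hlam k)
        linarith)
    simpa [hτ.le] using h)
  simp only [hint] at key
  have hpos : 0 ≤ ∫ r in Ioc 0 τ, ∑' k, Real.exp (-r * lam k) *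
      (inner ℝ C (phi k) * inner ℝ (phi k) ψ) :=
    setIntegral_nonneg measurableSet_Ioc fun r hr => hnn r hr.1
  rw [← key.tsum_eq] at hpos
  have hs := phi.hasSum_inner_mul_inner (oneLp Ω) ψ
  have hfin := hs.sub key
  rw [← inner_oneLp, ← hs.tsum_eq]
  have : ∑' k, Real.exp (-τ * lam k) * inner ℝ (oneLp Ω) (phi k) * inner ℝ (phi k) ψ =
      (inner ℝ (oneLp Ω) ψ : ℝ) - ∑' k, (1 - Real.exp (-τ * lam k)) *
        (inner ℝ (oneLp Ω) (phi k) * inner ℝ (phi k) ψ) := by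
    rw [key.tsum_eq, ← hfin.tsum_eq]
    exact tsum_congr fun k => by ring
  rw [this, hs.tsum_eq]
  linarith

theorem tsum_exp_le (hΩ : IsOpen Ω) [IsFiniteMeasure (leb Ω)] (hL : IsEllipticCoeff Ω Λ a c)
    {bc : BoundaryCondition} (hphi : ∀ k, IsEigenfunction Ω a c bc (lam k) (phi k))
    (hW : IsHeatKernel lam phi W) {τ : ℝ} (hτ : 0 < τ) {ψ : Lp ℝ 2 (leb Ω)}
    (hψ : ∀ᵐ x ∂leb Ω, 0 ≤ ψ x) :
    ∑' k, Real.exp (-τ * lam k) * inner ℝ (oneLp Ω) (phi k) * inner ℝ (phi k) ψ ≤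
      ∫ x in Ω, ψ x := by
  cases bc with
  | dirichlet => exact tsum_exp_le_dirichlet hL hphi hτ hψ
  | neumann => exact tsum_exp_le_neumann hΩ hL hphi hW hτ hψ

theorem integrable_kernel [IsFiniteMeasure (leb Ω)] (hW : IsHeatKernel lam phi W) {τ : ℝ}
    (hτ : 0 < τ) :
    Integrable (fun p : Euc n × Euc n => W τ p.1 p.2) ((leb Ω).prod (leb Ω)) := by
  refine (hW.integrable τ hτ (oneLp Ω) (oneLp Ω)).congr ?_
  filter_upwards [Measure.quasiMeasurePreserving_fst.ae (coeFn_oneLp (Ω := Ω)),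
    Measure.quasiMeasurePreserving_snd.ae (coeFn_oneLp (Ω := Ω))] with p h1 h2
  rw [h1, h2]; ring

/-- The heat semigroup is sub-Markov: `e^{-τL} 1 ≤ 1`. -/
theorem heatOne_le_one (hΩ : IsOpen Ω) [IsFiniteMeasure (leb Ω)] (hL : IsEllipticCoeff Ω Λ a c)
    {bc : BoundaryCondition} (hphi : ∀ k, IsEigenfunction Ω a c bc (lam k) (phi k))
    (hW : IsHeatKernel lam phi W) {τ : ℝ} (hτ : 0 < τ) :
    ∀ᵐ x ∂leb Ω, heatOne Ω W τ x ≤ 1 := by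
  have hK := integrable_kernel hW hτ
  refine ae_le_of_forall_setIntegral_le (f := heatOne Ω W τ) (g := fun _ => 1)
    hK.integral_prod_left (integrable_const _) fun S hS _ => ?_
  -- With ψ the indicator of S, the spectral inequality reads ∫_S e^(-τL)1 ≤ |S|; letting S vary
  -- gives the almost everywhere bound.
  have hm : MemLp (S.indicator fun _ => (1 : ℝ)) 2 (leb Ω) := (memLp_const 1).indicator hS
  set ψ := hm.toLp _
  have h := tsum_exp_le hΩ hL hphi hW hτ (ψ := ψ) (by
    filter_upwards [hm.coeFn_toLp] with x hx
    rw [hx]; exact indicator_nonneg (fun _ _ => zero_le_one) x)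
  have h2 := (hW.repr τ hτ (oneLp Ω) ψ).tsum_eq
  have e : ∀ k, Real.exp (-τ * lam k) * inner ℝ (oneLp Ω) (phi k) * inner ℝ (phi k) ψ =
      Real.exp (-τ * lam k) * (∫ x in Ω, oneLp Ω x * phi k x) * ∫ x in Ω, ψ x * phi k x :=
    fun k => by rw [← inner_eq_integral, ← inner_eq_integral, real_inner_comm ψ]
  rw [tsum_congr e, h2] at h
  have e1 : ∫ x in Ω, ∫ z in Ω, W τ x z * oneLp Ω z * ψ x = ∫ x in S, heatOne Ω W τ x ∂leb Ω := by
    rw [← integral_indicator hS]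
    refine integral_congr_ae ?_
    filter_upwards [hm.coeFn_toLp] with x hx
    rw [hx, integral_mul_const]
    have : ∫ z in Ω, W τ x z * oneLp Ω z = heatOne Ω W τ x :=
      integral_congr_ae (coeFn_oneLp.mono fun z hz => by simp [hz])
    rw [this]
    by_cases hxS : x ∈ S <;> simp [hxS]
  have e2 : ∫ x in Ω, ψ x = ∫ x in S, 1 ∂leb Ω := by
    rw [← integral_indicator hS]
    exact integral_congr_ae hm.coeFn_toLp
  rwa [e1, e2] at h

theorem heatOne_nonneg (hΩ : IsOpen Ω) (hW : IsHeatKernel lam phi W) {τ : ℝ} (hτ : 0 < τ) :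
    ∀ᵐ x ∂leb Ω, 0 ≤ heatOne Ω W τ x := by
  filter_upwards [ae_restrict_mem hΩ.measurableSet] with x hx
  refine integral_nonneg_of_ae ?_
  filter_upwards [ae_restrict_mem hΩ.measurableSet] with z hz
  exact hW.nonneg τ hτ x hx z hz

end SubMarkov

/-! ### The heat kernel as a measure on `Ω × Ω` -/

section KernelMeasure

variable {n : ℕ} {Ω : Set (Euc n)} {lam : ℕ → ℝ} {phi : HilbertBasis ℕ ℝ (Lp ℝ 2 (leb Ω))}
  {W : ℝ → Euc n → Euc n → ℝ}

/-- The `k`-th coefficient `∫ f φ` of a complex function. -/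
def spatialCoeff (φ : Lp ℝ 2 (leb Ω)) (f : Euc n → ℂ) : ℂ :=
  ∫ x in Ω, f x * (φ x : ℂ)

theorem spatialCoeff_eq (φ : Lp ℝ 2 (leb Ω)) {f : Euc n → ℂ} (hf : MemLp f 2 (leb Ω)) :
    spatialCoeff φ f =
      ((∫ x in Ω, (f x).re * φ x : ℝ) : ℂ) + ((∫ x in Ω, (f x).im * φ x : ℝ) : ℂ) * Complex.I := by
  have h1 : Integrable (fun x => (f x).re * φ x) (leb Ω) := hf.re.integrable_mul (Lp.memLp φ)
  have h2 : Integrable (fun x => (f x).im * φ x) (leb Ω) := hf.im.integrable_mul (Lp.memLp φ)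
  rw [spatialCoeff, ← integral_complex_ofReal, ← integral_complex_ofReal, ← integral_mul_const,
    ← integral_add h1.ofReal (h2.ofReal.mul_const _)]
  refine integral_congr_ae (.of_forall fun x => ?_)
  apply Complex.ext <;> simp

/-- Real and imaginary parts turn a real bilinear expansion into a sesquilinear one. The maps P and
Q let one argument cover Parseval on Ω (both the identity) and the heat kernel on Ω × Ω (the two
projections). -/
theorem hasSum_complex_of_real {X : Type*} [MeasurableSpace X] {ν : Measure X} {P Q : X → Euc n}
    (hP : ∀ f : Euc n → ℝ, MemLp f 2 (leb Ω) → MemLp (fun y => f (P y)) 2 ν)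
    (hQ : ∀ f : Euc n → ℝ, MemLp f 2 (leb Ω) → MemLp (fun y => f (Q y)) 2 ν) {β : ℕ → ℝ}
    (h : ∀ f g : Euc n → ℝ, MemLp f 2 (leb Ω) → MemLp g 2 (leb Ω) →
      HasSum (fun k => β k * (∫ x in Ω, f x * phi k x) * ∫ x in Ω, g x * phi k x)
        (∫ y, f (P y) * g (Q y) ∂ν))
    {f g : Euc n → ℂ} (hf : MemLp f 2 (leb Ω)) (hg : MemLp g 2 (leb Ω)) :
    HasSum (fun k => (β k : ℂ) * spatialCoeff (phi k) f * conj (spatialCoeff (phi k) g))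
      (∫ y, f (P y) * conj (g (Q y)) ∂ν) := by
  have i11 := (hP _ hf.re).integrable_mul (hQ _ hg.re)
  have i22 := (hP _ hf.im).integrable_mul (hQ _ hg.im)
  have i21 := (hP _ hf.im).integrable_mul (hQ _ hg.re)
  have i12 := (hP _ hf.re).integrable_mul (hQ _ hg.im)
  have hre := Complex.hasSum_ofReal.2 ((h _ _ hf.re hg.re).add (h _ _ hf.im hg.im))
  have him := Complex.hasSum_ofReal.2 ((h _ _ hf.im hg.re).sub (h _ _ hf.re hg.im))
  have e : ∫ y, f (P y) * conj (g (Q y)) ∂ν =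
      (((∫ y, (f (P y)).re * (g (Q y)).re ∂ν) + ∫ y, (f (P y)).im * (g (Q y)).im ∂ν : ℝ) : ℂ) +
      (((∫ y, (f (P y)).im * (g (Q y)).re ∂ν) - ∫ y, (f (P y)).re * (g (Q y)).im ∂ν : ℝ) : ℂ) *
        Complex.I := by
    have a1 := integral_add i11 i22
    have a2 := integral_sub i21 i12
    simp only [Pi.mul_apply, RCLike.re_to_complex, RCLike.im_to_complex] at a1 a2
    rw [← a1, ← a2, ← integral_complex_ofReal, ← integral_complex_ofReal, ← integral_mul_const,
      ← integral_add]
    · refine integral_congr_ae (.of_forall fun y => ?_)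
      apply Complex.ext <;> simp <;> ring
    · exact (i11.add i22).ofReal
    · exact ((i21.sub i12).ofReal).mul_const _
  rw [e]
  refine (hre.add (him.mul_right Complex.I)).congr_fun fun k => ?_
  rw [spatialCoeff_eq _ hf, spatialCoeff_eq _ hg]
  apply Complex.ext <;> simp <;> ring

theorem hasSum_spatialCoeff_mul_conj {f g : Euc n → ℂ} (hf : MemLp f 2 (leb Ω))
    (hg : MemLp g 2 (leb Ω)) :
    HasSum (fun k => spatialCoeff (phi k) f * conj (spatialCoeff (phi k) g))
      (∫ x in Ω, f x * conj (g x)) := by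
  have := hasSum_complex_of_real (phi := phi) (ν := leb Ω) (P := id) (Q := id) (β := fun _ => 1)
    (fun f hf => hf) (fun f hf => hf) (fun f g hf hg => ?_) hf hg
  · simpa using this
  · have h := phi.hasSum_inner_mul_inner (hf.toLp f) (hg.toLp g)
    have e : ∀ {f : Euc n → ℝ} (hf : MemLp f 2 (leb Ω)) (w : Lp ℝ 2 (leb Ω)),
        inner ℝ (hf.toLp f) w = ∫ x in Ω, f x * w x := fun hf w => by
      rw [inner_eq_integral]
      exact integral_congr_ae (hf.coeFn_toLp.mono fun x hx => by simp only [hx])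
    have e2 : ∫ x in Ω, f x * hg.toLp g x = ∫ x in Ω, f x * g x :=
      integral_congr_ae (hg.coeFn_toLp.mono fun x hx => by simp only [hx])
    rw [e hf, e2] at h
    refine h.congr_fun fun k => ?_
    rw [e hf, real_inner_comm, e hg, one_mul]

/-- The measure `W_τ(x, z) dx dz` on `Ω × Ω`. -/
def kernelMeasure (Ω : Set (Euc n)) (W : ℝ → Euc n → Euc n → ℝ) (τ : ℝ) :
    Measure (Euc n × Euc n) :=
  ((leb Ω).prod (leb Ω)).withDensity fun p => ENNReal.ofReal (W τ p.1 p.2)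

namespace IsHeatKernel

variable {τ : ℝ}

theorem measurable_slice (hW : IsHeatKernel lam phi W) (τ : ℝ) :
    Measurable fun p : Euc n × Euc n => W τ p.1 p.2 :=
  hW.meas.comp (measurable_const.prodMk measurable_id)

theorem ae_mem_prod (hΩ : IsOpen Ω) :
    ∀ᵐ p ∂(leb Ω).prod (leb Ω), p.1 ∈ Ω ∧ p.2 ∈ Ω := by
  rw [Measure.prod_restrict]
  exact ae_restrict_mem (hΩ.measurableSet.prod hΩ.measurableSet)

theorem integrable_kernelMeasure (hΩ : IsOpen Ω) (hW : IsHeatKernel lam phi W) (hτ : 0 < τ)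
    {F : Euc n × Euc n → ℂ} :
    Integrable F (kernelMeasure Ω W τ) ↔
      Integrable (fun p => (W τ p.1 p.2 : ℂ) * F p) ((leb Ω).prod (leb Ω)) := by
  rw [kernelMeasure, integrable_withDensity_iff_integrable_smul' (hW.measurable_slice τ).ennreal_ofReal
    (by simp)]
  refine integrable_congr ?_
  filter_upwards [ae_mem_prod hΩ] with p hp
  rw [ENNReal.toReal_ofReal (hW.nonneg τ hτ _ hp.1 _ hp.2), Complex.real_smul]

theorem integral_kernelMeasure (hΩ : IsOpen Ω) (hW : IsHeatKernel lam phi W) (hτ : 0 < τ)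
    (F : Euc n × Euc n → ℂ) :
    ∫ p, F p ∂kernelMeasure Ω W τ = ∫ p, (W τ p.1 p.2 : ℂ) * F p ∂(leb Ω).prod (leb Ω) := by
  rw [kernelMeasure, integral_withDensity_eq_integral_toReal_smul (hW.measurable_slice τ).ennreal_ofReal
    (by simp)]
  refine integral_congr_ae ?_
  filter_upwards [ae_mem_prod hΩ] with p hp
  rw [ENNReal.toReal_ofReal (hW.nonneg τ hτ _ hp.1 _ hp.2), Complex.real_smul]

theorem integral_kernelMeasure_real (hΩ : IsOpen Ω) (hW : IsHeatKernel lam phi W) (hτ : 0 < τ)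
    (F : Euc n × Euc n → ℝ) :
    ∫ p, F p ∂kernelMeasure Ω W τ = ∫ p, W τ p.1 p.2 * F p ∂(leb Ω).prod (leb Ω) := by
  rw [kernelMeasure, integral_withDensity_eq_integral_toReal_smul (hW.measurable_slice τ).ennreal_ofReal
    (by simp)]
  refine integral_congr_ae ?_
  filter_upwards [ae_mem_prod hΩ] with p hp
  rw [ENNReal.toReal_ofReal (hW.nonneg τ hτ _ hp.1 _ hp.2), smul_eq_mul]

theorem measurable_heatOne (hW : IsHeatKernel lam phi W) (τ : ℝ) :
    Measurable (heatOne Ω W τ) :=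
  ((hW.measurable_slice τ).stronglyMeasurable.integral_prod_right (ν := leb Ω)).measurable

theorem measurePreserving_swap (hΩ : IsOpen Ω) (hW : IsHeatKernel lam phi W) (hτ : 0 < τ) :
    MeasurePreserving Prod.swap (kernelMeasure Ω W τ) (kernelMeasure Ω W τ) := by
  refine ⟨measurable_swap, Measure.ext fun S hS => ?_⟩
  rw [Measure.map_apply measurable_swap hS, kernelMeasure,
    withDensity_apply _ (measurable_swap hS), withDensity_apply _ hS,
    ← lintegral_indicator hS, ← lintegral_indicator (measurable_swap hS),
    ← lintegral_prod_swap]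
  refine lintegral_congr_ae ?_
  filter_upwards [ae_mem_prod hΩ] with p hp
  by_cases h : p ∈ S
  · have h' : p.swap ∈ Prod.swap ⁻¹' S := by simpa using h
    rw [indicator_of_mem h, indicator_of_mem h']
    simp only [Prod.fst_swap, Prod.snd_swap]
    rw [hW.symm τ hτ _ hp.2 _ hp.1]
  · have h' : p.swap ∉ Prod.swap ⁻¹' S := by simpa using h
    rw [indicator_of_notMem h, indicator_of_notMem h']

theorem map_fst_kernelMeasure [IsFiniteMeasure (leb Ω)] (hΩ : IsOpen Ω)
    (hW : IsHeatKernel lam phi W) (hτ : 0 < τ) :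
    (kernelMeasure Ω W τ).map Prod.fst =
      (leb Ω).withDensity fun x => ENNReal.ofReal (heatOne Ω W τ x) := by
  refine Measure.ext fun S hS => ?_
  have hm := (hW.measurable_slice τ).ennreal_ofReal
  rw [Measure.map_apply measurable_fst hS, kernelMeasure,
    withDensity_apply _ (measurable_fst hS), withDensity_apply _ hS,
    ← lintegral_indicator hS, ← lintegral_indicator (measurable_fst hS),
    lintegral_prod _ ((hm.indicator (measurable_fst hS)).aemeasurable)]
  refine lintegral_congr_ae ?_
  filter_upwards [ae_restrict_mem hΩ.measurableSet, (integrable_kernel hW hτ).prod_right_ae]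
    with x hx hi
  by_cases h : x ∈ S
  · rw [indicator_of_mem h, heatOne, ofReal_integral_eq_lintegral_ofReal hi]
    · refine lintegral_congr fun z => ?_
      rw [indicator_of_mem (show (x, z) ∈ Prod.fst ⁻¹' S from h)]
    · filter_upwards [ae_restrict_mem hΩ.measurableSet] with z hz
      exact hW.nonneg τ hτ x hx z hz
  · rw [indicator_of_notMem h, ← lintegral_zero]
    refine lintegral_congr fun z => ?_
    rw [indicator_of_notMem (show (x, z) ∉ Prod.fst ⁻¹' S from h)]

/-- The marginal has density e^(-τL)1, so this is the sub-Markov bound in the form in which it is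
used: L² functions of one variable are L² for W_τ dx dz. -/
theorem map_fst_kernelMeasure_le [IsFiniteMeasure (leb Ω)] (hΩ : IsOpen Ω)
    (hW : IsHeatKernel lam phi W) (hτ : 0 < τ) (h1 : ∀ᵐ x ∂leb Ω, heatOne Ω W τ x ≤ 1) :
    (kernelMeasure Ω W τ).map Prod.fst ≤ leb Ω := by
  rw [hW.map_fst_kernelMeasure hΩ hτ]
  conv_rhs => rw [← withDensity_one (μ := leb Ω)]
  refine withDensity_mono (h1.mono fun x hx => ?_)
  simpa using hx

theorem memLp_fst [IsFiniteMeasure (leb Ω)] (hΩ : IsOpen Ω)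
    (hW : IsHeatKernel lam phi W) (hτ : 0 < τ) (h1 : ∀ᵐ x ∂leb Ω, heatOne Ω W τ x ≤ 1)
    {F : Type*} [NormedAddCommGroup F] {f : Euc n → F} (hf : MemLp f 2 (leb Ω)) :
    MemLp (fun p : Euc n × Euc n => f p.1) 2 (kernelMeasure Ω W τ) := by
  have h := hf.mono_measure (hW.map_fst_kernelMeasure_le hΩ hτ h1)
  exact h.comp_of_map measurable_fst.aemeasurable

theorem memLp_snd [IsFiniteMeasure (leb Ω)] (hΩ : IsOpen Ω)
    (hW : IsHeatKernel lam phi W) (hτ : 0 < τ) (h1 : ∀ᵐ x ∂leb Ω, heatOne Ω W τ x ≤ 1)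
    {F : Type*} [NormedAddCommGroup F] {f : Euc n → F} (hf : MemLp f 2 (leb Ω)) :
    MemLp (fun p : Euc n × Euc n => f p.2) 2 (kernelMeasure Ω W τ) :=
  (hW.memLp_fst hΩ hτ h1 hf).comp_measurePreserving (hW.measurePreserving_swap hΩ hτ)

theorem integral_swap (hΩ : IsOpen Ω) (hW : IsHeatKernel lam phi W) (hτ : 0 < τ)
    (F : Euc n × Euc n → ℂ) :
    ∫ p, F p.swap ∂kernelMeasure Ω W τ = ∫ p, F p ∂kernelMeasure Ω W τ :=
  (hW.measurePreserving_swap hΩ hτ).integral_comp MeasurableEquiv.prodComm.measurableEmbedding F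

theorem integral_fst [IsFiniteMeasure (leb Ω)] (hΩ : IsOpen Ω)
    (hW : IsHeatKernel lam phi W) (hτ : 0 < τ) (h1 : ∀ᵐ x ∂leb Ω, heatOne Ω W τ x ≤ 1)
    {F : Euc n → ℂ} (hF : AEStronglyMeasurable F (leb Ω)) :
    ∫ p, F p.1 ∂kernelMeasure Ω W τ = ∫ x in Ω, (heatOne Ω W τ x : ℂ) * F x := by
  have hF' := hF.mono_measure (hW.map_fst_kernelMeasure_le hΩ hτ h1)
  rw [← integral_map measurable_fst.aemeasurable hF', hW.map_fst_kernelMeasure hΩ hτ,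
    integral_withDensity_eq_integral_toReal_smul (hW.measurable_heatOne τ).ennreal_ofReal (by simp)]
  refine integral_congr_ae ?_
  filter_upwards [heatOne_nonneg hΩ hW hτ] with x hx
  rw [ENNReal.toReal_ofReal hx, Complex.real_smul]

theorem hasSum_exp_mul [IsFiniteMeasure (leb Ω)] (hΩ : IsOpen Ω)
    (hW : IsHeatKernel lam phi W) (hτ : 0 < τ) (h1 : ∀ᵐ x ∂leb Ω, heatOne Ω W τ x ≤ 1)
    {f g : Euc n → ℂ} (hf : MemLp f 2 (leb Ω)) (hg : MemLp g 2 (leb Ω)) :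
    HasSum (fun k => (Real.exp (-τ * lam k) : ℂ) * spatialCoeff (phi k) f *
      conj (spatialCoeff (phi k) g)) (∫ p, f p.2 * conj (g p.1) ∂kernelMeasure Ω W τ) := by
  refine hasSum_complex_of_real (phi := phi) (β := fun k => Real.exp (-τ * lam k))
    (fun f hf => hW.memLp_snd hΩ hτ h1 hf) (fun f hf => hW.memLp_fst hΩ hτ h1 hf)
    (fun f g hf hg => ?_) hf hg
  have h := hW.repr τ hτ (hf.toLp f) (hg.toLp g)
  have e : ∀ {f : Euc n → ℝ} (hf : MemLp f 2 (leb Ω)) (w : Lp ℝ 2 (leb Ω)),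
      ∫ x in Ω, hf.toLp f x * w x = ∫ x in Ω, f x * w x := fun hf w =>
    integral_congr_ae (hf.coeFn_toLp.mono fun x hx => by simp only [hx])
  simp only [e] at h
  convert h using 1
  rw [hW.integral_kernelMeasure_real hΩ hτ, ← integral_prod
    (f := fun p : Euc n × Euc n => W τ p.1 p.2 * hf.toLp f p.2 * hg.toLp g p.1)
    (hW.integrable τ hτ _ _)]
  refine integral_congr_ae ?_
  filter_upwards [Measure.quasiMeasurePreserving_fst.ae hg.coeFn_toLp,
    Measure.quasiMeasurePreserving_snd.ae hf.coeFn_toLp] with p a b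
  rw [a, b, mul_assoc]

/-- The spatial identity: the form with kernel `W_τ` in terms of `e^{-τL}`. -/
theorem integral_sub_mul_conj_sub [IsFiniteMeasure (leb Ω)] (hΩ : IsOpen Ω)
    (hW : IsHeatKernel lam phi W) (hτ : 0 < τ) (h1 : ∀ᵐ x ∂leb Ω, heatOne Ω W τ x ≤ 1)
    {f g : Euc n → ℂ} (hf : MemLp f 2 (leb Ω)) (hg : MemLp g 2 (leb Ω)) :
    ∫ p, (f p.1 - f p.2) * conj (g p.1 - g p.2) ∂kernelMeasure Ω W τ =
      2 * ((∫ x in Ω, (heatOne Ω W τ x : ℂ) * (f x * conj (g x))) -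
        ∑' k, (Real.exp (-τ * lam k) : ℂ) * spatialCoeff (phi k) f *
          conj (spatialCoeff (phi k) g)) := by
  have f1 := hW.memLp_fst hΩ hτ h1 hf
  have f2 := hW.memLp_snd hΩ hτ h1 hf
  have g1 := (hW.memLp_fst hΩ hτ h1 hg).star
  have g2 := (hW.memLp_snd hΩ hτ h1 hg).star
  have i11 : Integrable (fun p : Euc n × Euc n => f p.1 * conj (g p.1)) (kernelMeasure Ω W τ) :=
    f1.integrable_mul g1
  have i12 : Integrable (fun p : Euc n × Euc n => f p.1 * conj (g p.2)) (kernelMeasure Ω W τ) :=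
    f1.integrable_mul g2
  have i21 : Integrable (fun p : Euc n × Euc n => f p.2 * conj (g p.1)) (kernelMeasure Ω W τ) :=
    f2.integrable_mul g1
  have i22 : Integrable (fun p : Euc n × Euc n => f p.2 * conj (g p.2)) (kernelMeasure Ω W τ) :=
    f2.integrable_mul g2
  have s1 := hW.integral_swap hΩ hτ (fun p => f p.1 * conj (g p.1))
  have s2 := hW.integral_swap hΩ hτ (fun p => f p.2 * conj (g p.1))
  simp only [Prod.fst_swap, Prod.snd_swap] at s1 s2
  -- The swap of variables identifies the two diagonal terms with each other, and likewise the two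
  -- cross terms. This is the source of the factor 2.
  have e : ∀ p : Euc n × Euc n, (f p.1 - f p.2) * conj (g p.1 - g p.2) =
      (f p.1 * conj (g p.1) + f p.2 * conj (g p.2)) -
        (f p.1 * conj (g p.2) + f p.2 * conj (g p.1)) := fun p => by rw [map_sub]; ring
  simp only [e]
  have j1 : Integrable (fun p : Euc n × Euc n => f p.1 * conj (g p.1) + f p.2 * conj (g p.2))
    (kernelMeasure Ω W τ) := i11.add i22
  have j2 : Integrable (fun p : Euc n × Euc n => f p.1 * conj (g p.2) + f p.2 * conj (g p.1))
    (kernelMeasure Ω W τ) := i12.add i21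
  rw [integral_sub j1 j2, integral_add i11 i22, integral_add i12 i21, s1, s2,
    (hW.hasSum_exp_mul hΩ hτ h1 hf hg).tsum_eq,
    hW.integral_fst (F := fun x => f x * conj (g x)) hΩ hτ h1
      (hf.1.mul hg.star.1)]
  ring

theorem integrable_sub_mul_conj_sub [IsFiniteMeasure (leb Ω)] (hΩ : IsOpen Ω)
    (hW : IsHeatKernel lam phi W) (hτ : 0 < τ) (h1 : ∀ᵐ x ∂leb Ω, heatOne Ω W τ x ≤ 1)
    {f g : Euc n → ℂ} (hf : MemLp f 2 (leb Ω)) (hg : MemLp g 2 (leb Ω)) :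
    Integrable (fun p : Euc n × Euc n => (f p.1 - f p.2) * conj (g p.1 - g p.2))
      (kernelMeasure Ω W τ) :=
  ((hW.memLp_fst hΩ hτ h1 hf).sub (hW.memLp_snd hΩ hτ h1 hf)).integrable_mul
    ((hW.memLp_fst hΩ hτ h1 hg).sub (hW.memLp_snd hΩ hτ h1 hg)).star

/-- The energy of the kernel `W_τ` is controlled by `1 - e^{-τL}`. -/
theorem lintegral_sub_sq_le [IsFiniteMeasure (leb Ω)] (hΩ : IsOpen Ω)
    (hW : IsHeatKernel lam phi W) (hlam : ∀ k, 0 ≤ lam k) (hτ : 0 < τ)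
    (h1 : ∀ᵐ x ∂leb Ω, heatOne Ω W τ x ≤ 1) {f : Euc n → ℂ} (hf : MemLp f 2 (leb Ω)) :
    ∫⁻ p, ‖f p.1 - f p.2‖ₑ ^ 2 ∂kernelMeasure Ω W τ ≤
      ∑' k, ENNReal.ofReal (2 * (1 - Real.exp (-τ * lam k))) * ‖spatialCoeff (phi k) f‖ₑ ^ 2 := by
  have hsq : ∀ z : ℂ, z * conj z = ((‖z‖ ^ 2 : ℝ) : ℂ) := fun z => by
    rw [Complex.mul_conj, Complex.normSq_eq_norm_sq]
  have hint := hW.integrable_sub_mul_conj_sub hΩ hτ h1 hf hf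
  have hid := hW.integral_sub_mul_conj_sub hΩ hτ h1 hf hf
  have hs := hasSum_spatialCoeff_mul_conj (phi := phi) hf hf
  have hse := hW.hasSum_exp_mul hΩ hτ h1 hf hf
  have hs' : HasSum (fun k => ‖spatialCoeff (phi k) f‖ ^ 2) (∫ x in Ω, ‖f x‖ ^ 2) := by
    have e : ∫ x in Ω, f x * conj (f x) = ((∫ x in Ω, ‖f x‖ ^ 2 : ℝ) : ℂ) := by
      rw [← integral_complex_ofReal]
      exact integral_congr_ae (.of_forall fun x => hsq _)
    rw [e] at hs
    refine Complex.hasSum_ofReal.1 (hs.congr_fun fun k => (hsq _).symm)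
  have hexp : ∀ k, 0 ≤ 1 - Real.exp (-τ * lam k) := fun k => by
    have : Real.exp (-τ * lam k) ≤ 1 :=
      Real.exp_le_one_iff.2 (by have := mul_nonneg hτ.le (hlam k); linarith)
    linarith
  have hsum1 : Summable fun k => Real.exp (-τ * lam k) * ‖spatialCoeff (phi k) f‖ ^ 2 :=
    hs'.summable.of_nonneg_of_le (fun k => by positivity) fun k =>
      mul_le_of_le_one_left (sq_nonneg _) (by linarith [hexp k])
  have key : ∫ p, ‖f p.1 - f p.2‖ ^ 2 ∂kernelMeasure Ω W τ ≤
      ∑' k, 2 * (1 - Real.exp (-τ * lam k)) * ‖spatialCoeff (phi k) f‖ ^ 2 := by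
    have e1 : ∫ p, (f p.1 - f p.2) * conj (f p.1 - f p.2) ∂kernelMeasure Ω W τ =
        ((∫ p, ‖f p.1 - f p.2‖ ^ 2 ∂kernelMeasure Ω W τ : ℝ) : ℂ) := by
      rw [← integral_complex_ofReal]
      exact integral_congr_ae (.of_forall fun x => hsq _)
    have e2 : ∫ x in Ω, (heatOne Ω W τ x : ℂ) * (f x * conj (f x)) =
        ((∫ x in Ω, heatOne Ω W τ x * ‖f x‖ ^ 2 : ℝ) : ℂ) := by
      rw [← integral_complex_ofReal]
      exact integral_congr_ae (.of_forall fun x => by simp only [hsq]; push_cast; ring)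
    have e3 : ∑' k, (Real.exp (-τ * lam k) : ℂ) * spatialCoeff (phi k) f *
          conj (spatialCoeff (phi k) f) =
        ((∑' k, Real.exp (-τ * lam k) * ‖spatialCoeff (phi k) f‖ ^ 2 : ℝ) : ℂ) := by
      rw [Complex.ofReal_tsum]
      exact tsum_congr fun k => by rw [mul_assoc, hsq]; push_cast; ring
    rw [e1, e2, e3] at hid
    have hid' : ∫ p, ‖f p.1 - f p.2‖ ^ 2 ∂kernelMeasure Ω W τ =
        2 * ((∫ x in Ω, heatOne Ω W τ x * ‖f x‖ ^ 2) -
          ∑' k, Real.exp (-τ * lam k) * ‖spatialCoeff (phi k) f‖ ^ 2) := by exact_mod_cast hid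
    have hn2 : Integrable (fun x => ‖f x‖ ^ 2) (leb Ω) := hf.integrable_norm_pow (by norm_num)
    -- Replacing e^(-τL)1 by 1 is what turns the identity into an inequality; by Parseval the right
    -- side becomes 2 ∑ (1 - e^(-τλ_k)) |f_k|².
    have hle : ∫ x in Ω, heatOne Ω W τ x * ‖f x‖ ^ 2 ≤ ∫ x in Ω, ‖f x‖ ^ 2 := by
      refine integral_mono_of_nonneg ?_ hn2 ?_
      · filter_upwards [heatOne_nonneg hΩ hW hτ] with x hx
        exact mul_nonneg hx (sq_nonneg _)
      · filter_upwards [h1] with x hx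
        exact mul_le_of_le_one_left (sq_nonneg _) hx
    have e4 : ∑' k, 2 * (1 - Real.exp (-τ * lam k)) * ‖spatialCoeff (phi k) f‖ ^ 2 =
        2 * ((∫ x in Ω, ‖f x‖ ^ 2) -
          ∑' k, Real.exp (-τ * lam k) * ‖spatialCoeff (phi k) f‖ ^ 2) := by
      rw [← hs'.tsum_eq, ← (hs'.summable).tsum_sub hsum1, ← tsum_mul_left]
      exact tsum_congr fun k => by ring
    rw [hid', e4]; linarith
  have hint' : Integrable (fun p : Euc n × Euc n => ‖f p.1 - f p.2‖ ^ 2) (kernelMeasure Ω W τ) :=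
    hint.norm.congr (.of_forall fun p => by
      simp only [hsq, Complex.norm_real, Real.norm_of_nonneg (sq_nonneg ‖f p.1 - f p.2‖)])
  have e5 : ∫⁻ p, ‖f p.1 - f p.2‖ₑ ^ 2 ∂kernelMeasure Ω W τ =
      ENNReal.ofReal (∫ p, ‖f p.1 - f p.2‖ ^ 2 ∂kernelMeasure Ω W τ) := by
    rw [ofReal_integral_eq_lintegral_ofReal hint' (.of_forall fun p => sq_nonneg _)]
    refine lintegral_congr fun p => ?_
    rw [ENNReal.ofReal_pow (norm_nonneg _), ofReal_norm]
  rw [e5]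
  refine (ENNReal.ofReal_le_ofReal key).trans (le_of_eq ?_)
  rw [ENNReal.ofReal_tsum_of_nonneg]
  · refine tsum_congr fun k => ?_
    rw [ENNReal.ofReal_mul (by linarith [hexp k]), ENNReal.ofReal_pow (norm_nonneg _), ofReal_norm]
  · exact fun k => mul_nonneg (by linarith [hexp k]) (sq_nonneg _)
  · refine ((hs'.summable.sub hsum1).mul_left 2).congr fun k => by ring

end IsHeatKernel

end KernelMeasure

/-! ### Time-dependent functions -/

section Time

variable {n : ℕ} {Ω : Set (Euc n)} {lam : ℕ → ℝ} {phi : HilbertBasis ℕ ℝ (Lp ℝ 2 (leb Ω))}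
  {W : ℝ → Euc n → Euc n → ℝ} {s : ℝ}

theorem measurable_L2RΩ (u : L2RΩ Ω) : Measurable u :=
  (Lp.stronglyMeasurable u).measurable

theorem lintegral_enorm_sq_lt_top {X : Type*} [MeasurableSpace X] {μ : Measure X}
    {F : Type*} [NormedAddCommGroup F] {f : X → F} (hf : MemLp f 2 μ) :
    ∫⁻ x, ‖f x‖ₑ ^ 2 ∂μ < ⊤ := by
  have := (eLpNorm_lt_top_iff_lintegral_rpow_enorm_lt_top (by norm_num) (by norm_num)).1 hf.2
  simpa using this

theorem memLp_two_of_lintegral_lt_top {X : Type*} [MeasurableSpace X] {μ : Measure X}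
    {F : Type*} [NormedAddCommGroup F] {f : X → F} (hm : AEStronglyMeasurable f μ)
    (hf : ∫⁻ x, ‖f x‖ₑ ^ 2 ∂μ < ⊤) : MemLp f 2 μ := by
  refine ⟨hm, (eLpNorm_lt_top_iff_lintegral_rpow_enorm_lt_top (by norm_num) (by norm_num)).2 ?_⟩
  simpa using hf

theorem ae_memLp_slice (u : L2RΩ Ω) : ∀ᵐ t : ℝ, MemLp (fun x => u (t, x)) 2 (leb Ω) := by
  have h := lintegral_enorm_sq_lt_top (Lp.memLp u)
  have hm : Measurable fun p => ‖u p‖ₑ ^ 2 := (measurable_L2RΩ u).enorm.pow_const 2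
  rw [lintegral_prod _ hm.aemeasurable] at h
  filter_upwards [ae_lt_top hm.lintegral_prod_right' h.ne] with t ht
  exact memLp_two_of_lintegral_lt_top
    ((measurable_L2RΩ u).comp measurable_prodMk_left).aestronglyMeasurable ht

theorem ae_memLp_slice_sub (u : L2RΩ Ω) (τ : ℝ) :
    ∀ᵐ t : ℝ, MemLp (fun x => u (t - τ, x)) 2 (leb Ω) :=
  (measurePreserving_sub_right volume τ).quasiMeasurePreserving.ae (ae_memLp_slice u)

theorem enorm_sq_eq_ofReal (z : ℂ) : ‖z‖ₑ ^ 2 = ENNReal.ofReal (‖z‖ ^ 2) := by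
  rw [ENNReal.ofReal_pow (norm_nonneg _), ofReal_norm]

theorem tsum_lintegral_coeff_lt_top (u : L2RΩ Ω) :
    ∑' k, ∫⁻ t : ℝ, ‖coeff (phi k) u t‖ₑ ^ 2 < ⊤ := by
  have h := lintegral_enorm_sq_lt_top (Lp.memLp u)
  have hm : Measurable fun p => ‖u p‖ₑ ^ 2 := (measurable_L2RΩ u).enorm.pow_const 2
  rw [lintegral_prod _ hm.aemeasurable] at h
  rw [← lintegral_tsum fun k => (memLp_coeff (phi k) u).1.enorm.pow_const 2]
  refine lt_of_le_of_lt (lintegral_mono_ae ?_) h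
  filter_upwards [ae_memLp_slice u] with t ht
  have hsq : ∀ z : ℂ, z * conj z = ((‖z‖ ^ 2 : ℝ) : ℂ) := fun z => by
    rw [Complex.mul_conj, Complex.normSq_eq_norm_sq]
  have hs := hasSum_spatialCoeff_mul_conj (phi := phi) ht ht
  have e : ∫ x in Ω, u (t, x) * conj (u (t, x)) = ((∫ x in Ω, ‖u (t, x)‖ ^ 2 : ℝ) : ℂ) := by
    rw [← integral_complex_ofReal]
    exact integral_congr_ae (.of_forall fun x => hsq _)
  rw [e] at hs
  have hs' : HasSum (fun k => ‖coeff (phi k) u t‖ ^ 2) (∫ x in Ω, ‖u (t, x)‖ ^ 2) :=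
    Complex.hasSum_ofReal.1 (hs.congr_fun fun k => (hsq _).symm)
  refine le_of_eq ?_
  simp only [enorm_sq_eq_ofReal]
  rw [← ENNReal.ofReal_tsum_of_nonneg (fun k => sq_nonneg _) hs'.summable, hs'.tsum_eq,
    ofReal_integral_eq_lintegral_ofReal (ht.integrable_norm_pow (by norm_num))
      (.of_forall fun x => sq_nonneg _)]

theorem coeffHat_eq_unitaryFourier (φ : Lp ℝ 2 (leb Ω)) (u : L2RΩ Ω) :
    coeffHat φ u = unitaryFourier ((memLp_coeff φ u).toLp (coeff φ u)) := rfl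

theorem measurable_coeffHat (φ : Lp ℝ 2 (leb Ω)) (u : L2RΩ Ω) : Measurable (coeffHat φ u) :=
  measurable_unitaryFourier _

theorem lintegral_coeffHat (φ : Lp ℝ 2 (leb Ω)) (u : L2RΩ Ω) :
    ∫⁻ ρ : ℝ, ‖coeffHat φ u ρ‖ₑ ^ 2 = ∫⁻ t : ℝ, ‖coeff φ u t‖ₑ ^ 2 := by
  rw [coeffHat_eq_unitaryFourier, lintegral_unitaryFourier]
  exact lintegral_congr_ae ((memLp_coeff φ u).coeFn_toLp.mono fun t ht => by simp only [ht])

/-- The symbol `iρ + λ` of `∂_t + L` on an eigenspace. -/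
def symbol (l ρ : ℝ) : ℂ := Complex.I * (ρ : ℂ) + (l : ℂ)

theorem symbol_re (l ρ : ℝ) : (symbol l ρ).re = l := by simp [symbol]

theorem measurable_symbol (l : ℝ) : Measurable (symbol l) := by unfold symbol; fun_prop

theorem tsum_lintegral_symbol_lt_top {u : L2RΩ Ω} (hu : u ∈ Dom lam phi s) :
    ∑' k, ∫⁻ ρ : ℝ, ENNReal.ofReal (‖symbol (lam k) ρ‖ ^ s * ‖coeffHat (phi k) u ρ‖ ^ 2) < ⊤ := by
  rw [← lintegral_tsum fun k => ?_]
  · exact hu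
  · exact ((((measurable_symbol (lam k)).norm.pow_const s).mul
      ((measurable_coeffHat (phi k) u).norm.pow_const 2)).ennreal_ofReal).aemeasurable

/-- Since λ_k = Re(iρ + λ_k) ≤ |iρ + λ_k|, membership in `Dom` controls the purely spatial energy,
and Plancherel returns from ρ to t. -/
theorem tsum_rpow_mul_lintegral_coeff_lt_top (hs0 : 0 < s) (hlam : ∀ k, 0 ≤ lam k) {u : L2RΩ Ω}
    (hu : u ∈ Dom lam phi s) :
    ∑' k, ENNReal.ofReal (lam k ^ s) * ∫⁻ t : ℝ, ‖coeff (phi k) u t‖ₑ ^ 2 < ⊤ := by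
  refine lt_of_le_of_lt (ENNReal.tsum_le_tsum fun k => ?_) (tsum_lintegral_symbol_lt_top hu)
  rw [← lintegral_coeffHat, ← lintegral_const_mul _
    ((measurable_coeffHat (phi k) u).enorm.pow_const 2)]
  refine lintegral_mono fun ρ => ?_
  rw [enorm_sq_eq_ofReal, ← ENNReal.ofReal_mul (Real.rpow_nonneg (hlam k) s)]
  refine ENNReal.ofReal_le_ofReal (mul_le_mul_of_nonneg_right ?_ (sq_nonneg _))
  refine Real.rpow_le_rpow (hlam k) ?_ hs0.le
  exact (symbol_re (lam k) ρ).symm.trans_le (Complex.re_le_norm _)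

/-- The density `K_s(τ, x, z)` on `(0, ∞) × ℝ × Ω × Ω`. -/
def masterMeasure (Ω : Set (Euc n)) (W : ℝ → Euc n → Euc n → ℝ) (s : ℝ) :
    Measure (ℝ × ℝ × Euc n × Euc n) :=
  ((volume.restrict (Ioi 0)).prod (volume.prod ((leb Ω).prod (leb Ω)))).withDensity
    fun p => ENNReal.ofReal (masterKernel W s p.1 p.2.2.1 p.2.2.2)

theorem measurable_masterKernel (hW : IsHeatKernel lam phi W) (s : ℝ) :
    Measurable fun p : ℝ × ℝ × Euc n × Euc n => masterKernel W s p.1 p.2.2.1 p.2.2.2 := by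
  have h1 : Measurable fun p : ℝ × ℝ × Euc n × Euc n => W p.1 p.2.2.1 p.2.2.2 :=
    hW.meas.comp (measurable_fst.prodMk (measurable_snd.comp measurable_snd))
  unfold masterKernel
  exact h1.div (measurable_const.mul (measurable_fst.pow_const _))

/-- The finite difference `u(t - rτ, x) - u(t - rτ, z)`. -/
def spaceDiff (u : L2RΩ Ω) (r : ℝ) (p : ℝ × ℝ × Euc n × Euc n) : ℂ :=
  u (p.2.1 - r * p.1, p.2.2.1) - u (p.2.1 - r * p.1, p.2.2.2)

theorem measurable_spaceDiff (u : L2RΩ Ω) (r : ℝ) : Measurable (spaceDiff u r) :=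
  ((measurable_L2RΩ u).comp (by fun_prop)).sub ((measurable_L2RΩ u).comp (by fun_prop))

/-- Translation invariance in t removes the shift, and the energy bound for W_τ applies to almost
every time slice. -/
theorem lintegral_time_energy_le [IsFiniteMeasure (leb Ω)] (hΩ : IsOpen Ω)
    (hW : IsHeatKernel lam phi W) (hlam : ∀ k, 0 ≤ lam k) {τ : ℝ} (hτ : 0 < τ)
    (h1 : ∀ᵐ x ∂leb Ω, heatOne Ω W τ x ≤ 1) (u : L2RΩ Ω) (r : ℝ) :
    ∫⁻ t : ℝ, ∫⁻ q, ‖u (t - r, q.1) - u (t - r, q.2)‖ₑ ^ 2 ∂kernelMeasure Ω W τ ≤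
      ∑' k, ENNReal.ofReal (2 * (1 - Real.exp (-τ * lam k))) *
        ∫⁻ t : ℝ, ‖coeff (phi k) u t‖ₑ ^ 2 := by
  rw [lintegral_sub_right_eq_self
    (fun t => ∫⁻ q, ‖u (t, q.1) - u (t, q.2)‖ₑ ^ 2 ∂kernelMeasure Ω W τ) r]
  have hm : ∀ k, AEMeasurable (fun t => ‖coeff (phi k) u t‖ₑ ^ 2) volume := fun k =>
    (memLp_coeff (phi k) u).1.enorm.pow_const 2
  simp only [fun k => (lintegral_const_mul'' (ENNReal.ofReal (2 * (1 - Real.exp (-τ * lam k))))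
    (hm k)).symm]
  rw [← lintegral_tsum fun k => (hm k).const_mul _]
  refine lintegral_mono_ae ?_
  filter_upwards [ae_memLp_slice u] with t ht
  exact hW.lintegral_sub_sq_le hΩ hlam hτ h1 ht

/-- At lag τ the 2 in K_s cancels the 2 of the energy bound, leaving |Γ(-s)|⁻¹ τ^(-1-s) (1 -
e^(-τλ_k)): the Balakrishnan integrand at the real point λ_k. Its τ-integral is at most a multiple
of λ_k^s. -/
theorem lintegral_spaceDiff_lt_top [IsFiniteMeasure (leb Ω)] (hΩ : IsOpen Ω)
    (hW : IsHeatKernel lam phi W) (hlam : ∀ k, 0 ≤ lam k)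
    (h1 : ∀ τ, 0 < τ → ∀ᵐ x ∂leb Ω, heatOne Ω W τ x ≤ 1) (hs0 : 0 < s) (hs1 : s < 1)
    {u : L2RΩ Ω} (hu : u ∈ Dom lam phi s) (r : ℝ) :
    ∫⁻ p, ‖spaceDiff u r p‖ₑ ^ 2 ∂masterMeasure Ω W s < ⊤ := by
  have hm1 := (measurable_masterKernel hW s).ennreal_ofReal
  have hm2 := (measurable_spaceDiff u r).enorm.pow_const 2
  have hm := hm1.mul hm2
  set A : ℕ → ℝ≥0∞ := fun k => ∫⁻ t : ℝ, ‖coeff (phi k) u t‖ₑ ^ 2 with hA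
  have hg := abs_Gamma_neg_pos hs0 hs1
  set Γ := |Real.Gamma (-s)| with hΓ
  have inner : ∀ τ : ℝ, 0 < τ → ∫⁻ q : ℝ × Euc n × Euc n,
      ENNReal.ofReal (masterKernel W s τ q.2.1 q.2.2) * ‖spaceDiff u r (τ, q)‖ₑ ^ 2
        ∂(volume.prod ((leb Ω).prod (leb Ω))) ≤
      ∑' k, ENNReal.ofReal Γ⁻¹ * ‖balakrishnan s (lam k) τ‖ₑ * A k := fun τ hτ => by
    have hc : 0 ≤ (2 * Γ * τ ^ (1 + s))⁻¹ := by positivity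
    have hmτ : Measurable fun q : ℝ × Euc n × Euc n =>
        ENNReal.ofReal (masterKernel W s τ q.2.1 q.2.2) * ‖spaceDiff u r (τ, q)‖ₑ ^ 2 :=
      hm.comp measurable_prodMk_left
    rw [lintegral_prod _ hmτ.aemeasurable]
    have e : ∀ t : ℝ, ∫⁻ q : Euc n × Euc n, ENNReal.ofReal (masterKernel W s τ q.1 q.2) *
        ‖spaceDiff u r (τ, t, q)‖ₑ ^ 2 ∂((leb Ω).prod (leb Ω)) =
        ENNReal.ofReal (2 * Γ * τ ^ (1 + s))⁻¹ *
          ∫⁻ q, ‖u (t - r * τ, q.1) - u (t - r * τ, q.2)‖ₑ ^ 2 ∂kernelMeasure Ω W τ := fun t => by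
      have hd : Measurable fun q : Euc n × Euc n =>
          ‖u (t - r * τ, q.1) - u (t - r * τ, q.2)‖ₑ ^ 2 :=
        (((measurable_L2RΩ u).comp (by fun_prop)).sub
          ((measurable_L2RΩ u).comp (by fun_prop))).enorm.pow_const 2
      have hw := (hW.measurable_slice τ).ennreal_ofReal
      rw [kernelMeasure, lintegral_withDensity_eq_lintegral_mul _ hw hd,
        ← lintegral_const_mul _ (hw.mul hd)]
      refine lintegral_congr fun q => ?_
      rw [masterKernel, div_eq_mul_inv, ENNReal.ofReal_mul' hc, Pi.mul_apply, spaceDiff]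
      ring
    rw [lintegral_congr e, lintegral_const_mul' _ _ ENNReal.ofReal_ne_top]
    refine (mul_le_mul_right (lintegral_time_energy_le hΩ hW hlam hτ (h1 τ hτ) u (r * τ))
      _).trans (le_of_eq ?_)
    rw [← ENNReal.tsum_mul_left]
    refine tsum_congr fun k => ?_
    rw [← mul_assoc]
    congr 1
    have hexp : 0 ≤ 1 - Real.exp (-τ * lam k) := by
      have : Real.exp (-τ * lam k) ≤ 1 :=
        Real.exp_le_one_iff.2 (by have := mul_nonneg hτ.le (hlam k); linarith)
      linarith
    have hb : ‖balakrishnan s (lam k) τ‖ = τ ^ (-1 - s) * (1 - Real.exp (-τ * lam k)) := by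
      have : balakrishnan s (lam k) τ = ((τ ^ (-1 - s) * (1 - Real.exp (-τ * lam k)) : ℝ) : ℂ) := by
        rw [balakrishnan]; push_cast; ring_nf
      rw [this, Complex.norm_real, Real.norm_of_nonneg (mul_nonneg (by positivity) hexp)]
    rw [← ofReal_norm, hb, ← ENNReal.ofReal_mul hc, ← ENNReal.ofReal_mul (by positivity)]
    congr 1
    rw [show -1 - s = -(1 + s) by ring, Real.rpow_neg hτ.le]
    field_simp
  rw [masterMeasure, lintegral_withDensity_eq_lintegral_mul _ hm1 hm2,
    lintegral_prod _ hm.aemeasurable]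
  have step : ∫⁻ τ in Ioi (0 : ℝ), ∫⁻ q : ℝ × Euc n × Euc n,
      ENNReal.ofReal (masterKernel W s τ q.2.1 q.2.2) * ‖spaceDiff u r (τ, q)‖ₑ ^ 2
        ∂(volume.prod ((leb Ω).prod (leb Ω))) ≤
      ∫⁻ τ in Ioi (0 : ℝ), ∑' k, ENNReal.ofReal Γ⁻¹ * ‖balakrishnan s (lam k) τ‖ₑ * A k :=
    lintegral_mono_ae ((ae_restrict_mem measurableSet_Ioi).mono inner)
  refine lt_of_le_of_lt step ?_
  have hmb : ∀ k, Measurable fun τ => ‖balakrishnan s (lam k) τ‖ₑ := fun k =>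
    (measurable_balakrishnan s (lam k)).enorm
  rw [lintegral_tsum fun k => (((hmb k).const_mul _).mul_const _).aemeasurable]
  set C := 2 * (1 / (1 - s) + 1 / s) with hC
  have hC0 : 0 ≤ C := by
    have : 0 < 1 - s := by linarith
    positivity
  have hk : ∀ k, ∫⁻ τ in Ioi (0 : ℝ), ENNReal.ofReal Γ⁻¹ * ‖balakrishnan s (lam k) τ‖ₑ * A k ≤
      ENNReal.ofReal (Γ⁻¹ * C) * (ENNReal.ofReal (lam k ^ s) * A k) := fun k => by
    have hb := integrableOn_balakrishnan hs0 hs1 (z := lam k) (by simpa using hlam k)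
    rw [lintegral_mul_const _ ((hmb k).const_mul _), lintegral_const_mul _ (hmb k),
      ← ofReal_integral_norm_eq_lintegral_enorm hb.1, ENNReal.ofReal_mul (by positivity), mul_assoc,
      mul_assoc]
    refine mul_le_mul_right ?_ _
    rw [← mul_assoc]
    refine mul_le_mul_left ?_ _
    rw [← ENNReal.ofReal_mul hC0]
    refine ENNReal.ofReal_le_ofReal (hb.2.trans (le_of_eq ?_))
    rw [Complex.norm_real, Real.norm_of_nonneg (hlam k)]
  refine lt_of_le_of_lt (ENNReal.tsum_le_tsum hk) ?_
  rw [ENNReal.tsum_mul_left]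
  exact ENNReal.mul_lt_top ENNReal.ofReal_lt_top
    (tsum_rpow_mul_lintegral_coeff_lt_top hs0 hlam hu)

/-- Absolute convergence of the integral against `K_s`. -/
theorem integrable_masterKernel_mul [IsFiniteMeasure (leb Ω)] (hΩ : IsOpen Ω)
    (hW : IsHeatKernel lam phi W) (hlam : ∀ k, 0 ≤ lam k)
    (h1 : ∀ τ, 0 < τ → ∀ᵐ x ∂leb Ω, heatOne Ω W τ x ≤ 1) (hs0 : 0 < s) (hs1 : s < 1)
    {u v : L2RΩ Ω} (hu : u ∈ Dom lam phi s) (hv : v ∈ Dom lam phi s) :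
    Integrable (fun p : ℝ × ℝ × Euc n × Euc n =>
        (masterKernel W s p.1 p.2.2.1 p.2.2.2 : ℂ) *
          (u (p.2.1 - p.1, p.2.2.1) - u (p.2.1 - p.1, p.2.2.2)) *
          conj (v (p.2.1, p.2.2.1) - v (p.2.1, p.2.2.2)))
      ((volume.restrict (Ioi 0)).prod (volume.prod ((leb Ω).prod (leb Ω)))) := by
  -- The difference of u is taken at time t - τ (r = 1) and that of v at time t (r = 0). Both are L²
  -- for the density K_s, so their product is integrable.
  have mu : MemLp (spaceDiff u 1) 2 (masterMeasure Ω W s) :=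
    memLp_two_of_lintegral_lt_top (measurable_spaceDiff u 1).aestronglyMeasurable
      (lintegral_spaceDiff_lt_top hΩ hW hlam h1 hs0 hs1 hu 1)
  have mv : MemLp (spaceDiff v 0) 2 (masterMeasure Ω W s) :=
    memLp_two_of_lintegral_lt_top (measurable_spaceDiff v 0).aestronglyMeasurable
      (lintegral_spaceDiff_lt_top hΩ hW hlam h1 hs0 hs1 hv 0)
  have h := mu.integrable_mul mv.star
  rw [masterMeasure, integrable_withDensity_iff_integrable_smul'
    (measurable_masterKernel hW s).ennreal_ofReal (by simp)] at h
  refine h.congr ?_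
  have hae : ∀ᵐ p : ℝ × ℝ × Euc n × Euc n ∂((volume.restrict (Ioi 0)).prod
      (volume.prod ((leb Ω).prod (leb Ω)))), 0 < p.1 ∧ p.2.2.1 ∈ Ω ∧ p.2.2.2 ∈ Ω := by
    have a1 := Measure.quasiMeasurePreserving_fst (μ := volume.restrict (Ioi (0 : ℝ)))
      (ν := (volume : Measure ℝ).prod ((leb Ω).prod (leb Ω))) |>.ae
        (ae_restrict_mem measurableSet_Ioi)
    have a2 := Measure.quasiMeasurePreserving_snd (μ := volume.restrict (Ioi (0 : ℝ)))
      (ν := (volume : Measure ℝ).prod ((leb Ω).prod (leb Ω))) |>.ae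
        (Measure.quasiMeasurePreserving_snd.ae (IsHeatKernel.ae_mem_prod hΩ))
    filter_upwards [a1, a2] with p b1 b2
    exact ⟨b1, b2⟩
  filter_upwards [hae] with p hp
  have hk : 0 ≤ masterKernel W s p.1 p.2.2.1 p.2.2.2 := by
    have := hW.nonneg p.1 hp.1 _ hp.2.1 _ hp.2.2
    have h2 := Real.rpow_nonneg hp.1.le (1 + s)
    unfold masterKernel
    positivity
  rw [ENNReal.toReal_ofReal hk, Complex.real_smul, mul_assoc]
  simp [spaceDiff]

end Time

/-! ### The spectral side -/

section Spectral

variable {n : ℕ} {Ω : Set (Euc n)} {lam : ℕ → ℝ} {phi : HilbertBasis ℕ ℝ (Lp ℝ 2 (leb Ω))}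
  {W : ℝ → Euc n → Euc n → ℝ} {s : ℝ}

/-- One absolute bound supplies everything needed to exchange a series with an integral. It is used
in t, in τ and in ρ. -/
theorem hasSum_integral_of_tsum_lintegral {X : Type*} [MeasurableSpace X] {μ : Measure X}
    {G : ℕ → X → ℂ} (hm : ∀ k, AEStronglyMeasurable (G k) μ)
    (h : ∑' k, ∫⁻ x, ‖G k x‖ₑ ∂μ < ⊤) :
    (∀ k, Integrable (G k) μ) ∧ Integrable (fun x => ∑' k, G k x) μ ∧
      HasSum (fun k => ∫ x, G k x ∂μ) (∫ x, ∑' k, G k x ∂μ) := by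
  have hi : ∀ k, Integrable (G k) μ := fun k => ⟨hm k, (ENNReal.le_tsum k).trans_lt h⟩
  have hl : ∫⁻ x, ∑' k, ‖G k x‖ₑ ∂μ < ⊤ := by
    rwa [lintegral_tsum fun k => (hm k).enorm]
  have hsum : ∀ᵐ x ∂μ, Summable fun k => G k x := by
    filter_upwards [ae_lt_top' (AEMeasurable.tsum fun k => (hm k).enorm) hl.ne] with x hx
    have h2 := ENNReal.summable_toReal hx.ne
    simp only [toReal_enorm] at h2
    exact h2.of_norm
  refine ⟨hi, ⟨?_, ?_⟩, hasSum_integral_of_summable_integral_norm hi ?_⟩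
  · refine aestronglyMeasurable_of_tendsto_ae Filter.atTop
      (f := fun N x => ∑ k ∈ Finset.range N, G k x)
      (fun N => Finset.aestronglyMeasurable_fun_sum _ fun k _ => hm k) ?_
    filter_upwards [hsum] with x hx
    exact hx.hasSum.tendsto_sum_nat
  · refine lt_of_le_of_lt (lintegral_mono_ae ?_) hl
    exact .of_forall fun x => enorm_tsum_le_tsum_enorm
  · have h2 := ENNReal.summable_toReal h.ne
    refine h2.congr fun k => ?_
    rw [integral_norm_eq_lintegral_enorm (hm k)]

theorem enorm_mul_conj_le (z w : ℂ) : ‖z * conj w‖ₑ ≤ ‖z‖ₑ ^ 2 + ‖w‖ₑ ^ 2 := by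
  rw [enorm_sq_eq_ofReal, enorm_sq_eq_ofReal, ← ENNReal.ofReal_add (by positivity) (by positivity),
    ← ofReal_norm]
  refine ENNReal.ofReal_le_ofReal ?_
  rw [norm_mul, RCLike.norm_conj]
  nlinarith [sq_nonneg (‖z‖ - ‖w‖), sq_nonneg ‖z‖, sq_nonneg ‖w‖]

/-- Plancherel's identity for the coefficients of two functions, one of them translated. -/
theorem hasSum_integral_coeff (u v : L2RΩ Ω) {β : ℕ → ℝ} (hβ : ∀ k, |β k| ≤ 1) (τ : ℝ) :
    Integrable (fun t : ℝ =>
      ∑' k, (β k : ℂ) * coeff (phi k) u (t - τ) * conj (coeff (phi k) v t)) ∧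
    HasSum (fun k => (β k : ℂ) * ∫ ρ : ℝ, Complex.exp (-(τ * (Complex.I * ρ))) *
        coeffHat (phi k) u ρ * conj (coeffHat (phi k) v ρ))
      (∫ t : ℝ, ∑' k, (β k : ℂ) * coeff (phi k) u (t - τ) * conj (coeff (phi k) v t)) := by
  have hu := fun k => (memLp_coeff (phi k) u).comp_measurePreserving
    (measurePreserving_sub_right volume τ)
  have hv := fun k => memLp_coeff (phi k) v
  obtain ⟨-, h2, h3⟩ := hasSum_integral_of_tsum_lintegral (μ := (volume : Measure ℝ))
    (G := fun k t => (β k : ℂ) * coeff (phi k) u (t - τ) * conj (coeff (phi k) v t))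
    (fun k => ((hu k).1.const_mul _).mul (hv k).star.1) (by
      have hk : ∀ k, ∫⁻ t : ℝ, ‖(β k : ℂ) * coeff (phi k) u (t - τ) * conj (coeff (phi k) v t)‖ₑ ≤
          (∫⁻ t : ℝ, ‖coeff (phi k) u t‖ₑ ^ 2) + ∫⁻ t : ℝ, ‖coeff (phi k) v t‖ₑ ^ 2 := fun k => by
        rw [← lintegral_sub_right_eq_self (fun t => ‖coeff (phi k) u t‖ₑ ^ 2) τ,
          ← lintegral_add_right' _ ((hv k).1.enorm.pow_const 2)]
        refine lintegral_mono fun t => ?_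
        rw [mul_assoc, enorm_mul]
        refine (mul_le_of_le_one_left zero_le ?_).trans (enorm_mul_conj_le _ _)
        rw [← ofReal_norm, Complex.norm_real, Real.norm_eq_abs]
        exact ENNReal.ofReal_le_one.2 (hβ k)
      refine lt_of_le_of_lt (ENNReal.tsum_le_tsum hk) ?_
      rw [ENNReal.tsum_add]
      exact ENNReal.add_lt_top.2 ⟨tsum_lintegral_coeff_lt_top u, tsum_lintegral_coeff_lt_top v⟩)
  refine ⟨h2, h3.congr_fun fun k => ?_⟩
  simp only [mul_assoc]
  rw [integral_const_mul]
  congr 1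
  have h := integral_translate_mul_conj ((memLp_coeff (phi k) u).toLp _)
    ((memLp_coeff (phi k) v).toLp _) τ
  have e : ∫ t : ℝ, coeff (phi k) u (t - τ) * conj (coeff (phi k) v t) =
      ∫ t : ℝ, (memLp_coeff (phi k) u).toLp _ (t - τ) * conj ((memLp_coeff (phi k) v).toLp _ t) := by
    refine integral_congr_ae ?_
    filter_upwards [(measurePreserving_sub_right volume τ).quasiMeasurePreserving.ae
      (memLp_coeff (phi k) u).coeFn_toLp, (memLp_coeff (phi k) v).coeFn_toLp] with t h1 h2
    rw [h1, h2]
  rw [e, h]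
  simp only [mul_assoc, coeffHat_eq_unitaryFourier]

theorem integrable_coeffHat_mul (φ : Lp ℝ 2 (leb Ω)) (u v : L2RΩ Ω) :
    Integrable fun ρ : ℝ => coeffHat φ u ρ * conj (coeffHat φ v ρ) := by
  have h : ∀ u : L2RΩ Ω, MemLp (coeffHat φ u) 2 volume := fun u =>
    memLp_two_of_lintegral_lt_top (measurable_coeffHat φ u).aestronglyMeasurable (by
      rw [lintegral_coeffHat]; exact lintegral_enorm_sq_lt_top (memLp_coeff φ u))
  exact (h u).integrable_mul (h v).star

theorem tsum_lintegral_symbol_mul_lt_top {u v : L2RΩ Ω} (hu : u ∈ Dom lam phi s)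
    (hv : v ∈ Dom lam phi s) :
    ∑' k, ∫⁻ ρ : ℝ, ENNReal.ofReal (‖symbol (lam k) ρ‖ ^ s) *
      ‖coeffHat (phi k) u ρ * conj (coeffHat (phi k) v ρ)‖ₑ < ⊤ := by
  have hm : ∀ (v : L2RΩ Ω) k, Measurable fun ρ : ℝ => ENNReal.ofReal
      (‖symbol (lam k) ρ‖ ^ s * ‖coeffHat (phi k) v ρ‖ ^ 2) := fun v k =>
    (((measurable_symbol (lam k)).norm.pow_const s).mul
      ((measurable_coeffHat (phi k) v).norm.pow_const 2)).ennreal_ofReal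
  have hk : ∀ k, ∫⁻ ρ : ℝ, ENNReal.ofReal (‖symbol (lam k) ρ‖ ^ s) *
      ‖coeffHat (phi k) u ρ * conj (coeffHat (phi k) v ρ)‖ₑ ≤
      (∫⁻ ρ : ℝ, ENNReal.ofReal (‖symbol (lam k) ρ‖ ^ s * ‖coeffHat (phi k) u ρ‖ ^ 2)) +
      ∫⁻ ρ : ℝ, ENNReal.ofReal (‖symbol (lam k) ρ‖ ^ s * ‖coeffHat (phi k) v ρ‖ ^ 2) := fun k => by
    rw [← lintegral_add_right _ (hm v k)]
    refine lintegral_mono fun ρ => ?_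
    have h0 : 0 ≤ ‖symbol (lam k) ρ‖ ^ s := Real.rpow_nonneg (norm_nonneg _) _
    rw [ENNReal.ofReal_mul h0, ENNReal.ofReal_mul h0, ← mul_add, ← enorm_sq_eq_ofReal,
      ← enorm_sq_eq_ofReal]
    exact mul_le_mul_right (enorm_mul_conj_le _ _) _
  refine lt_of_le_of_lt (ENNReal.tsum_le_tsum hk) ?_
  rw [ENNReal.tsum_add]
  exact ENNReal.add_lt_top.2 ⟨tsum_lintegral_symbol_lt_top hu, tsum_lintegral_symbol_lt_top hv⟩

/-- The integrand of the Balakrishnan formula, integrated against the coefficients. -/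
def spectralDensity (lam : ℕ → ℝ) (phi : HilbertBasis ℕ ℝ (Lp ℝ 2 (leb Ω))) (s : ℝ) (u v : L2RΩ Ω)
    (k : ℕ) (τ : ℝ) : ℂ :=
  ∫ ρ : ℝ, balakrishnan s (symbol (lam k) ρ) τ *
    (coeffHat (phi k) u ρ * conj (coeffHat (phi k) v ρ))

theorem norm_cpow_ofReal (hs0 : 0 < s) (z : ℂ) : ‖z ^ (s : ℂ)‖ = ‖z‖ ^ s := by
  rcases eq_or_ne z 0 with rfl | hz
  · rw [Complex.zero_cpow (by exact_mod_cast hs0.ne'), norm_zero, Real.zero_rpow hs0.ne']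
  · rw [Complex.norm_cpow_of_ne_zero hz]; simp

/-- For each k, Fubini in (τ, ρ) is licensed by the bound C |iρ + λ_k|^s on the absolute τ-integral,
and the sum over k of these bounds is finite by membership in `Dom`. The formula for z^s then
evaluates the τ-integral. -/
theorem fracPairing_eq_integral (hlam : ∀ k, 0 ≤ lam k) (hs0 : 0 < s) (hs1 : s < 1)
    {u v : L2RΩ Ω} (hu : u ∈ Dom lam phi s) (hv : v ∈ Dom lam phi s) :
    IntegrableOn (fun τ => ∑' k, spectralDensity lam phi s u v k τ) (Ioi 0) ∧
      ∫ τ in Ioi 0, ∑' k, spectralDensity lam phi s u v k τ =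
        (|Real.Gamma (-s)| : ℝ) * fracPairing lam phi s u v := by
  set w : ℕ → ℝ → ℂ := fun k ρ => coeffHat (phi k) u ρ * conj (coeffHat (phi k) v ρ) with hw
  have hwm : ∀ k, Measurable (w k) := fun k => (measurable_coeffHat (phi k) u).mul
    (Complex.continuous_conj.measurable.comp (measurable_coeffHat (phi k) v))
  have hfin := tsum_lintegral_symbol_mul_lt_top hu hv
  set C := 2 * (1 / (1 - s) + 1 / s) with hC
  have hC0 : 0 ≤ C := by
    have : 0 < 1 - s := by linarith
    positivity
  have hFm : ∀ k, Measurable fun p : ℝ × ℝ => balakrishnan s (symbol (lam k) p.2) p.1 * w k p.2 :=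
    fun k => by
      refine Measurable.mul ?_ ((hwm k).comp measurable_snd)
      unfold balakrishnan symbol
      fun_prop
  have hF : ∀ k, ∫⁻ τ in Ioi (0 : ℝ), ∫⁻ ρ : ℝ, ‖balakrishnan s (symbol (lam k) ρ) τ * w k ρ‖ₑ ≤
      ENNReal.ofReal C * ∫⁻ ρ : ℝ, ENNReal.ofReal (‖symbol (lam k) ρ‖ ^ s) * ‖w k ρ‖ₑ := fun k => by
    rw [lintegral_lintegral_swap (hFm k).enorm.aemeasurable,
      ← lintegral_const_mul' _ _ ENNReal.ofReal_ne_top]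
    refine lintegral_mono fun ρ => ?_
    have hb := integrableOn_balakrishnan hs0 hs1 (z := symbol (lam k) ρ)
      (by rw [symbol_re]; exact hlam k)
    simp only [enorm_mul]
    rw [lintegral_mul_const _ (measurable_balakrishnan s _).enorm, ← mul_assoc,
      ← ofReal_integral_norm_eq_lintegral_enorm hb.1, ← ENNReal.ofReal_mul hC0]
    exact mul_le_mul_left (ENNReal.ofReal_le_ofReal hb.2) _
  have hFsum : ∑' k, ∫⁻ τ in Ioi (0 : ℝ), ∫⁻ ρ : ℝ,
      ‖balakrishnan s (symbol (lam k) ρ) τ * w k ρ‖ₑ < ⊤ := by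
    refine lt_of_le_of_lt (ENNReal.tsum_le_tsum hF) ?_
    rw [ENNReal.tsum_mul_left]
    exact ENNReal.mul_lt_top ENNReal.ofReal_lt_top hfin
  have hFi : ∀ k, Integrable (fun p : ℝ × ℝ => balakrishnan s (symbol (lam k) p.2) p.1 * w k p.2)
      ((volume.restrict (Ioi 0)).prod volume) := fun k => by
    refine ⟨(hFm k).aestronglyMeasurable, ?_⟩
    rw [HasFiniteIntegral, lintegral_prod _ (hFm k).enorm.aemeasurable]
    exact (ENNReal.le_tsum k).trans_lt hFsum
  obtain ⟨-, g2, g3⟩ := hasSum_integral_of_tsum_lintegral (μ := volume.restrict (Ioi (0 : ℝ)))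
    (G := fun k τ => spectralDensity lam phi s u v k τ)
    (fun k => (hFi k).integral_prod_left.aestronglyMeasurable) (by
      refine lt_of_le_of_lt (ENNReal.tsum_le_tsum fun k => ?_) hFsum
      exact lintegral_mono fun τ => enorm_integral_le_lintegral_enorm _)
  refine ⟨g2, ?_⟩
  obtain ⟨-, -, r3⟩ := hasSum_integral_of_tsum_lintegral (μ := (volume : Measure ℝ))
    (G := fun k ρ => (symbol (lam k) ρ) ^ (s : ℂ) * w k ρ)
    (fun k => (((measurable_symbol (lam k)).pow_const _).mul (hwm k)).aestronglyMeasurable) (by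
      refine lt_of_le_of_lt (ENNReal.tsum_le_tsum fun k => ?_) hfin
      refine lintegral_mono fun ρ => ?_
      rw [enorm_mul, ← ofReal_norm (_ ^ _), norm_cpow_ofReal hs0])
  have hk : ∀ k, ∫ τ in Ioi 0, spectralDensity lam phi s u v k τ =
      (|Real.Gamma (-s)| : ℝ) * ∫ ρ, (symbol (lam k) ρ) ^ (s : ℂ) * w k ρ := fun k => by
    simp only [spectralDensity]
    rw [integral_integral_swap (hFi k), ← integral_const_mul]
    refine integral_congr_ae (.of_forall fun ρ => ?_)
    simp only
    rw [integral_mul_const, integral_balakrishnan hs0 hs1 (by rw [symbol_re]; exact hlam k),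
      mul_assoc]
  rw [← g3.tsum_eq, tsum_congr hk, tsum_mul_left, r3.tsum_eq, fracPairing]
  congr 1
  refine integral_congr_ae (.of_forall fun ρ => tsum_congr fun k => ?_)
  rw [hw, symbol, ← mul_assoc]

/-- The exponential e^(-τ(iρ + λ_k)) is the semigroup factor e^(-τλ_k) times the phase of a
translation by τ. The constant 1 of the integrand is the same situation with unit factors and zero
translation. -/
theorem tsum_spectralDensity (hlam : ∀ k, 0 ≤ lam k) (u v : L2RΩ Ω) {τ : ℝ} (hτ : 0 < τ) :
    ∑' k, spectralDensity lam phi s u v k τ = ((τ ^ (-1 - s) : ℝ) : ℂ) *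
      ((∫ t : ℝ, ∑' k, coeff (phi k) u t * conj (coeff (phi k) v t)) -
        ∫ t : ℝ, ∑' k, (Real.exp (-τ * lam k) : ℂ) * coeff (phi k) u (t - τ) *
          conj (coeff (phi k) v t)) := by
  have h0 := (hasSum_integral_coeff (phi := phi) u v (β := fun _ => 1) (by simp) 0).2
  have h1 := (hasSum_integral_coeff (phi := phi) u v (β := fun k => Real.exp (-τ * lam k))
    (fun k => by
      rw [abs_of_pos (Real.exp_pos _)]
      exact Real.exp_le_one_iff.2 (by have := mul_nonneg hτ.le (hlam k); linarith)) τ).2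
  simp only [Complex.ofReal_one, one_mul, sub_zero, Complex.ofReal_zero, zero_mul, neg_zero,
    Complex.exp_zero] at h0
  rw [← h0.tsum_eq, ← h1.tsum_eq, ← h0.summable.tsum_sub h1.summable, ← tsum_mul_left]
  refine tsum_congr fun k => ?_
  have hi := integrable_coeffHat_mul (phi k) u v
  have hi2 : Integrable fun ρ : ℝ => Complex.exp (-(τ * (Complex.I * ρ))) *
      coeffHat (phi k) u ρ * conj (coeffHat (phi k) v ρ) := by
    refine (hi.bdd_mul (f := fun ρ : ℝ => Complex.exp (-(τ * (Complex.I * ρ)))) (c := 1) ?_ ?_).congr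
      (.of_forall fun ρ => (mul_assoc _ _ _).symm)
    · exact Measurable.aestronglyMeasurable (by fun_prop)
    · refine .of_forall fun ρ => ?_
      rw [Complex.norm_exp]; simp
  rw [← integral_const_mul, ← integral_sub hi (hi2.const_mul _), ← integral_const_mul,
    spectralDensity]
  refine integral_congr_ae (.of_forall fun ρ => ?_)
  simp only [balakrishnan, symbol]
  have : Complex.exp (-(τ * (Complex.I * ρ + lam k))) =
      (Real.exp (-τ * lam k) : ℂ) * Complex.exp (-(τ * (Complex.I * ρ))) := by
    rw [Complex.ofReal_exp, ← Complex.exp_add]; congr 1; push_cast; ring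
  rw [this]; ring

end Spectral

/-! ### The identity at a fixed time lag -/

section FixedLag

variable {n : ℕ} {Ω : Set (Euc n)} {lam : ℕ → ℝ} {phi : HilbertBasis ℕ ℝ (Lp ℝ 2 (leb Ω))}
  {W : ℝ → Euc n → Euc n → ℝ} {s τ : ℝ}

theorem memLp_shift (u : L2RΩ Ω) (τ : ℝ) :
    MemLp (fun p : ℝ × Euc n => u (p.1 - τ, p.2)) 2 ((volume : Measure ℝ).prod (leb Ω)) :=
  (Lp.memLp u).comp_measurePreserving
    ((measurePreserving_sub_right volume τ).prod (MeasurePreserving.id (leb Ω)))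

theorem integrable_shift_mul_conj (u v : L2RΩ Ω) (τ : ℝ) :
    Integrable (fun p : ℝ × Euc n => u (p.1 - τ, p.2) * conj (v p))
      ((volume : Measure ℝ).prod (leb Ω)) :=
  (memLp_shift u τ).integrable_mul (Lp.memLp v).star

theorem integrable_mul_conj (u v : L2RΩ Ω) :
    Integrable (fun p : ℝ × Euc n => u p * conj (v p)) ((volume : Measure ℝ).prod (leb Ω)) :=
  (Lp.memLp u).integrable_mul (Lp.memLp v).star

theorem integrable_heatOne_mul (hΩ : IsOpen Ω) (hW : IsHeatKernel lam phi W) (hτ : 0 < τ)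
    (h1 : ∀ᵐ x ∂leb Ω, heatOne Ω W τ x ≤ 1) {F : ℝ × Euc n → ℂ}
    (hF : Integrable F ((volume : Measure ℝ).prod (leb Ω))) :
    Integrable (fun p : ℝ × Euc n => (heatOne Ω W τ p.2 : ℂ) * F p)
      ((volume : Measure ℝ).prod (leb Ω)) := by
  refine hF.bdd_mul (c := 1) ?_ ?_
  · exact (Complex.measurable_ofReal.comp
      ((hW.measurable_heatOne τ).comp measurable_snd)).aestronglyMeasurable
  · filter_upwards [Measure.quasiMeasurePreserving_snd.ae (h1.and (heatOne_nonneg hΩ hW hτ))]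
      with p hp
    rw [Complex.norm_real, Real.norm_of_nonneg hp.2]
    exact hp.1

theorem integrable_bracket_left (hΩ : IsOpen Ω) (hW : IsHeatKernel lam phi W) (hτ : 0 < τ)
    (h1 : ∀ᵐ x ∂leb Ω, heatOne Ω W τ x ≤ 1) (u v : L2RΩ Ω) :
    Integrable (fun p : ℝ × Euc n =>
        (((1 - heatOne Ω W τ p.2) / (|Real.Gamma (-s)| * τ ^ (1 + s)) : ℝ) : ℂ) * u p * conj (v p))
      ((volume : Measure ℝ).prod (leb Ω)) := by
  have hi := integrable_mul_conj u v
  refine ((hi.sub (integrable_heatOne_mul hΩ hW hτ h1 hi)).const_mul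
    (((|Real.Gamma (-s)| * τ ^ (1 + s))⁻¹ : ℝ) : ℂ)).congr (.of_forall fun p => ?_)
  simp only [Pi.sub_apply, div_eq_mul_inv]
  push_cast; ring

theorem integrable_bracket_right (hΩ : IsOpen Ω) (hW : IsHeatKernel lam phi W) (hτ : 0 < τ)
    (h1 : ∀ᵐ x ∂leb Ω, heatOne Ω W τ x ≤ 1) (u v : L2RΩ Ω) :
    Integrable (fun p : ℝ × Euc n => (heatOne Ω W τ p.2 : ℂ) *
        ((u (p.1 - τ, p.2) - u p) / ((|Real.Gamma (-s)| * τ ^ (1 + s) : ℝ) : ℂ)) * conj (v p))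
      ((volume : Measure ℝ).prod (leb Ω)) := by
  have hi := (integrable_shift_mul_conj u v τ).sub (integrable_mul_conj u v)
  refine ((integrable_heatOne_mul hΩ hW hτ h1 hi).const_mul
    (((|Real.Gamma (-s)| * τ ^ (1 + s))⁻¹ : ℝ) : ℂ)).congr (.of_forall fun p => ?_)
  simp only [Pi.sub_apply, div_eq_mul_inv]
  push_cast; ring

/-- With h = e^(-τL)1, the terms ± h u conj(v) cancel in (1 - h) u conj(v) - h (u(t - τ) - u)
conj(v). -/
theorem bracket_eq (hΩ : IsOpen Ω) (hW : IsHeatKernel lam phi W) (hτ : 0 < τ)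
    (h1 : ∀ᵐ x ∂leb Ω, heatOne Ω W τ x ≤ 1) (u v : L2RΩ Ω) :
    (∫ t : ℝ, ∫ x in Ω,
      (((1 - heatOne Ω W τ x) / (|Real.Gamma (-s)| * τ ^ (1 + s)) : ℝ) : ℂ) * u (t, x) *
        conj (v (t, x))) -
    (∫ t : ℝ, ∫ x in Ω, (heatOne Ω W τ x : ℂ) *
        ((u (t - τ, x) - u (t, x)) / ((|Real.Gamma (-s)| * τ ^ (1 + s) : ℝ) : ℂ)) *
          conj (v (t, x))) =
    (((|Real.Gamma (-s)| * τ ^ (1 + s))⁻¹ : ℝ) : ℂ) *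
      ((∫ t : ℝ, ∫ x in Ω, u (t, x) * conj (v (t, x))) -
        ∫ t : ℝ, ∫ x in Ω, (heatOne Ω W τ x : ℂ) * (u (t - τ, x) * conj (v (t, x)))) := by
  have hi := integrable_mul_conj u v
  have hs := integrable_heatOne_mul hΩ hW hτ h1 (integrable_shift_mul_conj u v τ)
  have l := integrable_bracket_left (s := s) hΩ hW hτ h1 u v
  have r := integrable_bracket_right (s := s) hΩ hW hτ h1 u v
  rw [← integral_prod (f := fun p : ℝ × Euc n => (((1 - heatOne Ω W τ p.2) /
      (|Real.Gamma (-s)| * τ ^ (1 + s)) : ℝ) : ℂ) * u p * conj (v p)) l,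
    ← integral_prod (f := fun p : ℝ × Euc n => (heatOne Ω W τ p.2 : ℂ) *
      ((u (p.1 - τ, p.2) - u p) / ((|Real.Gamma (-s)| * τ ^ (1 + s) : ℝ) : ℂ)) * conj (v p)) r,
    ← integral_prod (f := fun p : ℝ × Euc n => u p * conj (v p)) hi,
    ← integral_prod (f := fun p : ℝ × Euc n =>
      (heatOne Ω W τ p.2 : ℂ) * (u (p.1 - τ, p.2) * conj (v p))) hs,
    ← integral_sub l r, ← integral_sub hi hs, ← integral_const_mul]
  refine integral_congr_ae (.of_forall fun p => ?_)
  simp only [div_eq_mul_inv]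
  push_cast; ring

/-- This is the spatial identity at almost every t with f = u(t - τ, ·) and g = v(t, ·); its factor
2 is absorbed by the 2 in K_s. -/
theorem kernel_integral_eq [IsFiniteMeasure (leb Ω)] (hΩ : IsOpen Ω) (hW : IsHeatKernel lam phi W)
    (hlam : ∀ k, 0 ≤ lam k) (hτ : 0 < τ) (h1 : ∀ᵐ x ∂leb Ω, heatOne Ω W τ x ≤ 1)
    (u v : L2RΩ Ω) :
    ∫ t : ℝ, ∫ x in Ω, ∫ z in Ω, (masterKernel W s τ x z : ℂ) *
        (u (t - τ, x) - u (t - τ, z)) * conj (v (t, x) - v (t, z)) =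
    (((|Real.Gamma (-s)| * τ ^ (1 + s))⁻¹ : ℝ) : ℂ) *
      ((∫ t : ℝ, ∫ x in Ω, (heatOne Ω W τ x : ℂ) * (u (t - τ, x) * conj (v (t, x)))) -
        ∫ t : ℝ, ∑' k, (Real.exp (-τ * lam k) : ℂ) * coeff (phi k) u (t - τ) *
          conj (coeff (phi k) v t)) := by
  have hs := integrable_heatOne_mul hΩ hW hτ h1 (integrable_shift_mul_conj u v τ)
  have hc := (hasSum_integral_coeff (phi := phi) u v (β := fun k => Real.exp (-τ * lam k))
    (fun k => by
      rw [abs_of_pos (Real.exp_pos _)]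
      exact Real.exp_le_one_iff.2 (by have := mul_nonneg hτ.le (hlam k); linarith)) τ).1
  rw [← integral_sub hs.integral_prod_left hc, ← integral_const_mul]
  refine integral_congr_ae ?_
  filter_upwards [ae_memLp_slice_sub u τ, ae_memLp_slice v] with t hu hv
  have hint := (hW.integrable_kernelMeasure hΩ hτ).1
    (hW.integrable_sub_mul_conj_sub hΩ hτ h1 hu hv)
  have hid := hW.integral_sub_mul_conj_sub hΩ hτ h1 hu hv
  rw [hW.integral_kernelMeasure hΩ hτ, integral_prod _ hint] at hid
  have e : ∀ x z, (masterKernel W s τ x z : ℂ) * (u (t - τ, x) - u (t - τ, z)) *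
      conj (v (t, x) - v (t, z)) = (((2 * (|Real.Gamma (-s)| * τ ^ (1 + s)))⁻¹ : ℝ) : ℂ) *
        ((W τ x z : ℂ) * ((u (t - τ, x) - u (t - τ, z)) * conj (v (t, x) - v (t, z)))) :=
    fun x z => by
      rw [masterKernel, div_eq_mul_inv, mul_assoc 2]; push_cast; ring
  simp only [e, integral_const_mul]
  rw [hid, mul_inv]
  simp only [coeff, spatialCoeff]
  push_cast; ring

theorem integral_coeff_mul_conj (u v : L2RΩ Ω) :
    ∫ t : ℝ, ∑' k, coeff (phi k) u t * conj (coeff (phi k) v t) =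
      ∫ t : ℝ, ∫ x in Ω, u (t, x) * conj (v (t, x)) := by
  refine integral_congr_ae ?_
  filter_upwards [ae_memLp_slice u, ae_memLp_slice v] with t hu hv
  exact (hasSum_spatialCoeff_mul_conj hu hv).tsum_eq

/-- The kernel part and the bracket contain e^(-τL)1 u(t - τ) conj(v) with opposite signs. What
remains is ⟨u, v⟩ - ⟨e^(-τL) u(· - τ), v⟩, the spectral integrand. -/
theorem kernel_add_bracket [IsFiniteMeasure (leb Ω)] (hΩ : IsOpen Ω) (hW : IsHeatKernel lam phi W)
    (hlam : ∀ k, 0 ≤ lam k) (hτ : 0 < τ) (h1 : ∀ᵐ x ∂leb Ω, heatOne Ω W τ x ≤ 1)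
    (u v : L2RΩ Ω) :
    (∫ t : ℝ, ∫ x in Ω, ∫ z in Ω, (masterKernel W s τ x z : ℂ) *
        (u (t - τ, x) - u (t - τ, z)) * conj (v (t, x) - v (t, z))) +
    ((∫ t : ℝ, ∫ x in Ω,
      (((1 - heatOne Ω W τ x) / (|Real.Gamma (-s)| * τ ^ (1 + s)) : ℝ) : ℂ) * u (t, x) *
        conj (v (t, x))) -
    (∫ t : ℝ, ∫ x in Ω, (heatOne Ω W τ x : ℂ) *
        ((u (t - τ, x) - u (t, x)) / ((|Real.Gamma (-s)| * τ ^ (1 + s) : ℝ) : ℂ)) *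
          conj (v (t, x)))) =
    ((|Real.Gamma (-s)|⁻¹ : ℝ) : ℂ) * ∑' k, spectralDensity lam phi s u v k τ := by
  rw [bracket_eq hΩ hW hτ h1, kernel_integral_eq hΩ hW hlam hτ h1, tsum_spectralDensity hlam u v hτ,
    integral_coeff_mul_conj, show -1 - s = -(1 + s) by ring, Real.rpow_neg hτ.le, mul_inv]
  push_cast; ring

end FixedLag

end MasterEquation

end

/-! ### Integration over the time lag -/

theorem mainTheorem5 {n : ℕ} (Ω : Set (MasterEquation.Euc n)) (hΩ : IsOpen Ω)
    (hΩb : Bornology.IsBounded Ω) (Λ : ℝ)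
    (a : MasterEquation.Euc n → Matrix (Fin n) (Fin n) ℝ) (c : MasterEquation.Euc n → ℝ)
    (hL : MasterEquation.IsEllipticCoeff Ω Λ a c) (bc : MasterEquation.BoundaryCondition)
    (lam : ℕ → ℝ) (phi : HilbertBasis ℕ ℝ (Lp ℝ 2 (MasterEquation.leb Ω)))
    (hphi : ∀ k, MasterEquation.IsEigenfunction Ω a c bc (lam k) (phi k))
    (W : ℝ → MasterEquation.Euc n → MasterEquation.Euc n → ℝ)
    (hW : MasterEquation.IsHeatKernel lam phi W)
    (s : ℝ) (hs0 : 0 < s) (hs1 : s < 1) (u v : MasterEquation.L2RΩ Ω)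
    (hu : u ∈ MasterEquation.Dom lam phi s) (hv : v ∈ MasterEquation.Dom lam phi s) :
    -- the first integral converges absolutely
    Integrable (fun p : ℝ × ℝ × MasterEquation.Euc n × MasterEquation.Euc n =>
        (MasterEquation.masterKernel W s p.1 p.2.2.1 p.2.2.2 : ℂ) *
          (u (p.2.1 - p.1, p.2.2.1) - u (p.2.1 - p.1, p.2.2.2)) *
          conj (v (p.2.1, p.2.2.1) - v (p.2.1, p.2.2.2)))
      ((volume.restrict (Ioi 0)).prod
        (volume.prod ((MasterEquation.leb Ω).prod (MasterEquation.leb Ω)))) ∧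
    -- so do the integrals over `ℝ × Ω` in the second one, for each `τ > 0`
    (∀ τ : ℝ, 0 < τ →
      Integrable (fun p : ℝ × MasterEquation.Euc n =>
          (((1 - MasterEquation.heatOne Ω W τ p.2) /
            (|Real.Gamma (-s)| * τ ^ (1 + s)) : ℝ) : ℂ) * u p * conj (v p))
        (volume.prod (MasterEquation.leb Ω)) ∧
      Integrable (fun p : ℝ × MasterEquation.Euc n =>
          (MasterEquation.heatOne Ω W τ p.2 : ℂ) *
            ((u (p.1 - τ, p.2) - u p) / ((|Real.Gamma (-s)| * τ ^ (1 + s) : ℝ) : ℂ)) *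
            conj (v p))
        (volume.prod (MasterEquation.leb Ω))) ∧
    -- and the integral over `τ`
    IntegrableOn (fun τ : ℝ =>
        (∫ t : ℝ, ∫ x in Ω,
          (((1 - MasterEquation.heatOne Ω W τ x) /
            (|Real.Gamma (-s)| * τ ^ (1 + s)) : ℝ) : ℂ) * u (t, x) * conj (v (t, x))) -
        ∫ t : ℝ, ∫ x in Ω,
          (MasterEquation.heatOne Ω W τ x : ℂ) *
            ((u (t - τ, x) - u (t, x)) / ((|Real.Gamma (-s)| * τ ^ (1 + s) : ℝ) : ℂ)) *
            conj (v (t, x)))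
      (Ioi 0) ∧
    MasterEquation.fracPairing lam phi s u v =
      (∫ τ in Ioi (0 : ℝ), ∫ t : ℝ, ∫ x in Ω, ∫ z in Ω,
        (MasterEquation.masterKernel W s τ x z : ℂ) *
          (u (t - τ, x) - u (t - τ, z)) * conj (v (t, x) - v (t, z))) +
      ∫ τ in Ioi (0 : ℝ),
        ((∫ t : ℝ, ∫ x in Ω,
          (((1 - MasterEquation.heatOne Ω W τ x) /
            (|Real.Gamma (-s)| * τ ^ (1 + s)) : ℝ) : ℂ) * u (t, x) * conj (v (t, x))) -
        ∫ t : ℝ, ∫ x in Ω,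
          (MasterEquation.heatOne Ω W τ x : ℂ) *
            ((u (t - τ, x) - u (t, x)) / ((|Real.Gamma (-s)| * τ ^ (1 + s) : ℝ) : ℂ)) *
            conj (v (t, x))) := by
  have : IsFiniteMeasure (MasterEquation.leb Ω) := MasterEquation.isFiniteMeasure_leb hΩb
  have hlam : ∀ k, 0 ≤ lam k := fun k =>
    MasterEquation.eigenvalue_nonneg hL (hphi k) (phi.orthonormal.1 k)
  have h1 : ∀ τ, 0 < τ → ∀ᵐ x ∂MasterEquation.leb Ω, MasterEquation.heatOne Ω W τ x ≤ 1 :=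
    fun τ hτ => MasterEquation.heatOne_le_one hΩ hL hphi hW hτ
  have hK := MasterEquation.integrable_masterKernel_mul hΩ hW hlam h1 hs0 hs1 hu hv
  obtain ⟨hS, hSeq⟩ := MasterEquation.fracPairing_eq_integral hlam hs0 hs1 hu hv
  have hg := MasterEquation.abs_Gamma_neg_pos hs0 hs1
  have hJ : IntegrableOn (fun τ : ℝ => ∫ t : ℝ, ∫ x in Ω, ∫ z in Ω,
      (MasterEquation.masterKernel W s τ x z : ℂ) *
        (u (t - τ, x) - u (t - τ, z)) * conj (v (t, x) - v (t, z))) (Ioi 0) := by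
    -- Fubini identifies the iterated integral with the one over the product for almost every τ and
    -- t, which suffices here.
    refine hK.integral_prod_left.congr ?_
    filter_upwards [hK.prod_right_ae] with τ h2
    rw [integral_prod _ h2]
    refine integral_congr_ae ?_
    filter_upwards [h2.prod_right_ae] with t h3
    rw [integral_prod _ h3]
  have hsum := fun τ (hτ : 0 < τ) =>
    MasterEquation.kernel_add_bracket (s := s) hΩ hW hlam hτ (h1 τ hτ) u v
  -- The two terms of the bracket are not estimated separately in τ: the bracket equals the spectral
  -- integrand minus the kernel integral, both already integrable.
  have hB := ((hS.const_mul ((|Real.Gamma (-s)|⁻¹ : ℝ) : ℂ)).sub hJ).congr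
    ((ae_restrict_mem measurableSet_Ioi).mono fun τ hτ => by
      rw [Pi.sub_apply, ← hsum τ hτ, add_sub_cancel_left])
  refine ⟨hK, fun τ hτ => ⟨MasterEquation.integrable_bracket_left hΩ hW hτ (h1 τ hτ) u v,
    MasterEquation.integrable_bracket_right hΩ hW hτ (h1 τ hτ) u v⟩, hB, ?_⟩
  rw [← integral_add hJ hB, setIntegral_congr_fun measurableSet_Ioi hsum, integral_const_mul, hSeq,
    ← mul_assoc, ← Complex.ofReal_mul, inv_mul_cancel₀ hg.ne', Complex.ofReal_one, one_mul]
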